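/- **Setting.** Let $\mathbb S^3$ be the unit sphere in $\mathbb R^4$ with its surface measure (total mass $2\pi^2$), $\operatorname{dist}$ the spherical distance, and $K$ an oriented closed two-dimensional simplicial manifold. A *polyhedron* of type $K$ in $\mathbb S^3$ is given by points $P(v)\in\mathbb S^3$ for the vertices $v$ of $K$ such that $P(v_0),P(v_1),P(v_2)$ are linearly independent for every $2$-simplex $[v_0,v_1,v_2]$. For linearly independent points of $\mathbb S^3$ put $V_{\mathrm{or}}(c_0,c_1,c_2,c_3)=\operatorname{sgn}\det(c_0,c_1,c_2,c_3)\cdot\operatorname{vol}(c_0c_1c_2c_3)$, where $c_0c_1c_2c_3$ is the spherical tetrahedron. The *oriented volume* of $P$ is $$V_{\mathrm{or}}(P)=\sum_{[v_0,v_1,v_2]}V_{\mathrm{or}}(o,P(v_0),P(v_1),P(v_2))\in\mathbb R/2\pi^2\mathbb Z,$$ the sum being over the positively oriented $2$-simplices, for any $o\in\mathbb S^3$ for which all these tetrahedra are non-degenerate. A *flex* is a continuous family $P_s$, $s\in[0,1]$, of polyhedra of type $K$ with constant edge lengths that is not induced by a continuous family of isometries of $\mathbb S^3$. The *Modified Bellows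 Conjecture in $\mathbb S^3$* says that for every flex $P_s$ one can replace some of the vertices with their antipodes (the same ones for all $s$) so that the oriented volume of the resulting family is constant in $s$. A flex for which no set of vertices has this property is a *counterexample* to it. **Octahedra.** An octahedron has the vertices $a_i,b_i$ ($i=1,2,3$), its edges are all pairs of vertices except $\{a_i,b_i\}$, and it is oriented so that $a_1a_2a_3$ is a positive face. For real $p_1,p_2,q_1,q_2$ with $\max\{p_1^2,p_2^2\}+\max\{q_1^2,q_2^2\}<1$, signs $\delta_1,\delta_2,\varepsilon_1,\varepsilon_2\in\{\pm1\}$ and $$\theta\in[\theta_{\min},\theta_{\max}],\qquad \theta_{\min}=\arcsin\max\{|q_1|,|q_2|\},\quad\theta_{\max}=\arccos\max\{|p_1|,|p_2|\},$$ consider the octahedron $$\begin{aligned} a_1&=\Bigl(\tfrac{p_1}{\cos\theta},\delta_1\sqrt{1-\tfrac{p_1^2}{\cos^2\theta}},0,0\Bigr),& b_1&=\Bigl(\tfrac{p_2}{\cos\theta},\delta_2\sqrt{1-\tfrac{p_2^2}{\cos^2\theta}},0,0\Bigr),\\ a_2&=\Bigl(0,0,\tfrac{q_1}{\sin\theta},\varepsilon_1\sqrt{1-\tfrac{q_1^2}{\sin^2\theta}}\Bigr),&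 b_2&=\Bigl(0,0,\tfrac{q_2}{\sin\theta},\varepsilon_2\sqrt{1-\tfrac{q_2^2}{\sin^2\theta}}\Bigr),\\ a_3&=(\cos\theta,0,\sin\theta,0),& b_3&=(\cos\theta,0,-\sin\theta,0). \end{aligned}\tag{$*$}$$ The configuration curve of $(*)$ consists of all these octahedra, for all $\theta$ and all signs, up to congruence. **Exotic flexible octahedra.** For an octahedron in $\mathbb S^3$ with non-degenerate faces let $t_{uv}=\tan(\varphi_{uv}/2)\in\mathbb{RP}^1=\mathbb R\cup\{\infty\}$, where $\varphi_{uv}\in\mathbb R/2\pi\mathbb Z$ is the oriented dihedral angle at the edge $uv$: if $uvw_1$ and $vuw_2$ are the positively oriented faces at $uv$, $\tau$ is the unit tangent vector at $u$ of the arc $uv$, and $n_i$ is the unit tangent vector at $u$ orthogonal to $uv$ and pointing inside the face that contains $w_i$, then $\cos\varphi_{uv}=\langle n_1,n_2\rangle$ and $\sin\varphi_{uv}=-\det(u,\tau,n_1,n_2)$. For a set $\ell$ of $12$ edge lengths, the configuration space $\Sigma(\ell)\subset(\mathbb{RP}^1)^{12}$ is the real algebraic variety given by the following $24$ relations, in bihomogeneous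 form: for every vertex $u$ and every face $uv_1v_2$, with $v_3,v_4$ the vertices opposite to $v_1,v_2$ and $\alpha,\beta,\gamma,\delta$ the angles $\angle v_1uv_2,\angle v_2uv_3,\angle v_3uv_4,\angle v_4uv_1$ determined by $\ell$, the coordinates $t_1=t_{uv_1}$ and $t_2=t_{uv_2}$ satisfy $$At_1^2t_2^2+Bt_1^2+2Ct_1t_2+Dt_2^2+E=0,$$ $$\begin{gathered}A=\cos\gamma-\cos(\alpha+\beta+\delta),\quad B=\cos\gamma-\cos(\alpha-\beta+\delta),\quad C=-2\sin\beta\sin\delta,\\ D=\cos\gamma-\cos(\alpha+\beta-\delta),\quad E=\cos\gamma-\cos(\alpha-\beta-\delta).\end{gathered}$$ A one-dimensional irreducible component $\Gamma$ of $\Sigma(\ell)$ is *essential* if no coordinate $t_{uv}$ is identically $0$ or identically $\infty$ on $\Gamma$. An *exotic flexible octahedron* is a flex of an octahedron with edge lengths $\ell$ whose tangents $(t_{uv})$ run along an essential one-dimensional irreducible component $\Gamma$ of $\Sigma(\ell)$ such that, after a permutation of the indices $1,2,3$, the functions $t_1=t_{a_2a_3}$, $t_2=t_{a_3a_1}$,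 $t_3=t_{a_1a_2}$ satisfy $\mathbb R(t_3)=\mathbb R(t_1)\cap\mathbb R(t_2)$, $|\mathbb R(\Gamma)/\mathbb R(t_3)|=4$ and $$|\mathbb R(\Gamma)/\mathbb R(t_1)|=|\mathbb R(\Gamma)/\mathbb R(t_2)|=|\mathbb R(t_1)/\mathbb R(t_3)|=|\mathbb R(t_2)/\mathbb R(t_3)|=2.$$ **Theorem.** 1. Let $|p_1|\ne|p_2|$, $|q_1|\ne|q_2|$ and $\max\{p_1^2,p_2^2\}+\max\{q_1^2,q_2^2\}<1$. Replace any set of the vertices of the octahedra $(*)$ with their antipodes. Then the oriented volume of the result is nonconstant on every arbitrarily small segment of the configuration curve; that is, it is nonconstant along every continuous family of octahedra congruent to octahedra $(*)$ (with $\theta$ and the signs depending on the parameter) that is not induced by a continuous family of isometries. In particular, for all signs, $(*)$ with $\theta$ running from $\theta_{\min}$ to $\theta_{\max}$ is a flex and a counterexample to the Modified Bellows Conjecture in $\mathbb S^3$. 2. Every exotic flexible octahedron is a counterexample to the Modified Bellows Conjecture in $\mathbb S^3$. 3. Hence the Modified Bellows Conjecture in $\mathbb S^3$ is false. -/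

import Mathlib

open MeasureTheory
open scoped unitInterval

noncomputable section

namespace SphericalOctahedra

/-! ### The sphere `S³` and oriented volumes -/

/-- Euclidean 4-space. -/
abbrev E4 : Type := EuclideanSpace ℝ (Fin 4)

/-- The unit sphere `S³` in Euclidean 4-space. -/
abbrev S3 : Type := Metric.sphere (0 : E4) 1

/-- The determinant of the matrix whose rows are the coordinates of four vectors. -/
def det4 (a b c d : E4) : ℝ :=
  Matrix.det (Matrix.of fun i j : Fin 4 => (![a, b, c, d] i) j)

/-- The spherical tetrahedron with the given vertices (meant for linearly independent vertices). -/
def tetrahedron (a b c d : S3) : Set S3 :=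
  {x | ∃ r : Fin 4 → ℝ, (∀ i, 0 ≤ r i) ∧
    (x : E4) = r 0 • (a : E4) + r 1 • (b : E4) + r 2 • (c : E4) + r 3 • (d : E4)}

/-- The oriented volume of a spherical tetrahedron, with respect to the standard
surface measure of `S³` (total mass `2π²`). -/
def tetrahedronVolume (a b c d : S3) : ℝ :=
  (SignType.sign (det4 a b c d) : ℝ) *
    ((volume : Measure E4).toSphere).real (tetrahedron a b c d)

/-- An oriented closed two-dimensional simplicial manifold with vertex set `V`;
`face u v w` says that `[u, v, w]` is a positively oriented 2-simplex. -/
structure OrientedSurface (V : Type) where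
  face : V → V → V → Prop
  rotate : ∀ {u v w}, face u v w → face v w u
  ne : ∀ {u v w}, face u v w → u ≠ v
  /-- a 2-simplex has only one positive orientation -/
  oriented : ∀ {u v w}, face u v w → ¬ face v u w
  /-- every edge lies in exactly two 2-simplices, which induce opposite orientations on it -/
  edge_unique : ∀ {u v w w'}, face u v w → face u v w' → w = w'
  edge_closed : ∀ {u v w}, face u v w → ∃ w', face v u w'
  vertex_mem : ∀ u, ∃ v w, face u v w
  /-- the link of every vertex is connected (hence a single cycle) -/
  link_connected : ∀ {u v w v' w'}, face u v w → face u v' w' →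
    Relation.ReflTransGen (face u) v v'

variable {V : Type}

/-- All faces of a polyhedron with vertices `P v` in `S³` are non-degenerate: the vertices of a
face do not lie on a great circle. The polyhedron, a map that is quasi-linear on each 2-simplex, is
determined by its vertices. -/
def IsNondegenerate (K : OrientedSurface V) (P : V → S3) : Prop :=
  ∀ u v w, K.face u v w → LinearIndependent ℝ ![(P u : E4), (P v : E4), (P w : E4)]

/-- All tetrahedra that join `o` to the faces of the polyhedron are non-degenerate. -/
def IsGenericPoint (K : OrientedSurface V) (P : V → S3) (o : S3) : Prop :=
  ∀ u v w, K.face u v w → LinearIndependent ℝ ![(o : E4), (P u : E4), (P v : E4), (P w : E4)]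

open Classical in
/-- The sum of the oriented volumes of the tetrahedra `o P(u) P(v) P(w)` over the positively
oriented 2-simplices; each of these occurs with three orderings `u v w`, whence the factor `1/3`. -/
def volumeFrom [Fintype V] (K : OrientedSurface V) (P : V → S3) (o : S3) : ℝ :=
  (1 / 3) * ∑ u, ∑ v, ∑ w, if K.face u v w then tetrahedronVolume o (P u) (P v) (P w) else 0

open Classical in
/-- The oriented volume of a polyhedron in `S³`, an element of `ℝ / 2π²ℤ`. For non-degenerate
faces a generic point `o` exists, and the value does not depend on it. -/
def orientedVolume [Fintype V] (K : OrientedSurface V) (P : V → S3) :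
    AddCircle (2 * Real.pi ^ 2) :=
  if h : ∃ o, IsGenericPoint K P o then
    ((volumeFrom K P h.choose : ℝ) : AddCircle (2 * Real.pi ^ 2))
  else 0

/-! ### Flexes and the Modified Bellows Conjecture -/

/-- The spherical distance. -/
def sdist (x y : S3) : ℝ := InnerProductGeometry.angle (x : E4) (y : E4)

/-- The family `P` is induced by a continuous family of isometries of `S³`. -/
def IsInducedByIsometries (P : I → V → S3) : Prop :=
  ∃ g : I → (E4 ≃ₗᵢ[ℝ] E4), (∀ x, Continuous fun t => g t x) ∧
    ∀ t v, (P t v : E4) = g t (P 0 v)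

/-- A flex of a polyhedron of combinatorial type `K` in `S³`. -/
structure IsFlex (K : OrientedSurface V) (P : I → V → S3) : Prop where
  continuous : Continuous P
  nondegenerate : ∀ t, IsNondegenerate K (P t)
  lengths : ∀ u v w, K.face u v w → ∀ t, sdist (P t u) (P t v) = sdist (P 0 u) (P 0 v)
  not_induced : ¬ IsInducedByIsometries P

open Classical in
/-- Replace the vertices in `S` with their antipodes. -/
def antipodes (S : Set V) (P : V → S3) : V → S3 := fun v => if v ∈ S then -P v else P v

/-- The oriented volume is constant along the family `P`. -/
def HasConstantVolume [Fintype V] (K : OrientedSurface V) (P : I → V → S3) : Prop :=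
  ∃ c, ∀ t, orientedVolume K (P t) = c

/-- The Modified Bellows Conjecture in `S³`. -/
def ModifiedBellowsConjecture : Prop :=
  ∀ (V : Type) [Fintype V] (K : OrientedSurface V) (P : I → V → S3), IsFlex K P →
    ∃ S : Set V, HasConstantVolume K fun t => antipodes S (P t)

/-- `P` is a counterexample to the Modified Bellows Conjecture in `S³`. -/
def IsCounterexample [Fintype V] (K : OrientedSurface V) (P : I → V → S3) : Prop :=
  IsFlex K P ∧ ∀ S : Set V, ¬ HasConstantVolume K fun t => antipodes S (P t)

/-! ### The octahedron -/

/-- The vertices of the octahedron: `(i, false)` is `a_{i+1}` and `(i, true)` is `b_{i+1}`. -/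
abbrev OctV : Type := Fin 3 × Bool

/-- The combinatorially opposite vertex. -/
def opp (v : OctV) : OctV := (v.1, !v.2)

/-- The positively oriented faces of the octahedron, `a₁a₂a₃` being one of them. -/
def OctFace (u v w : OctV) : Prop :=
  (v.1 = u.1 + 1 ∧ w.1 = u.1 + 2 ∧ (u.2 ^^ v.2 ^^ w.2) = false) ∨
  (v.1 = u.1 + 2 ∧ w.1 = u.1 + 1 ∧ (u.2 ^^ v.2 ^^ w.2) = true)

instance (u v w : OctV) : Decidable (OctFace u v w) := by
  unfold OctFace; infer_instance

theorem octFace_link : ∀ u v w v' w' : OctV, OctFace u v w → OctFace u v' w' →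
    v = v' ∨ OctFace u v v' ∨ (∃ a, OctFace u v a ∧ OctFace u a v') ∨
      ∃ a, OctFace u v a ∧ ∃ b, OctFace u a b ∧ OctFace u b v' := by
  have key : ∀ u v v' : OctV, u.1 ≠ v.1 → u.1 ≠ v'.1 →
      v = v' ∨ OctFace u v v' ∨ (∃ a, OctFace u v a ∧ OctFace u a v') ∨
      ∃ a, OctFace u v a ∧ ∃ b, OctFace u a b ∧ OctFace u b v' := by decide
  have hne : ∀ u v w : OctV, OctFace u v w → u.1 ≠ v.1 := by decide
  intro u v w v' w' h h'
  exact key u v v' (hne _ _ _ h) (hne _ _ _ h')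

/-- The boundary of the octahedron as an oriented surface. -/
def octahedron : OrientedSurface OctV where
  face := OctFace
  rotate {u v w} := by revert u v w; decide
  ne {u v w} := by revert u v w; decide
  oriented {u v w} := by revert u v w; decide
  edge_unique {u v w w'} h h' := by
    have : ∀ u v w w' : OctV, OctFace u v w → OctFace u v w' → w = w' := by decide
    exact this _ _ _ _ h h'
  edge_closed {u v w} := by revert u v w; decide
  vertex_mem := by decide
  link_connected {u v w v' w'} h h' := by
    rcases octFace_link u v w v' w' h h' with rfl | h1 | ⟨a, h1, h2⟩ | ⟨a, h1, b, h2, h3⟩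
    · exact .refl
    · exact .single h1
    · exact .tail (.single h1) h2
    · exact .tail (.tail (.single h1) h2) h3

/-- The graph of the octahedron: all pairs of vertices but the pairs `{a_i, b_i}` are edges. -/
def octGraph : SimpleGraph OctV where
  Adj u v := u.1 ≠ v.1
  symm := ⟨fun _ _ h => h.symm⟩
  loopless := ⟨fun _ h => h rfl⟩

/-- The 12 edges of the octahedron. -/
abbrev OctEdge : Type := octGraph.edgeSet

/-- The edge joining two vertices that are not opposite. -/
def edge (u v : OctV) (h : u.1 ≠ v.1) : OctEdge := ⟨s(u, v), h⟩

/-! ### The explicit family -/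

/-- The positions of the vertices of the octahedron in the explicit family with parameters
`p₁, p₂, q₁, q₂`. -/
def flexVertex (p₁ p₂ q₁ q₂ θ : ℝ) (δ₁ δ₂ ε₁ ε₂ : ℤˣ) : OctV → E4
  | (0, false) => !₂[p₁ / Real.cos θ, (δ₁ : ℤ) * √(1 - p₁ ^ 2 / Real.cos θ ^ 2), 0, 0]
  | (0, true) => !₂[p₂ / Real.cos θ, (δ₂ : ℤ) * √(1 - p₂ ^ 2 / Real.cos θ ^ 2), 0, 0]
  | (1, false) => !₂[0, 0, q₁ / Real.sin θ, (ε₁ : ℤ) * √(1 - q₁ ^ 2 / Real.sin θ ^ 2)]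
  | (1, true) => !₂[0, 0, q₂ / Real.sin θ, (ε₂ : ℤ) * √(1 - q₂ ^ 2 / Real.sin θ ^ 2)]
  | (2, false) => !₂[Real.cos θ, 0, Real.sin θ, 0]
  | (2, true) => !₂[Real.cos θ, 0, -Real.sin θ, 0]

def thetaMin (q₁ q₂ : ℝ) : ℝ := Real.arcsin (max |q₁| |q₂|)

def thetaMax (p₁ p₂ : ℝ) : ℝ := Real.arccos (max |p₁| |p₂|)

/-- The octahedra that are congruent to an octahedron of the explicit family with parameters
`p₁, p₂, q₁, q₂`, for arbitrary `θ` and signs. Up to congruence these are the points of the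
configuration curve. (A reflection only changes signs, so congruence by rotations
gives the same set.) -/
def configCurve (p₁ p₂ q₁ q₂ : ℝ) : Set (OctV → S3) :=
  {P | ∃ θ ∈ Set.Icc (thetaMin q₁ q₂) (thetaMax p₁ p₂), ∃ δ₁ δ₂ ε₁ ε₂ : ℤˣ,
    ∃ g : E4 ≃ₗᵢ[ℝ] E4, ∀ v, (P v : E4) = g (flexVertex p₁ p₂ q₁ q₂ θ δ₁ δ₂ ε₁ ε₂ v)}

/-! ### Oriented dihedral angles -/

/-- The unit tangent vector at `u` of the arc from `u` to `v`. -/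
def edgeDirection (u v : E4) : E4 := ‖v - inner ℝ u v • u‖⁻¹ • (v - inner ℝ u v • u)

/-- The unit tangent vector at `u` that is orthogonal to the edge `uv` and points inside
the triangle `uvw`. -/
def innerNormal (u v w : E4) : E4 :=
  let x := w - inner ℝ u w • u - inner ℝ (edgeDirection u v) w • edgeDirection u v
  ‖x‖⁻¹ • x

/-- The oriented dihedral angle at the edge `uv` between the positively oriented faces `u v w₁` and
`v u w₂`. With `n₁, n₂` the inner normals, `τ` the direction of the edge, and `m₁` the exterior unit
normal of the first face (so that `det (u, m₁, τ, n₁) = 1`), it is the angle `φ` with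
`cos φ = ⟪n₁, n₂⟫` and `sin φ = ⟪-m₁, n₂⟫ = -det (u, τ, n₁, n₂)`. -/
def dihedralAngle (u v w₁ w₂ : E4) : ℝ :=
  Complex.arg ⟨inner ℝ (innerNormal u v w₁) (innerNormal u v w₂),
    -det4 u (edgeDirection u v) (innerNormal u v w₁) (innerNormal u v w₂)⟩

/-- The real projective line; the point `(X : Y)` stands for `X / Y ∈ ℝ ∪ {∞}`. -/
abbrev RP1 : Type := Projectivization ℝ (Fin 2 → ℝ)

/-- The point `tan (φ / 2)` of the projective line. -/
def tanHalf (φ : ℝ) : RP1 :=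
  Projectivization.mk ℝ ![Real.sin (φ / 2), Real.cos (φ / 2)] (by
    intro h
    have h0 : Real.sin (φ / 2) = 0 := congrFun h 0
    have h1 : Real.cos (φ / 2) = 0 := congrFun h 1
    have := Real.sin_sq_add_cos_sq (φ / 2)
    rw [h0, h1] at this
    norm_num at this)

/-- The point of the projective line with affine coordinate `x`. -/
def affinePt (x : ℝ) : RP1 :=
  Projectivization.mk ℝ ![x, 1] (fun h => one_ne_zero (congrFun h 1))

/-- The point at infinity of the projective line. -/
def infPt : RP1 :=
  Projectivization.mk ℝ ![1, 0] (fun h => one_ne_zero (congrFun h 0))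

/-- `t` is the tuple of the tangents of the halves of the oriented dihedral angles of `P`. -/
def HasTangents (P : OctV → S3) (t : OctEdge → RP1) : Prop :=
  ∀ (u v w₁ w₂ : OctV) (h : u.1 ≠ v.1), OctFace u v w₁ → OctFace v u w₂ →
    t (edge u v h) = tanHalf (dihedralAngle (P u) (P v) (P w₁) (P w₂))

/-! ### The configuration space and exotic flexible octahedra -/

/-- `ℓ` is the set of edge lengths of `P`. -/
def HasEdgeLengths (P : OctV → S3) (ℓ : OctEdge → ℝ) : Prop :=
  ∀ (u v : OctV) (h : u.1 ≠ v.1), sdist (P u) (P v) = ℓ (edge u v h)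

/-- The angle at `u` of the spherical triangle `uvw` with edge lengths `ℓ`. -/
def faceAngle (ℓ : OctEdge → ℝ) (u v w : OctV) (huv : u.1 ≠ v.1) (huw : u.1 ≠ w.1)
    (hvw : v.1 ≠ w.1) : ℝ :=
  Real.arccos ((Real.cos (ℓ (edge v w hvw)) -
      Real.cos (ℓ (edge u v huv)) * Real.cos (ℓ (edge u w huw))) /
    (Real.sin (ℓ (edge u v huv)) * Real.sin (ℓ (edge u w huw))))

/-- The (bihomogeneous) relation between the tangents of the half angles at two adjacent vertices
`c₁, c₂` of a spherical quadrilateral `c₁c₂c₃c₄` with consecutive side lengths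
`α = c₁c₂`, `β = c₂c₃`, `γ = c₃c₄`, `δ = c₄c₁`. -/
def BricardRelation (α β γ δ : ℝ) (t₁ t₂ : RP1) : Prop :=
  let X₁ := t₁.rep 0
  let Y₁ := t₁.rep 1
  let X₂ := t₂.rep 0
  let Y₂ := t₂.rep 1
  (Real.cos γ - Real.cos (α + β + δ)) * X₁ ^ 2 * X₂ ^ 2 +
    (Real.cos γ - Real.cos (α - β + δ)) * X₁ ^ 2 * Y₂ ^ 2 +
    2 * (-2 * Real.sin β * Real.sin δ) * X₁ * Y₁ * X₂ * Y₂ +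
    (Real.cos γ - Real.cos (α + β - δ)) * Y₁ ^ 2 * X₂ ^ 2 +
    (Real.cos γ - Real.cos (α - β - δ)) * Y₁ ^ 2 * Y₂ ^ 2 = 0

/-- The configuration space of spherical octahedra with edge lengths `ℓ`: the variety in `(ℝP¹)¹²`
given by the 24 relations for the pairs of edges `uv`, `uw` of a face `uvw`. The link of `u` is the
quadrilateral with the vertices `v, w, opp v, opp w`. -/
def configSpace (ℓ : OctEdge → ℝ) : Set (OctEdge → RP1) :=
  {t | ∀ (u v w : OctV) (huv : u.1 ≠ v.1) (huw : u.1 ≠ w.1) (hvw : v.1 ≠ w.1),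
    BricardRelation (faceAngle ℓ u v w huv huw hvw)
      (faceAngle ℓ u w (opp v) huw huv hvw.symm)
      (faceAngle ℓ u (opp v) (opp w) huv huw hvw)
      (faceAngle ℓ u (opp w) v huw huv hvw.symm)
      (t (edge u v huv)) (t (edge u w huw))}

/-- `x` is a tuple of homogeneous coordinates of the point `t` of `(ℝP¹)¹²`. -/
def IsCoordinates (x : OctEdge → Fin 2 → ℝ) (t : OctEdge → RP1) : Prop :=
  ∀ e, ∃ h : x e ≠ 0, Projectivization.mk ℝ (x e) h = t e

/-- Zariski closed subsets of `(ℝP¹)¹²`. A polynomial vanishes at all homogeneous coordinates of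
a point iff all its multihomogeneous components vanish at the point. -/
def IsZariskiClosed (Z : Set (OctEdge → RP1)) : Prop :=
  ∃ F : Set (MvPolynomial (OctEdge × Fin 2) ℝ),
    Z = {t | ∀ f ∈ F, ∀ x, IsCoordinates x t → MvPolynomial.eval (fun i => x i.1 i.2) f = 0}

/-- Irreducible Zariski closed subsets of `(ℝP¹)¹²`. -/
def IsIrreducibleVariety (Γ : Set (OctEdge → RP1)) : Prop :=
  IsZariskiClosed Γ ∧ Γ.Nonempty ∧
    ∀ Z₁ Z₂, IsZariskiClosed Z₁ → IsZariskiClosed Z₂ → Γ ⊆ Z₁ ∪ Z₂ → Γ ⊆ Z₁ ∨ Γ ⊆ Z₂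

/-- `Γ` is an irreducible component of the variety `Z`. -/
def IsComponent (Γ Z : Set (OctEdge → RP1)) : Prop :=
  IsIrreducibleVariety Γ ∧ Γ ⊆ Z ∧ ∀ Γ', IsIrreducibleVariety Γ' → Γ' ⊆ Z → Γ ⊆ Γ' → Γ' = Γ

/-- No coordinate is identically zero or identically infinite on `Γ`. -/
def IsEssential (Γ : Set (OctEdge → RP1)) : Prop :=
  ∀ e, (∃ t ∈ Γ, t e ≠ affinePt 0) ∧ (∃ t ∈ Γ, t e ≠ infPt)

/-- The ideal of the affine part of `Γ`, where all coordinates are finite. -/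
def affineIdeal (Γ : Set (OctEdge → RP1)) : Ideal (MvPolynomial OctEdge ℝ) :=
  MvPolynomial.vanishingIdeal ℝ {x : OctEdge → ℝ | (fun e => affinePt (x e)) ∈ Γ}

/-- The field of rational functions on `Γ`, for `Γ` irreducible with nonempty affine part. -/
abbrev FunctionField (Γ : Set (OctEdge → RP1)) : Type :=
  FractionRing (MvPolynomial OctEdge ℝ ⧸ affineIdeal Γ)

/-- The coordinate `t_e` as a rational function on `Γ`. -/
def coordFn (Γ : Set (OctEdge → RP1)) (e : OctEdge) : FunctionField Γ :=
  algebraMap (MvPolynomial OctEdge ℝ ⧸ affineIdeal Γ) (FunctionField Γ)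
    (Ideal.Quotient.mk (affineIdeal Γ) (MvPolynomial.X e))

/-- The exotic relative position of the fields `ℝ(t₁), ℝ(t₂), ℝ(t₃)` in a field `L`. -/
def IsExoticTriple {L : Type} [Field L] [Algebra ℝ L] (t₁ t₂ t₃ : L) : Prop :=
  let F₁ := IntermediateField.adjoin ℝ {t₁}
  let F₂ := IntermediateField.adjoin ℝ {t₂}
  let F₃ := IntermediateField.adjoin ℝ {t₃}
  F₃ = F₁ ⊓ F₂ ∧ Module.finrank F₃ L = 4 ∧
    Module.finrank F₁ L = 2 ∧ Module.finrank F₂ L = 2 ∧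
    IntermediateField.relfinrank F₃ F₁ = 2 ∧ IntermediateField.relfinrank F₃ F₂ = 2

/-- The edge of the face `a₁a₂a₃` opposite to its vertex with index `i`. -/
def faceEdge (i : Fin 3) : OctEdge :=
  edge (i + 1, false) (i + 2, false) (by revert i; decide)

/-- `Γ` is one-dimensional and, after a permutation of the indices, the tangents at the
edges of the face `a₁a₂a₃` satisfy the exotic degree conditions. -/
def IsExoticCurve (Γ : Set (OctEdge → RP1)) : Prop :=
  ∃ _ : (affineIdeal Γ).IsPrime, Algebra.trdeg ℝ (FunctionField Γ) = 1 ∧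
    ∃ ρ : Equiv.Perm (Fin 3), IsExoticTriple (coordFn Γ (faceEdge (ρ 0)))
      (coordFn Γ (faceEdge (ρ 1))) (coordFn Γ (faceEdge (ρ 2)))

/-- Exotic flexible octahedra: flexes that run along an essential one-dimensional irreducible
component `Γ` of a configuration space, where `Γ` satisfies the exotic degree conditions. -/
def IsExoticFlexibleOctahedron (P : I → OctV → S3) : Prop :=
  IsFlex octahedron P ∧ ∃ (ℓ : OctEdge → ℝ) (Γ : Set (OctEdge → RP1)),
    IsComponent Γ (configSpace ℓ) ∧ IsEssential Γ ∧ IsExoticCurve Γ ∧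
    ∀ s, HasEdgeLengths (P s) ℓ ∧ ∃ t ∈ Γ, HasTangents (P s) t

end SphericalOctahedra

end

/-! Let `c, d` be the vertices of the third diagonal, `x` a vertex of the first and `y` one of the
second. Everything rests on the relations `FlexGram`: `x ⟂ y`, `⟪x, c⟫ = ⟪x, d⟫ = p` and `⟪y, c⟫ =
-⟪y, d⟫ = q`. They give a half-turn that swaps `c, d`, fixes `x` and negates `y`. It maps the
tetrahedron `cdxy` to `cdx(-y)`, and the two together fill the intersection of three half-spaces,
whose measure is linear in the angles between the normals (`coneMeasure_triple`). Hence the volume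
of `cdxy` is an elementary function `tetVolume p q X` of `X = ‖(c + d) / 2‖²`, and `X` is the only
parameter of the flex: `⟪a₁, b₁⟫` and `⟪a₂, b₂⟫` are roots of quadratics with coefficients
determined by `X`, so by continuity they are constant if `X` is.

The cocycle relation for five points (`signedVolume_cocycle`) shows that the oriented volume does
not depend on `o`, and it cuts the octahedron along the third diagonal: modulo `2π²` the volume is a
sum of four terms `± tetVolume pᵢ qⱼ X`. The derivative of such a sum is algebraic in `X`. If it had
infinitely many zeros, squaring twice would give a polynomial identity `F² = G² (X - r₁²) (X - r₂²)`
with `rⱼ² = 1 - qⱼ²`. As `r₁² ≠ r₂²`, this forces `G = 0`, and the values of `G` at `p₁²` and `p₂²`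
then give `p₁ = p₂ = 0`, a contradiction. So for fixed signs the level sets are finite, and a
constant volume would cover an interval of values of `X` by countably many finite sets. Replacing
vertices with antipodes only changes signs of the `pᵢ`, `qⱼ` or exchanges the roles of the first two
diagonals, so the argument survives it (`not_hasConstantVolume_antipodes`).

For exotic octahedra, the degree conditions say that `t₃` is a rational function of `t₁` and of `t₂`
but generates neither field. A biquadratic relation of Bricard's form between `t` and such an
element of `ℝ(t)` must lose two of its coefficients (`biquadratic_degenerate`), and of the two links
concerned one is a kite and the other an antikite (`kite_antikite`). Eliminating `t₃` gives the
relation for the third link up to a factor. In terms of the face angles this yields enough equations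
to recover, up to a permutation of the indices, the relations `FlexGram` (`flexGram_of_angles`).
These involve only edge lengths, so they hold along the whole flex and the first argument applies.
-/

noncomputable section

namespace SphericalOctahedra

/-! ### The measure of cones -/

/-- Four times the Lebesgue measure on the unit ball: the measure of a cone is the area of its
trace on the unit sphere. -/
def coneMeasure : Measure E4 := (4 : ENNReal) • (volume : Measure E4).restrict (Metric.ball 0 1)

instance : IsFiniteMeasure coneMeasure := by
  unfold coneMeasure
  have : IsFiniteMeasure ((volume : Measure E4).restrict (Metric.ball 0 1)) :=
  ⟨by simpa using measure_ball_lt_top⟩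
  refine ⟨?_⟩
  rw [Measure.smul_apply]
  exact ENNReal.mul_lt_top (by norm_num) (measure_lt_top _ _)

theorem coneMeasure_univ : coneMeasure.real Set.univ = 2 * Real.pi ^ 2 := by
  have h : (volume : Measure E4) (Metric.ball 0 1) = ENNReal.ofReal (Real.pi ^ 2 / 2) := by
    rw [InnerProductSpace.volume_ball_of_dim_even (k := 2) (by simp)]
    simp
  rw [measureReal_def, coneMeasure, Measure.smul_apply, Measure.restrict_apply MeasurableSet.univ,
    Set.univ_inter, h, smul_eq_mul, ENNReal.toReal_mul, ENNReal.toReal_ofReal (by positivity)]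
  norm_num
  ring

theorem coneMeasure_absolutelyContinuous : coneMeasure ≪ volume := by
  intro s hs
  have h : (volume : Measure E4).restrict (Metric.ball 0 1) s = 0 :=
    Measure.absolutelyContinuous_of_le Measure.restrict_le_self hs
  rw [coneMeasure, Measure.smul_apply, h, smul_zero]

theorem coneMeasure_hyperplane {f : E4} (hf : f ≠ 0) :
    coneMeasure {x | inner ℝ f x = 0} = 0 := by
  apply coneMeasure_absolutelyContinuous
  have : {x : E4 | inner ℝ f x = 0} = (LinearMap.ker (innerSL ℝ f).toLinearMap : Set E4) := by
    ext x; simp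
  rw [this]
  apply Measure.addHaar_submodule
  intro h
  have h1 : f ∈ LinearMap.ker (innerSL ℝ f).toLinearMap := by rw [h]; trivial
  simp at h1
  exact hf h1

theorem measurePreserving_coneMeasure (g : E4 ≃ₗᵢ[ℝ] E4) :
    MeasurePreserving g coneMeasure coneMeasure := by
  have h := (g.measurePreserving).restrict_preimage (s := Metric.ball (0 : E4) 1)
    measurableSet_ball
  have hb : g ⁻¹' Metric.ball (0 : E4) 1 = Metric.ball 0 1 := by
    ext x; simp
  rw [hb] at h
  exact h.smul_measure 4

theorem coneMeasure_preimage (g : E4 ≃ₗᵢ[ℝ] E4) {s : Set E4} (hs : MeasurableSet s) :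
    coneMeasure.real (g ⁻¹' s) = coneMeasure.real s := by
  rw [measureReal_def, measureReal_def,
    (measurePreserving_coneMeasure g).measure_preimage hs.nullMeasurableSet]

/-- `Measure.toSphere` of a set is four times the volume of the truncated cone over it, and for a
cone this is its part in the open unit ball without the origin. -/
theorem toSphere_eq_coneMeasure {C : Set E4} (hC : MeasurableSet C)
    (hcone : ∀ r : ℝ, 0 < r → ∀ x, x ∈ C ↔ r • x ∈ C) :
    ((volume : Measure E4).toSphere).real {x : S3 | (x : E4) ∈ C} = coneMeasure.real C := by
  have hm : MeasurableSet {x : S3 | (x : E4) ∈ C} := measurable_subtype_coe hC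
  rw [measureReal_def, measureReal_def, Measure.toSphere_apply' _ hm, coneMeasure,
    Measure.smul_apply, Measure.restrict_apply hC]
  congr 1
  simp only [finrank_euclideanSpace, Fintype.card_fin, smul_eq_mul]
  congr 1
  open scoped Pointwise in
  have : Set.Ioo (0 : ℝ) 1 • (Subtype.val '' {x : S3 | (x : E4) ∈ C}) =
      (C ∩ Metric.ball 0 1) \ {0} := by
    ext x
    constructor
    · rintro ⟨r, hr, _, ⟨y, hy, rfl⟩, rfl⟩
      have hy1 : ‖(y : E4)‖ = 1 := by simp
      have hy0 : (y : E4) ≠ 0 := by intro h; rw [h] at hy1; simp at hy1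
      refine ⟨⟨(hcone r hr.1 _).1 hy, ?_⟩, ?_⟩
      · simp [norm_smul, hy1, abs_of_pos hr.1, hr.2]
      · simp [hr.1.ne', hy0]
    · rintro ⟨⟨hx, hb⟩, h0⟩
      have h0 : x ≠ 0 := h0
      have hn : 0 < ‖x‖ := norm_pos_iff.2 h0
      refine ⟨‖x‖, ⟨hn, by simp at hb; exact hb⟩, ‖x‖⁻¹ • x, ⟨⟨‖x‖⁻¹ • x, ?_⟩, ?_, rfl⟩, ?_⟩
      · simp [norm_smul, hn.ne']
      · exact (hcone _ (inv_pos.2 hn) _).1 hx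
      · simp [smul_smul, hn.ne']
  rw [this, measure_sdiff_null (measure_singleton _)]

/-! ### The measure of a wedge -/

/-- In polar coordinates the two half-planes, whose normals have the directions `0` and `φ`, meet in
the sector `[φ - π/2, π/2]` of angle `π - φ`. Values `R ≤ 0` are allowed because slices that miss
the unit ball produce them. -/
theorem volume_sector {φ R : ℝ} (h0 : 0 < φ) (hπ : φ < Real.pi) :
    (volume : Measure (ℝ × ℝ)) {z | 0 ≤ z.1 ∧ 0 ≤ Real.cos φ * z.1 + Real.sin φ * z.2 ∧
      z.1 ^ 2 + z.2 ^ 2 < R} = ENNReal.ofReal (Real.pi - φ) * ENNReal.ofReal (R / 2) := by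
  rcases le_or_gt R 0 with hR | hR
  · rw [ENNReal.ofReal_of_nonpos (p := R / 2) (by linarith), mul_zero]
    convert measure_empty (μ := (volume : Measure (ℝ × ℝ)))
    ext z
    simp only [Set.mem_ofPred_eq, Set.mem_empty_iff_false, iff_false, not_and, not_lt]
    intros
    nlinarith [sq_nonneg z.1, sq_nonneg z.2]
  set S := {z : ℝ × ℝ | 0 ≤ z.1 ∧ 0 ≤ Real.cos φ * z.1 + Real.sin φ * z.2 ∧
      z.1 ^ 2 + z.2 ^ 2 < R} with hS
  have hSm : MeasurableSet S := by
    have h1 : MeasurableSet {z : ℝ × ℝ | 0 ≤ z.1} := measurableSet_le (by fun_prop) (by fun_prop)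
    have h2 : MeasurableSet {z : ℝ × ℝ | 0 ≤ Real.cos φ * z.1 + Real.sin φ * z.2} :=
      measurableSet_le (by fun_prop) (by fun_prop)
    have h3 : MeasurableSet {z : ℝ × ℝ | z.1 ^ 2 + z.2 ^ 2 < R} :=
      measurableSet_lt (by fun_prop) (by fun_prop)
    exact h1.inter (h2.inter h3)
  rw [← lintegral_indicator_one hSm, ← lintegral_comp_polarCoord_symm]
  have key : ∀ p ∈ polarCoord.target, (polarCoord.symm p ∈ S ↔
      p ∈ Set.Ioo 0 (√R) ×ˢ Set.Icc (φ - Real.pi / 2) (Real.pi / 2)) := by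
    rintro ⟨r, ψ⟩ ⟨hr, hψ⟩
    simp only [Set.mem_Ioi, Set.mem_Ioo] at hr hψ
    have e1 : (0 ≤ r * Real.cos ψ) ↔ 0 ≤ Real.cos ψ := mul_nonneg_iff_of_pos_left hr
    have e2 : (0 ≤ Real.cos φ * (r * Real.cos ψ) + Real.sin φ * (r * Real.sin ψ)) ↔
        0 ≤ Real.cos (ψ - φ) := by
      rw [← mul_nonneg_iff_of_pos_left (b := Real.cos (ψ - φ)) hr, Real.cos_sub]
      ring_nf
    have e3 : (r * Real.cos ψ) ^ 2 + (r * Real.sin ψ) ^ 2 < R ↔ r < √R := by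
      rw [Real.lt_sqrt hr.le]
      have : (r * Real.cos ψ) ^ 2 + (r * Real.sin ψ) ^ 2 = r ^ 2 := by
        linear_combination r ^ 2 * Real.cos_sq_add_sin_sq ψ
      rw [this]
    simp only [hS, polarCoord_symm_apply, Set.mem_ofPred_eq, Set.mem_prod, Set.mem_Ioo,
      Set.mem_Icc, e1, e2, e3]
    constructor
    · rintro ⟨h1, h2, h3⟩
      have hle : ψ ≤ Real.pi / 2 := by
        by_contra h
        exact absurd (Real.cos_neg_of_pi_div_two_lt_of_lt (not_le.1 h) (by linarith)) (not_lt.2 h1)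
      refine ⟨⟨hr, h3⟩, ?_, hle⟩
      by_contra h
      rcases le_or_gt (-Real.pi / 2) ψ with hψ' | hψ'
      · have := Real.cos_neg_of_pi_div_two_lt_of_lt (x := φ - ψ) (by linarith) (by linarith)
        rw [← Real.cos_neg, neg_sub] at this
        linarith
      · have := Real.cos_neg_of_pi_div_two_lt_of_lt (x := -ψ) (by linarith) (by linarith)
        rw [Real.cos_neg] at this
        linarith
    · rintro ⟨⟨-, h3⟩, h1, h2⟩
      exact ⟨Real.cos_nonneg_of_neg_pi_div_two_le_of_le (by linarith) h2,
        Real.cos_nonneg_of_neg_pi_div_two_le_of_le (by linarith) (by linarith), h3⟩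
  have hsub : Set.Ioo 0 (√R) ×ˢ Set.Icc (φ - Real.pi / 2) (Real.pi / 2) ⊆ polarCoord.target := by
    rintro ⟨r, ψ⟩ ⟨hr, hψ⟩
    simp only [Set.mem_Ioo, Set.mem_Icc] at hr hψ
    exact ⟨hr.1, by constructor <;> linarith [Real.pi_pos]⟩
  have hQm : MeasurableSet (Set.Ioo 0 (√R) ×ˢ Set.Icc (φ - Real.pi / 2) (Real.pi / 2)) :=
    measurableSet_Ioo.prod measurableSet_Icc
  calc ∫⁻ p in polarCoord.target, ENNReal.ofReal p.1 • S.indicator 1 (polarCoord.symm p)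
      = ∫⁻ p in polarCoord.target,
          (Set.Ioo 0 (√R) ×ˢ Set.Icc (φ - Real.pi / 2) (Real.pi / 2)).indicator
            (fun p => ENNReal.ofReal p.1 * 1) p := by
        refine setLIntegral_congr_fun polarCoord.open_target.measurableSet fun p hp => ?_
        by_cases h : polarCoord.symm p ∈ S
        · simp only [Set.indicator_of_mem h, Set.indicator_of_mem ((key p hp).1 h)]
          simp
        · simp only [Set.indicator_of_notMem h, Set.indicator_of_notMem (mt (key p hp).2 h)]
          simp
    _ = ∫⁻ p in Set.Ioo 0 (√R) ×ˢ Set.Icc (φ - Real.pi / 2) (Real.pi / 2),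
          ENNReal.ofReal p.1 * 1 := by
        rw [setLIntegral_indicator hQm, Set.inter_eq_left.2 hsub]
    _ = (∫⁻ r in Set.Ioo 0 (√R), ENNReal.ofReal r) *
          ∫⁻ _ in Set.Icc (φ - Real.pi / 2) (Real.pi / 2), 1 := by
        rw [Measure.volume_eq_prod, ← Measure.prod_restrict]
        exact lintegral_prod_mul (f := fun r => ENNReal.ofReal r) (g := fun _ => 1)
          (by fun_prop) (by fun_prop)
    _ = _ := by
        have h1 : ∫⁻ r in Set.Ioo 0 (√R), ENNReal.ofReal r = ENNReal.ofReal (R / 2) := by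
          rw [restrict_Ioo_eq_restrict_Ioc, ← ofReal_integral_eq_lintegral_ofReal,
            ← intervalIntegral.integral_of_le (Real.sqrt_nonneg R), integral_id,
            Real.sq_sqrt hR.le]
          · simp
          · exact (continuous_id.intervalIntegrable 0 (√R)).1
          · exact (ae_restrict_mem measurableSet_Ioc).mono fun x hx => hx.1.le
        rw [h1, setLIntegral_one, Real.volume_Icc, mul_comm]
        congr 2
        ring

/-- The ratio of the measure of a wedge and its dihedral angle. -/
def wedgeConstant : ENNReal :=
  4 * ∫⁻ w : Fin 2 → ℝ, ENNReal.ofReal ((1 - (w 0 ^ 2 + w 1 ^ 2)) / 2)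

theorem measurableSet_halfspace (f : E4) : MeasurableSet {x : E4 | 0 ≤ inner ℝ f x} :=
  measurableSet_le (by fun_prop) (by fun_prop)

/-- The planes parallel to the span of `f` and `g` cut the wedge in the ball into sectors of angle
`π - angle f g` and squared radius `1 - ‖w‖²`. So the measure is proportional to this angle; the
factor is never integrated, as `coneMeasure_wedge` finds it by comparison with a half-space. -/
theorem coneMeasure_wedge_aux {f g : E4} (hf : f ≠ 0) (hg : g ≠ 0)
    (h0 : 0 < InnerProductGeometry.angle f g) (hπ : InnerProductGeometry.angle f g < Real.pi) :
    coneMeasure {x | 0 ≤ inner ℝ f x ∧ 0 ≤ inner ℝ g x} =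
      ENNReal.ofReal (Real.pi - InnerProductGeometry.angle f g) * wedgeConstant := by
  set φ := InnerProductGeometry.angle f g with hφ
  have hfn : 0 < ‖f‖ := norm_pos_iff.2 hf
  have hgn : 0 < ‖g‖ := norm_pos_iff.2 hg
  have hs : 0 < Real.sin φ := Real.sin_pos_of_pos_of_lt_pi h0 hπ
  have hin : inner ℝ f g = ‖f‖ * ‖g‖ * Real.cos φ := by
    rw [hφ, mul_comm (‖f‖ * ‖g‖), InnerProductGeometry.cos_angle_mul_norm_mul_norm]
  -- Gram–Schmidt: `f = ‖f‖ e` and `g = ‖g‖ (cos φ e + sin φ e')`.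
  set e : E4 := ‖f‖⁻¹ • f with he
  set e' : E4 := (Real.sin φ)⁻¹ • (‖g‖⁻¹ • g - Real.cos φ • e) with he'
  have hee : inner ℝ e e = 1 := by
    simp only [he, inner_smul_left, inner_smul_right, real_inner_self_eq_norm_sq]
    simp; field_simp
  have heg : inner ℝ e g = ‖g‖ * Real.cos φ := by
    simp only [he, inner_smul_left, hin]
    simp; field_simp
  have hee' : inner ℝ e e' = 0 := by
    simp only [he', inner_smul_right, inner_sub_right, hee, heg]
    field_simp; ring
  have hge : inner ℝ g e = ‖g‖ * Real.cos φ := by rw [real_inner_comm, heg]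
  have he'e' : inner ℝ e' e' = 1 := by
    have h1 : inner ℝ (‖g‖⁻¹ • g - Real.cos φ • e) (‖g‖⁻¹ • g - Real.cos φ • e) =
        Real.sin φ ^ 2 := by
      simp only [inner_sub_left, inner_sub_right, inner_smul_left, inner_smul_right, hee, heg, hge,
        real_inner_self_eq_norm_sq g]
      simp only [conj_trivial]
      field_simp
      linear_combination -Real.cos_sq_add_sin_sq φ
    simp only [he', inner_smul_left, inner_smul_right, h1]
    simp; field_simp
  let v : Fin 2 ⊕ Fin 2 → E4 := Sum.elim ![e, e'] ![0, 0]
  obtain ⟨b, hb⟩ := Orthonormal.exists_orthonormalBasis_extension_of_card_eq (𝕜 := ℝ) (E := E4)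
    (ι := Fin 2 ⊕ Fin 2) (by simp) (v := v) (s := Set.range Sum.inl) (by
      rw [orthonormal_iff_ite]
      rintro ⟨_, i, rfl⟩ ⟨_, j, rfl⟩
      have hn : ‖e‖ = 1 := by
        rw [norm_eq_sqrt_real_inner, hee, Real.sqrt_one]
      have hn' : ‖e'‖ = 1 := by
        rw [norm_eq_sqrt_real_inner, he'e', Real.sqrt_one]
      fin_cases i <;> fin_cases j <;> simp [v, hee', hn, hn', real_inner_comm e e'])
  have hb0 : b (.inl 0) = e := hb _ ⟨0, rfl⟩
  have hb1 : b (.inl 1) = e' := hb _ ⟨1, rfl⟩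
  have hF : MeasurePreserving (fun x : E4 =>
      MeasurableEquiv.sumPiEquivProdPi (fun _ : Fin 2 ⊕ Fin 2 => ℝ) (WithLp.ofLp (b.repr x)))
      volume volume :=
    (volume_measurePreserving_sumPiEquivProdPi _).comp
      ((PiLp.volume_preserving_ofLp _).comp b.measurePreserving_repr)
  have h1 : MeasurableSet {z : (Fin 2 → ℝ) × (Fin 2 → ℝ) | 0 ≤ z.1 0} :=
    measurableSet_le (by fun_prop) (by fun_prop)
  have h2 : MeasurableSet {z : (Fin 2 → ℝ) × (Fin 2 → ℝ) |
      0 ≤ Real.cos φ * z.1 0 + Real.sin φ * z.1 1} :=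
    measurableSet_le (by fun_prop) (by fun_prop)
  have h3 : MeasurableSet {z : (Fin 2 → ℝ) × (Fin 2 → ℝ) |
      z.1 0 ^ 2 + z.1 1 ^ 2 < 1 - (z.2 0 ^ 2 + z.2 1 ^ 2)} :=
    measurableSet_lt (by fun_prop) (by fun_prop)
  have hW := h1.inter (h2.inter h3)
  have hpre : {x | 0 ≤ inner ℝ f x ∧ 0 ≤ inner ℝ g x} ∩ Metric.ball 0 1 = (fun x : E4 =>
      MeasurableEquiv.sumPiEquivProdPi (fun _ : Fin 2 ⊕ Fin 2 => ℝ) (WithLp.ofLp (b.repr x))) ⁻¹'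
      ({z : (Fin 2 → ℝ) × (Fin 2 → ℝ) | 0 ≤ z.1 0} ∩
        ({z : (Fin 2 → ℝ) × (Fin 2 → ℝ) | 0 ≤ Real.cos φ * z.1 0 + Real.sin φ * z.1 1} ∩
        {z : (Fin 2 → ℝ) × (Fin 2 → ℝ) |
          z.1 0 ^ 2 + z.1 1 ^ 2 < 1 - (z.2 0 ^ 2 + z.2 1 ^ 2)})) := by
    ext x
    have e1 : inner ℝ f x = ‖f‖ * b.repr x (.inl 0) := by
      rw [b.repr_apply_apply, hb0, he, inner_smul_left]
      simp; field_simp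
    have e2 : inner ℝ g x = ‖g‖ *
        (Real.cos φ * b.repr x (.inl 0) + Real.sin φ * b.repr x (.inl 1)) := by
      rw [b.repr_apply_apply, b.repr_apply_apply, hb0, hb1, he']
      simp only [inner_smul_left, inner_sub_left, conj_trivial]
      field_simp; ring
    have e3 : ‖x‖ < 1 ↔ b.repr x (.inl 0) ^ 2 + b.repr x (.inl 1) ^ 2 <
        1 - (b.repr x (.inr 0) ^ 2 + b.repr x (.inr 1) ^ 2) := by
      rw [← b.repr.norm_map x, ← sq_lt_one_iff₀ (norm_nonneg _), EuclideanSpace.norm_sq_eq]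
      simp only [Fintype.sum_sum_type, Fin.sum_univ_two, Real.norm_eq_abs, sq_abs]
      exact lt_sub_iff_add_lt.symm
    simp only [Set.mem_inter_iff, Set.mem_ofPred_eq, Metric.mem_ball, dist_zero_right,
      Set.mem_preimage, e1, e2, e3, mul_nonneg_iff_of_pos_left hfn,
      mul_nonneg_iff_of_pos_left hgn, and_assoc]
    rfl
  have hm : MeasurableSet {x | 0 ≤ inner ℝ f x ∧ 0 ≤ inner ℝ g x} :=
    (measurableSet_halfspace f).inter (measurableSet_halfspace g)
  rw [coneMeasure, Measure.smul_apply, Measure.restrict_apply hm, hpre,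
    hF.measure_preimage hW.nullMeasurableSet, Measure.volume_eq_prod,
    Measure.prod_apply_symm hW, smul_eq_mul, wedgeConstant, mul_left_comm,
    ← lintegral_const_mul' _ _ ENNReal.ofReal_ne_top]
  congr 1
  refine lintegral_congr fun w => ?_
  rw [← volume_sector h0 hπ, ← (volume_preserving_finTwoArrow ℝ).measure_preimage_equiv]
  rfl

/-- Up to a null set, the antipodal map exchanges the half-space and its complement. -/
theorem coneMeasure_halfspace {f : E4} (hf : f ≠ 0) :
    coneMeasure.real {x | 0 ≤ inner ℝ f x} = Real.pi ^ 2 := by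
  have h1 : coneMeasure.real {x | 0 ≤ inner ℝ f x}ᶜ = coneMeasure.real {x | 0 ≤ inner ℝ f x} := by
    rw [← coneMeasure_preimage (LinearIsometryEquiv.neg ℝ) (measurableSet_halfspace f)]
    apply measureReal_congr
    have := measure_eq_zero_iff_ae_notMem.1 (coneMeasure_hyperplane hf)
    filter_upwards [this] with x hx
    apply propext
    change (¬ 0 ≤ inner ℝ f x) ↔ (0 ≤ inner ℝ f (-x))
    rw [inner_neg_right]
    have hx : inner ℝ f x ≠ 0 := hx
    constructor
    · intro h; linarith
    · intro h h'; exact hx (by linarith)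
  have h2 := measureReal_add_measureReal_compl (μ := coneMeasure) (measurableSet_halfspace f)
  rw [h1, coneMeasure_univ] at h2
  linarith

/-- The wedges of `f, g` and of `f, -g` make up a half-space and their angles are supplementary, so
`π * wedgeConstant = π²`. -/
theorem coneMeasure_wedge {f g : E4} (hf : f ≠ 0) (hg : g ≠ 0)
    (h0 : 0 < InnerProductGeometry.angle f g) (hπ : InnerProductGeometry.angle f g < Real.pi) :
    coneMeasure.real {x | 0 ≤ inner ℝ f x ∧ 0 ≤ inner ℝ g x} =
      Real.pi * (Real.pi - InnerProductGeometry.angle f g) := by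
  have hA := coneMeasure_wedge_aux hf hg h0 hπ
  have hB := coneMeasure_wedge_aux hf (neg_ne_zero.2 hg)
    (by rw [InnerProductGeometry.angle_neg_right]; linarith)
    (by rw [InnerProductGeometry.angle_neg_right]; linarith)
  rw [InnerProductGeometry.angle_neg_right, sub_sub_cancel] at hB
  have hA' := congrArg ENNReal.toReal hA
  have hB' := congrArg ENNReal.toReal hB
  rw [ENNReal.toReal_mul, ENNReal.toReal_ofReal (by linarith), ← measureReal_def] at hA' hB'
  have hsum : coneMeasure.real {x | 0 ≤ inner ℝ f x ∧ 0 ≤ inner ℝ g x} +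
      coneMeasure.real {x | 0 ≤ inner ℝ f x ∧ 0 ≤ inner ℝ (-g) x} = Real.pi ^ 2 := by
    rw [← coneMeasure_halfspace hf,
      ← measureReal_inter_add_sdiff (μ := coneMeasure) (s := {x | 0 ≤ inner ℝ f x})
        (measurableSet_halfspace g)]
    congr 1
    apply measureReal_congr
    filter_upwards [measure_eq_zero_iff_ae_notMem.1 (coneMeasure_hyperplane hg)] with x hx
    apply propext
    change (0 ≤ inner ℝ f x ∧ 0 ≤ inner ℝ (-g) x) ↔ (0 ≤ inner ℝ f x ∧ ¬ 0 ≤ inner ℝ g x)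
    rw [inner_neg_left]
    have hx : inner ℝ g x ≠ 0 := hx
    refine and_congr_right fun _ => ⟨fun h h' => hx (by linarith), fun h => by linarith⟩
  rw [hA', hB'] at hsum
  have hK : wedgeConstant.toReal = Real.pi := by
    have : Real.pi * wedgeConstant.toReal = Real.pi * Real.pi := by linarith
    exact mul_left_cancel₀ Real.pi_ne_zero this
  rw [hA', hK, mul_comm]

/-- The measure of the intersection of three half-spaces, for example of the cone over
a spherical triangle times a line. -/
theorem coneMeasure_triple {f g h : E4} (hf : f ≠ 0) (hg : g ≠ 0) (hh : h ≠ 0)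
    (hfg : InnerProductGeometry.angle f g ∈ Set.Ioo 0 Real.pi)
    (hfh : InnerProductGeometry.angle f h ∈ Set.Ioo 0 Real.pi)
    (hgh : InnerProductGeometry.angle g h ∈ Set.Ioo 0 Real.pi) :
    coneMeasure.real {x | 0 ≤ inner ℝ f x ∧ 0 ≤ inner ℝ g x ∧ 0 ≤ inner ℝ h x} =
      Real.pi / 2 * (2 * Real.pi - InnerProductGeometry.angle f g -
        InnerProductGeometry.angle f h - InnerProductGeometry.angle g h) := by
  set F := {x : E4 | 0 ≤ inner ℝ f x} with hF
  set G := {x : E4 | 0 ≤ inner ℝ g x} with hG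
  set H := {x : E4 | 0 ≤ inner ℝ h x} with hH
  have mF : MeasurableSet F := measurableSet_halfspace f
  have mG : MeasurableSet G := measurableSet_halfspace g
  have mH : MeasurableSet H := measurableSet_halfspace h
  have w1 : coneMeasure.real (F ∩ G) = _ := coneMeasure_wedge hf hg hfg.1 hfg.2
  have w2 : coneMeasure.real (F ∩ H) = _ := coneMeasure_wedge hf hh hfh.1 hfh.2
  have w3 : coneMeasure.real (G ∩ H) = _ := coneMeasure_wedge hg hh hgh.1 hgh.2
  have s1 : coneMeasure.real F = _ := coneMeasure_halfspace hf
  have s2 : coneMeasure.real G = _ := coneMeasure_halfspace hg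
  have s3 : coneMeasure.real H = _ := coneMeasure_halfspace hh
  change coneMeasure.real (F ∩ (G ∩ H)) = _
  -- The antipodal map carries the triple intersection to the complement of the union. With
  -- inclusion–exclusion this determines the triple intersection from the pairwise ones.
  have hanti : coneMeasure.real (F ∪ G ∪ H)ᶜ = coneMeasure.real (F ∩ (G ∩ H)) := by
    rw [← coneMeasure_preimage (LinearIsometryEquiv.neg ℝ) (mF.inter (mG.inter mH))]
    apply measureReal_congr
    filter_upwards [measure_eq_zero_iff_ae_notMem.1 (coneMeasure_hyperplane hf),
      measure_eq_zero_iff_ae_notMem.1 (coneMeasure_hyperplane hg),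
      measure_eq_zero_iff_ae_notMem.1 (coneMeasure_hyperplane hh)] with x h1 h2 h3
    apply propext
    change (¬ ((0 ≤ inner ℝ f x ∨ 0 ≤ inner ℝ g x) ∨ 0 ≤ inner ℝ h x)) ↔
      (0 ≤ inner ℝ f (-x) ∧ 0 ≤ inner ℝ g (-x) ∧ 0 ≤ inner ℝ h (-x))
    simp only [inner_neg_right]
    have h1 : inner ℝ f x ≠ 0 := h1
    have h2 : inner ℝ g x ≠ 0 := h2
    have h3 : inner ℝ h x ≠ 0 := h3
    push Not
    constructor
    · rintro ⟨⟨a, b⟩, c⟩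
      exact ⟨by linarith, by linarith, by linarith⟩
    · rintro ⟨a, b, c⟩
      exact ⟨⟨lt_of_le_of_ne (by linarith) h1, lt_of_le_of_ne (by linarith) h2⟩,
        lt_of_le_of_ne (by linarith) h3⟩
  have hc := measureReal_add_measureReal_compl (μ := coneMeasure) ((mF.union mG).union mH)
  have u1 := measureReal_union_add_inter (μ := coneMeasure) (s := F ∪ G) mH
  have u2 := measureReal_union_add_inter (μ := coneMeasure) (s := F) mG
  have u3 := measureReal_union_add_inter (μ := coneMeasure) (s := F ∩ H) (mG.inter mH)
  rw [Set.union_inter_distrib_right] at u1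
  have hi : F ∩ H ∩ (G ∩ H) = F ∩ (G ∩ H) := by
    ext x; simp only [Set.mem_inter_iff]; tauto
  rw [hi] at u3
  rw [hanti, coneMeasure_univ] at hc
  linarith

/-! ### Signed volumes of simplicial cones and the cocycle relation -/

/-- The simplicial cone spanned by four vectors. -/
def coneSpan (v : Fin 4 → E4) : Set E4 :=
  {x | ∃ r : Fin 4 → ℝ, (∀ i, 0 ≤ r i) ∧ x = ∑ i, r i • v i}

/-- The determinant of four vectors. -/
def detFour (v : Fin 4 → E4) : ℝ := Matrix.det (Matrix.of fun i j => v i j)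

theorem detFour_ne_zero_iff (v : Fin 4 → E4) : detFour v ≠ 0 ↔ LinearIndependent ℝ v := by
  have h := Matrix.linearIndependent_rows_iff_isUnit (A := Matrix.of fun i j => v i j)
  rw [Matrix.isUnit_iff_isUnit_det, isUnit_iff_ne_zero] at h
  rw [detFour, ← h]
  exact LinearMap.linearIndependent_iff (WithLp.linearEquiv 2 ℝ (Fin 4 → ℝ)).toLinearMap
    (LinearEquiv.ker _) (v := v)

theorem det4_ne_zero_iff (a b c d : E4) :
    det4 a b c d ≠ 0 ↔ LinearIndependent ℝ ![a, b, c, d] :=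
  detFour_ne_zero_iff _

/-- The volume of a spherical simplex with the sign of its determinant. -/
def signedVolume (v : Fin 4 → E4) : ℝ :=
  (SignType.sign (detFour v) : ℝ) * coneMeasure.real (coneSpan v)

/-- The linear dependency between five vectors. -/
theorem sum_detFour_smul (c : Fin 5 → E4) :
    ∑ i : Fin 5, ((-1) ^ (i : ℕ) * detFour (c ∘ i.succAbove)) • c i = 0 := by
  ext k
  -- A 5 × 5 determinant in which the column of the `k`-th coordinates occurs twice vanishes; its
  -- expansion along the first copy is the `k`-th coordinate of the relation.
  have h := Matrix.det_zero_of_column_eq (M := Matrix.of fun i : Fin 5 =>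
    (Fin.cons (c i k) (fun j => c i j) : Fin 5 → ℝ)) (i := 0) (j := k.succ)
    (Fin.succ_ne_zero k).symm (by intro i; simp)
  rw [Matrix.det_succ_column_zero] at h
  simp only [WithLp.ofLp_sum, WithLp.ofLp_smul, Finset.sum_apply, Pi.smul_apply, smul_eq_mul,
    PiLp.zero_apply]
  rw [← h]
  refine Finset.sum_congr rfl fun i _ => ?_
  simp only [Matrix.of_apply, Fin.cons_zero]
  rw [detFour]
  have : (Matrix.of fun i : Fin 5 => (Fin.cons (c i k) (fun j => c i j) : Fin 5 → ℝ)).submatrix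
      i.succAbove Fin.succ = Matrix.of fun a b => (c ∘ i.succAbove) a b := by
    ext a b; simp
  rw [this]
  ring

theorem exists_coordinates {v : Fin 4 → E4} (hv : LinearIndependent ℝ v) (x : E4) :
    ∃ r : Fin 4 → ℝ, x = ∑ i, r i • v i := by
  have h := hv.span_eq_top_of_card_eq_finrank (by simp)
  have hx : x ∈ Submodule.span ℝ (Set.range v) := by rw [h]; trivial
  obtain ⟨r, hr⟩ := (Submodule.mem_span_range_iff_exists_fun ℝ).1 hx
  exact ⟨r, hr.symm⟩

theorem mem_coneSpan_iff {v : Fin 4 → E4} (hv : LinearIndependent ℝ v) (r : Fin 4 → ℝ) :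
    ∑ i, r i • v i ∈ coneSpan v ↔ ∀ i, 0 ≤ r i := by
  refine ⟨?_, fun h => ⟨r, h, rfl⟩⟩
  rintro ⟨r', h, e⟩ i
  rw [← sub_eq_zero, ← Finset.sum_sub_distrib] at e
  simp only [← sub_smul] at e
  have := Fintype.linearIndependent_iff.1 hv _ e i
  rw [sub_eq_zero.1 this]
  exact h i

theorem smul_mem_coneSpan {v : Fin 4 → E4} {r : ℝ} (hr : 0 < r) (x : E4) :
    x ∈ coneSpan v ↔ r • x ∈ coneSpan v := by
  have key : ∀ r : ℝ, 0 < r → ∀ x, x ∈ coneSpan v → r • x ∈ coneSpan v := by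
    rintro r hr _ ⟨s, hs, rfl⟩
    exact ⟨fun i => r * s i, fun i => mul_nonneg hr.le (hs i), by
      simp [Finset.smul_sum, mul_smul]⟩
  refine ⟨key r hr x, fun h => ?_⟩
  simpa [smul_smul, hr.ne'] using key r⁻¹ (inv_pos.2 hr) _ h

theorem measurableSet_coneSpan {v : Fin 4 → E4} (hv : LinearIndependent ℝ v) :
    MeasurableSet (coneSpan v) := by
  let b := basisOfLinearIndependentOfCardEqFinrank hv (by simp)
  have hb : ∀ i, b i = v i := fun i => by simp [b]
  have : coneSpan v = ⋂ i, {x | 0 ≤ b.coord i x} := by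
    ext x
    simp only [Set.mem_iInter, Set.mem_ofPred_eq]
    conv_lhs => rw [← b.sum_repr x]
    simp only [hb]
    exact mem_coneSpan_iff hv _
  rw [this]
  refine MeasurableSet.iInter fun i => measurableSet_le measurable_const ?_
  exact (LinearMap.continuous_of_finiteDimensional (b.coord i)).measurable

theorem tetrahedronVolume_eq (a b c d : S3) :
    tetrahedronVolume a b c d = signedVolume ![(a : E4), b, c, d] := by
  by_cases h : det4 (a : E4) b c d = 0
  · have h' : detFour ![(a : E4), b, c, d] = 0 := h
    simp [tetrahedronVolume, signedVolume, h, h']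
  · have hv := (det4_ne_zero_iff _ _ _ _).1 h
    rw [tetrahedronVolume, signedVolume, ← toSphere_eq_coneMeasure (measurableSet_coneSpan hv)
      fun r hr x => smul_mem_coneSpan hr x]
    congr 3
    ext x
    simp [tetrahedron, coneSpan, Fin.sum_univ_four]

/-- The endpoints of the polyhedron `{t | ∀ j, 0 ≤ μ j + t * l j}`, an interval, counted
with signs. -/
theorem sum_sign_vertices {ι : Type*} [Fintype ι] [Nonempty ι] (l : ι → ℝ) (hl : ∀ i, l i ≠ 0) :
    ∃ n : ℤ, ∀ μ : ι → ℝ, (∀ i j, i ≠ j → μ i * l j ≠ μ j * l i) →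
      ∑ i, (SignType.sign (l i) : ℝ) * (if ∀ j, 0 ≤ μ j - μ i / l i * l j then 1 else 0) = n := by
  classical
  -- At `t = -μ i / l i` the `i`-th coordinate vanishes. The inequalities with `l j > 0` are lower
  -- bounds for `t`, those with `l j < 0` upper bounds.
  have hcond : ∀ μ : ι → ℝ, ∀ i j, (0 ≤ μ j - μ i / l i * l j ↔
      (0 < l j → -μ j / l j ≤ -μ i / l i) ∧ (l j < 0 → -μ i / l i ≤ -μ j / l j)) := by
    intro μ i j
    rcases lt_or_gt_of_ne (hl j) with h | h
    · simp only [h, not_lt.2 h.le, false_imp_iff, true_imp_iff, true_and]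
      rw [neg_div, neg_div, neg_le_neg_iff, div_le_iff_of_neg h, sub_nonneg]
    · simp only [h, not_lt.2 h.le, false_imp_iff, true_imp_iff, and_true]
      rw [neg_div, neg_div, neg_le_neg_iff, le_div_iff₀ h, sub_nonneg]
  have hinj : ∀ μ : ι → ℝ, (∀ i j, i ≠ j → μ i * l j ≠ μ j * l i) →
      ∀ i j, -μ i / l i = -μ j / l j → i = j := by
    intro μ h i j e
    by_contra hne
    rw [div_eq_div_iff (hl i) (hl j)] at e
    exact h i j hne (by linarith)
  by_cases hP : ∃ i, 0 < l i
  · have hmax : ∀ μ : ι → ℝ, ∃ i, 0 < l i ∧ ∀ j, 0 < l j → -μ j / l j ≤ -μ i / l i := by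
      intro μ
      obtain ⟨i, hi, h⟩ := (Finset.univ.filter fun i => 0 < l i).exists_max_image
        (fun i => -μ i / l i) (by obtain ⟨i, hi⟩ := hP; exact ⟨i, by simpa using hi⟩)
      exact ⟨i, by simpa using hi, fun j hj => h j (by simpa using hj)⟩
    -- If both signs occur, the interval is bounded or empty, and its lower endpoint, at `i₀`,
    -- cancels against its upper endpoint, at `j₀`. If only one sign occurs, it is a ray with a
    -- single endpoint, whose sign is that of the `l i`.
    by_cases hN : ∃ i, l i < 0
    · refine ⟨0, fun μ hμ => ?_⟩
      have hi' := hinj μ hμ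
      obtain ⟨i₀, hi₀, hi₀'⟩ := hmax μ
      obtain ⟨j₀, hj₀, hj₀'⟩ : ∃ i, l i < 0 ∧ ∀ j, l j < 0 → -μ i / l i ≤ -μ j / l j := by
        obtain ⟨i, hi, h⟩ := (Finset.univ.filter fun i => l i < 0).exists_min_image
          (fun i => -μ i / l i) (by obtain ⟨i, hi⟩ := hN; exact ⟨i, by simpa using hi⟩)
        exact ⟨i, by simpa using hi, fun j hj => h j (by simpa using hj)⟩
      have hterm : ∀ i, (SignType.sign (l i) : ℝ) *
          (if ∀ j, 0 ≤ μ j - μ i / l i * l j then 1 else 0) =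
          (if i = i₀ then (if -μ i₀ / l i₀ ≤ -μ j₀ / l j₀ then 1 else 0) else 0) -
          (if i = j₀ then (if -μ i₀ / l i₀ ≤ -μ j₀ / l j₀ then 1 else 0) else 0) := by
        intro i
        simp only [hcond]
        rcases lt_or_gt_of_ne (hl i) with h | h
        · have hne : i ≠ i₀ := by rintro rfl; linarith
          have : (∀ j, (0 < l j → -μ j / l j ≤ -μ i / l i) ∧ (l j < 0 → -μ i / l i ≤ -μ j / l j)) ↔
              (i = j₀ ∧ -μ i₀ / l i₀ ≤ -μ j₀ / l j₀) := by
            constructor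
            · intro H
              have e : i = j₀ := hi' _ _ (le_antisymm ((H j₀).2 hj₀) (hj₀' i h))
              subst e
              exact ⟨rfl, (H i₀).1 hi₀⟩
            · rintro ⟨rfl, H⟩ j
              exact ⟨fun hj => (hi₀' j hj).trans H, hj₀' j⟩
          simp only [this, sign_neg h, hne, if_false]
          by_cases e : i = j₀ <;> by_cases e' : -μ i₀ / l i₀ ≤ -μ j₀ / l j₀ <;> simp [e, e']
        · have hne : i ≠ j₀ := by rintro rfl; linarith
          have : (∀ j, (0 < l j → -μ j / l j ≤ -μ i / l i) ∧ (l j < 0 → -μ i / l i ≤ -μ j / l j)) ↔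
              (i = i₀ ∧ -μ i₀ / l i₀ ≤ -μ j₀ / l j₀) := by
            constructor
            · intro H
              have e : i = i₀ := hi' _ _ (le_antisymm (hi₀' i h) ((H i₀).1 hi₀))
              subst e
              exact ⟨rfl, (H j₀).2 hj₀⟩
            · rintro ⟨rfl, H⟩ j
              exact ⟨hi₀' j, fun hj => H.trans (hj₀' j hj)⟩
          simp only [this, sign_pos h, hne, if_false]
          by_cases e : i = i₀ <;> simp [e]
      simp only [hterm, Finset.sum_sub_distrib, Finset.sum_ite_eq', Finset.mem_univ, if_true]
      simp
    · have hpos : ∀ i, 0 < l i := fun i => lt_of_le_of_ne (not_lt.1 fun h => hN ⟨i, h⟩) (hl i).symm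
      refine ⟨1, fun μ hμ => ?_⟩
      have hi' := hinj μ hμ
      obtain ⟨i₀, hi₀, hi₀'⟩ := hmax μ
      have hterm : ∀ i, (SignType.sign (l i) : ℝ) *
          (if ∀ j, 0 ≤ μ j - μ i / l i * l j then 1 else 0) = if i = i₀ then 1 else 0 := by
        intro i
        have : (∀ j, (0 < l j → -μ j / l j ≤ -μ i / l i) ∧ (l j < 0 → -μ i / l i ≤ -μ j / l j)) ↔
            i = i₀ := by
          constructor
          · intro H
            exact hi' _ _ (le_antisymm (hi₀' i (hpos i)) ((H i₀).1 hi₀))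
          · rintro rfl j
            exact ⟨hi₀' j, fun hj => absurd hj (not_lt.2 (hpos j).le)⟩
        simp only [hcond, this, sign_pos (hpos i)]
        simp
      simp only [hterm]
      simp
  · have hneg : ∀ i, l i < 0 := fun i => lt_of_le_of_ne (not_lt.1 fun h => hP ⟨i, h⟩) (hl i)
    refine ⟨-1, fun μ hμ => ?_⟩
    have hi' := hinj μ hμ
    obtain ⟨j₀, -, hj₀⟩ := (Finset.univ : Finset ι).exists_min_image
      (fun i => -μ i / l i) Finset.univ_nonempty
    have hterm : ∀ i, (SignType.sign (l i) : ℝ) *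
        (if ∀ j, 0 ≤ μ j - μ i / l i * l j then 1 else 0) = if i = j₀ then -1 else 0 := by
      intro i
      have : (∀ j, (0 < l j → -μ j / l j ≤ -μ i / l i) ∧ (l j < 0 → -μ i / l i ≤ -μ j / l j)) ↔
          i = j₀ := by
        constructor
        · intro H
          exact hi' _ _ (le_antisymm ((H j₀).2 (hneg j₀)) (hj₀ i (Finset.mem_univ i)))
        · rintro rfl j
          exact ⟨fun hj => absurd hj (not_lt.2 (hneg j).le), fun _ => hj₀ j (Finset.mem_univ j)⟩
      simp only [hcond, this, sign_neg (hneg i)]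
      simp
    simp only [hterm]
    simp

/-- The cocycle relation for oriented volumes. -/
theorem signedVolume_cocycle (c : Fin 5 → E4) (hc : ∀ i : Fin 5, detFour (c ∘ i.succAbove) ≠ 0) :
    ∃ n : ℤ, ∑ i : Fin 5, (-1) ^ (i : ℕ) * signedVolume (c ∘ i.succAbove) =
      n * (2 * Real.pi ^ 2) := by
  classical
  set l : Fin 5 → ℝ := fun i => (-1) ^ (i : ℕ) * detFour (c ∘ i.succAbove) with hl
  have hl0 : ∀ i, l i ≠ 0 := fun i => mul_ne_zero (by simp) (hc i)
  have hrel : ∑ i, l i • c i = 0 := sum_detFour_smul c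
  obtain ⟨n, hn⟩ := sum_sign_vertices l hl0
  refine ⟨n, ?_⟩
  have hli : ∀ i : Fin 5, LinearIndependent ℝ (c ∘ i.succAbove) :=
    fun i => (detFour_ne_zero_iff _).1 (hc i)
  -- The coordinate vectors of `x` with respect to the five vectors form a line `μ + t l`. The point
  -- `x` lies in the `i`-th cone iff the point of this line with vanishing `i`-th coordinate has
  -- only nonnegative coordinates. So the signed number of cones containing `x` is a signed count of
  -- endpoints, and `sum_sign_vertices` makes it almost everywhere constant.
  have hae : ∀ᵐ x ∂coneMeasure, ∑ i : Fin 5, (SignType.sign (l i) : ℝ) *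
      (coneSpan (c ∘ i.succAbove)).indicator (fun _ => (1 : ℝ)) x = n := by
    -- Off the hyperplanes of the facets no two coordinates vanish at the same point of the line, as
    -- `sum_sign_vertices` requires.
    have hspan : ∀ᵐ x ∂coneMeasure, ∀ i : Fin 5, ∀ k : Fin 4,
        x ∉ Submodule.span ℝ ((c ∘ i.succAbove) '' {k}ᶜ) := by
      rw [ae_all_iff]; intro i
      rw [ae_all_iff]; intro k
      refine measure_eq_zero_iff_ae_notMem.1 (coneMeasure_absolutelyContinuous
        (Measure.addHaar_submodule _ _ ?_))
      intro h
      have := (hli i).notMem_span_image (s := {k}ᶜ) (x := k) (by simp)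
      rw [h] at this
      exact this trivial
    filter_upwards [hspan] with x hx
    obtain ⟨r, hr⟩ := exists_coordinates (hli 0) x
    set μ : Fin 5 → ℝ := Fin.cons 0 r with hμ
    have hxμ : x = ∑ i, μ i • c i := by
      rw [hr, Fin.sum_univ_succ (fun i => μ i • c i)]
      simp only [hμ, Fin.cons_zero, zero_smul, zero_add, Fin.cons_succ]
      rfl
    have hx' : ∀ i, x = ∑ k, (μ (i.succAbove k) - μ i / l i * l (i.succAbove k)) •
        (c ∘ i.succAbove) k := by
      intro i
      have h1 : x = ∑ j, (μ j - μ i / l i * l j) • c j := by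
        simp only [sub_smul, Finset.sum_sub_distrib, mul_smul, ← Finset.smul_sum, hrel]
        simpa using hxμ
      rw [h1, Fin.sum_univ_succAbove _ i]
      simp [div_mul_cancel₀ _ (hl0 i)]
    have hmem : ∀ i : Fin 5, x ∈ coneSpan (c ∘ i.succAbove) ↔
        ∀ j, 0 ≤ μ j - μ i / l i * l j := by
      intro i
      conv_lhs => rw [hx' i]
      rw [mem_coneSpan_iff (hli i), Fin.forall_iff_succAbove i]
      simp [div_mul_cancel₀ _ (hl0 i)]
    rw [← hn μ]
    · refine Finset.sum_congr rfl fun i _ => ?_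
      rw [Set.indicator_apply]
      simp only [hmem]
      congr
    · intro i j hij h
      obtain ⟨k, rfl⟩ := Fin.exists_succAbove_eq hij.symm
      apply hx i k
      rw [hx' i]
      refine Submodule.sum_mem _ fun m _ => ?_
      by_cases hm : m = k
      · subst hm
        have : μ (i.succAbove m) - μ i / l i * l (i.succAbove m) = 0 := by
          have := hl0 i
          field_simp
          linarith
        rw [this, zero_smul]
        exact Submodule.zero_mem _
      · exact Submodule.smul_mem _ _ (Submodule.subset_span ⟨m, hm, rfl⟩)
  have hint := integral_congr_ae hae
  rw [integral_const, coneMeasure_univ, smul_eq_mul, mul_comm, integral_finsetSum] at hint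
  · rw [← hint]
    refine Finset.sum_congr rfl fun i _ => ?_
    rw [integral_const_mul, integral_indicator_const _ (measurableSet_coneSpan (hli i)),
      signedVolume, hl]
    simp only [sign_mul, sign_pow, smul_eq_mul, mul_one, SignType.coe_mul, SignType.coe_pow,
      Left.sign_neg, sign_one, SignType.coe_neg, SignType.coe_one]
    ring
  · intro i _
    exact ((integrable_const _).indicator (measurableSet_coneSpan (hli i))).const_mul _

/-! ### The oriented volume of an octahedron -/

theorem coneSpan_comp_perm (v : Fin 4 → E4) (ρ : Equiv.Perm (Fin 4)) :
    coneSpan (v ∘ ρ) = coneSpan v := by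
  ext x
  constructor
  · rintro ⟨r, hr, rfl⟩
    exact ⟨r ∘ ρ.symm, fun i => hr _, by
      rw [← Equiv.sum_comp ρ fun i => (r ∘ ρ.symm) i • v i]; simp⟩
  · rintro ⟨r, hr, rfl⟩
    exact ⟨r ∘ ρ, fun i => hr _, by
      rw [← Equiv.sum_comp ρ fun i => r i • v i]; simp⟩

theorem signedVolume_comp_perm (v : Fin 4 → E4) (ρ : Equiv.Perm (Fin 4)) :
    signedVolume (v ∘ ρ) = (Equiv.Perm.sign ρ : ℤ) * signedVolume v := by
  have h : detFour (v ∘ ρ) = (Equiv.Perm.sign ρ : ℤ) * detFour v :=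
    Matrix.det_permute ρ (Matrix.of fun i j => v i j)
  rw [signedVolume, signedVolume, coneSpan_comp_perm, h]
  rcases Int.units_eq_one_or (Equiv.Perm.sign ρ) with h | h <;> simp [h, Left.sign_neg]

theorem signedVolume_swap_23 (a b c d : E4) :
    signedVolume ![a, b, d, c] = -signedVolume ![a, b, c, d] := by
  have h := signedVolume_comp_perm ![a, b, c, d] (Equiv.swap 2 3)
  rw [Equiv.Perm.sign_swap (by decide)] at h
  have e : ![a, b, c, d] ∘ Equiv.swap (2 : Fin 4) 3 = ![a, b, d, c] := by
    ext i; fin_cases i <;> rfl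
  rw [e] at h
  simpa using h

theorem signedVolume_swap_12 (a b c d : E4) :
    signedVolume ![a, c, b, d] = -signedVolume ![a, b, c, d] := by
  have h := signedVolume_comp_perm ![a, b, c, d] (Equiv.swap 1 2)
  rw [Equiv.Perm.sign_swap (by decide)] at h
  have e : ![a, b, c, d] ∘ Equiv.swap (1 : Fin 4) 2 = ![a, c, b, d] := by
    ext i; fin_cases i <;> rfl
  rw [e] at h
  simpa using h

theorem signedVolume_cocycle' {a b c d e : E4} (ha : LinearIndependent ℝ ![b, c, d, e])
    (hb : LinearIndependent ℝ ![a, c, d, e]) (hc : LinearIndependent ℝ ![a, b, d, e])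
    (hd : LinearIndependent ℝ ![a, b, c, e]) (he : LinearIndependent ℝ ![a, b, c, d]) :
    ∃ n : ℤ, signedVolume ![b, c, d, e] - signedVolume ![a, c, d, e] + signedVolume ![a, b, d, e]
      - signedVolume ![a, b, c, e] + signedVolume ![a, b, c, d] = n * (2 * Real.pi ^ 2) := by
  have e0 : ![a, b, c, d, e] ∘ (0 : Fin 5).succAbove = ![b, c, d, e] := by
    ext i; fin_cases i <;> rfl
  have e1 : ![a, b, c, d, e] ∘ (1 : Fin 5).succAbove = ![a, c, d, e] := by
    ext i; fin_cases i <;> rfl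
  have e2 : ![a, b, c, d, e] ∘ (2 : Fin 5).succAbove = ![a, b, d, e] := by
    ext i; fin_cases i <;> rfl
  have e3 : ![a, b, c, d, e] ∘ (3 : Fin 5).succAbove = ![a, b, c, e] := by
    ext i; fin_cases i <;> rfl
  have e4 : ![a, b, c, d, e] ∘ (4 : Fin 5).succAbove = ![a, b, c, d] := by
    ext i; fin_cases i <;> rfl
  obtain ⟨n, hn⟩ := signedVolume_cocycle ![a, b, c, d, e] (by
    intro i
    rw [detFour_ne_zero_iff]
    fin_cases i
    exacts [e0 ▸ ha, e1 ▸ hb, e2 ▸ hc, e3 ▸ hd, e4 ▸ he])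
  refine ⟨n, ?_⟩
  rw [← hn, Fin.sum_univ_five, e0, e1, e2, e3, e4]
  simp
  ring

/-- The sum over the positively oriented faces of the octahedron. -/
theorem sum_octFace (F : OctV → OctV → OctV → ℝ) (hF : ∀ u v w, F u v w = F v w u) :
    ∑ u, ∑ v, ∑ w, (if OctFace u v w then F u v w else 0) = 3 * (
      (F (2, false) (0, false) (1, false) + F (2, true) (1, false) (0, false)) +
      (F (2, false) (1, false) (0, true) + F (2, true) (0, true) (1, false)) +
      (F (2, false) (0, true) (1, true) + F (2, true) (1, true) (0, true)) +
      (F (2, false) (1, true) (0, false) + F (2, true) (0, false) (1, true))) := by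
  have key : ∀ u v w, F u v w + F v w u + F w u v = 3 * F u v w := fun u v w => by
    rw [hF w u v, ← hF u v w]; ring
  simp only [Fintype.sum_prod_type, Fin.sum_univ_three, Fintype.sum_bool]
  simp +decide only [if_true, if_false, add_zero, zero_add]
  linear_combination key (2, false) (0, false) (1, false) + key (2, true) (1, false) (0, false) +
      key (2, false) (1, false) (0, true) + key (2, true) (0, true) (1, false) +
      key (2, false) (0, true) (1, true) + key (2, true) (1, true) (0, true) +
      key (2, false) (1, true) (0, false) + key (2, true) (0, false) (1, true)

theorem volumeFrom_octahedron (P : OctV → S3) (o : S3) :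
    volumeFrom octahedron P o = 1 / 3 * ∑ u, ∑ v, ∑ w,
      (if OctFace u v w then signedVolume ![(o : E4), P u, P v, P w] else 0) := by
  simp only [volumeFrom, tetrahedronVolume_eq]
  congr! 7

theorem volumeFrom_octahedron_eq (P : OctV → S3) (o : S3) :
    volumeFrom octahedron P o =
      (signedVolume ![(o : E4), P (2, false), P (0, false), P (1, false)] +
        signedVolume ![(o : E4), P (2, true), P (1, false), P (0, false)]) +
      (signedVolume ![(o : E4), P (2, false), P (1, false), P (0, true)] +
        signedVolume ![(o : E4), P (2, true), P (0, true), P (1, false)]) +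
      (signedVolume ![(o : E4), P (2, false), P (0, true), P (1, true)] +
        signedVolume ![(o : E4), P (2, true), P (1, true), P (0, true)]) +
      (signedVolume ![(o : E4), P (2, false), P (1, true), P (0, false)] +
        signedVolume ![(o : E4), P (2, true), P (0, false), P (1, true)]) := by
  rw [volumeFrom_octahedron, sum_octFace]
  · ring
  · intro u v w
    rw [← neg_neg (signedVolume ![(o : E4), P u, P v, P w]), ← signedVolume_swap_12,
      ← signedVolume_swap_23]

theorem octFace_of_ne : ∀ u v : OctV, u.1 ≠ v.1 → ∃ w, OctFace u v w := by decide

theorem octFace_adj : ∀ u v w : OctV, OctFace u v w → u.1 ≠ v.1 ∧ v.1 ≠ w.1 ∧ u.1 ≠ w.1 := by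
  decide

/-- The cocycle relation for `o, o', u, v, w` compares the two tetrahedra over each face. The terms
that belong to an edge cancel, because its two faces induce opposite orientations on it. -/
theorem exists_volumeFrom_sub {P : OctV → S3} {o o' : S3}
    (ho : IsGenericPoint octahedron P o) (ho' : IsGenericPoint octahedron P o')
    (he : ∀ u v : OctV, u.1 ≠ v.1 → LinearIndependent ℝ ![(o : E4), o', P u, P v]) :
    ∃ n : ℤ, volumeFrom octahedron P o - volumeFrom octahedron P o' = n * (2 * Real.pi ^ 2) := by
  have key : ∀ u v w, ∃ n : ℤ, OctFace u v w →
      signedVolume ![(o' : E4), P u, P v, P w] - signedVolume ![(o : E4), P u, P v, P w] +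
      signedVolume ![(o : E4), o', P v, P w] - signedVolume ![(o : E4), o', P u, P w] +
      signedVolume ![(o : E4), o', P u, P v] = n * (2 * Real.pi ^ 2) := by
    intro u v w
    by_cases h : OctFace u v w
    · obtain ⟨h1, h2, h3⟩ := octFace_adj u v w h
      obtain ⟨n, hn⟩ := signedVolume_cocycle' (ho' u v w h) (ho u v w h) (he v w h2) (he u w h3)
        (he u v h1)
      exact ⟨n, fun _ => hn⟩
    · exact ⟨0, fun h' => absurd h' h⟩
  choose n hn using key
  refine ⟨-(n (2, false) (0, false) (1, false) + n (2, true) (1, false) (0, false) +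
      n (2, false) (1, false) (0, true) + n (2, true) (0, true) (1, false) +
      n (2, false) (0, true) (1, true) + n (2, true) (1, true) (0, true) +
      n (2, false) (1, true) (0, false) + n (2, true) (0, false) (1, true)), ?_⟩
  rw [volumeFrom_octahedron_eq, volumeFrom_octahedron_eq]
  push_cast
  -- The terms of the edges at the vertices `(2, _)` cancel literally; those of the other four edges
  -- occur in both orders, whence the swaps.
  linear_combination -hn (2, false) (0, false) (1, false) (by decide) -
      hn (2, true) (1, false) (0, false) (by decide) -
      hn (2, false) (1, false) (0, true) (by decide) - hn (2, true) (0, true) (1, false) (by decide) -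
      hn (2, false) (0, true) (1, true) (by decide) - hn (2, true) (1, true) (0, true) (by decide) -
      hn (2, false) (1, true) (0, false) (by decide) - hn (2, true) (0, false) (1, true) (by decide)
      + signedVolume_swap_23 o o' (P (0, false)) (P (1, false))
      + signedVolume_swap_23 o o' (P (1, false)) (P (0, true))
      + signedVolume_swap_23 o o' (P (0, true)) (P (1, true))
      + signedVolume_swap_23 o o' (P (1, true)) (P (0, false))

/-- Proper subspaces are null sets, so almost every vector avoids finitely many of them; normalizing
such a vector puts it on the sphere. -/
theorem exists_forall_linearIndependent {κ : Type*} [Finite κ] (v : κ → Fin 3 → E4)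
    (hv : ∀ k, LinearIndependent ℝ (v k)) :
    ∃ o : S3, ∀ k, LinearIndependent ℝ (Fin.cons (o : E4) (v k) : Fin 4 → E4) := by
  have h : ∀ᵐ x ∂(volume : Measure E4), ∀ k, x ∉ Submodule.span ℝ (Set.range (v k)) := by
    have := Finite.to_countable (α := κ)
    rw [ae_all_iff]
    intro k
    refine measure_eq_zero_iff_ae_notMem.1 (Measure.addHaar_submodule _ _ fun h => ?_)
    have h1 := finrank_span_eq_card (hv k)
    rw [h, finrank_top] at h1
    simp at h1
  obtain ⟨x, hx, hx0⟩ := (h.and (measure_eq_zero_iff_ae_notMem.1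
    (measure_singleton (μ := (volume : Measure E4)) 0))).exists
  have hx0 : x ≠ 0 := hx0
  refine ⟨⟨‖x‖⁻¹ • x, by simp [norm_smul, hx0]⟩, fun k => linearIndependent_finCons.2
    ⟨hv k, fun h => hx k ?_⟩⟩
  have := Submodule.smul_mem _ ‖x‖ h
  simpa [smul_smul, hx0] using this

theorem exists_isGenericPoint {P : OctV → S3} (hP : IsNondegenerate octahedron P) :
    ∃ o, IsGenericPoint octahedron P o := by
  obtain ⟨o, ho⟩ := exists_forall_linearIndependent
    (fun k : {k : OctV × OctV × OctV // OctFace k.1 k.2.1 k.2.2} =>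
      ![(P k.1.1 : E4), P k.1.2.1, P k.1.2.2]) fun k => hP _ _ _ k.2
  exact ⟨o, fun u v w h => ho ⟨(u, v, w), h⟩⟩

/-- The pairs of adjacent vertices of the octahedron. -/
abbrev AdjPair : Type := {k : OctV × OctV // k.1.1 ≠ k.2.1}

theorem LinearIndependent.vec4_drop {a b c d : E4} (h : LinearIndependent ℝ ![a, b, c, d]) :
    LinearIndependent ℝ ![a, b, c] := by
  have := h.comp (Fin.castSucc : Fin 3 → Fin 4) (Fin.castSucc_injective 3)
  have e : ![a, b, c, d] ∘ (Fin.castSucc : Fin 3 → Fin 4) = ![a, b, c] := by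
    ext i; fin_cases i <;> rfl
  rwa [e] at this

theorem LinearIndependent.vec4_perm {v w : Fin 4 → E4} (h : LinearIndependent ℝ v)
    (ρ : Equiv.Perm (Fin 4)) (e : v ∘ ρ = w) : LinearIndependent ℝ w :=
  e ▸ h.comp ρ ρ.injective

theorem linearIndependent_swap_01 {a b c d : E4} (h : LinearIndependent ℝ ![a, b, c, d]) :
    LinearIndependent ℝ ![b, a, c, d] :=
  LinearIndependent.vec4_perm h (Equiv.swap 0 1) (by ext i; fin_cases i <;> rfl)

theorem linearIndependent_swap_23 {a b c d : E4} (h : LinearIndependent ℝ ![a, b, c, d]) :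
    LinearIndependent ℝ ![a, b, d, c] :=
  LinearIndependent.vec4_perm h (Equiv.swap 2 3) (by ext i; fin_cases i <;> rfl)

/-- The oriented volume of an octahedron can be computed from every generic point. -/
theorem orientedVolume_eq_volumeFrom {P : OctV → S3} {o : S3}
    (ho : IsGenericPoint octahedron P o) :
    orientedVolume octahedron P = (volumeFrom octahedron P o : AddCircle (2 * Real.pi ^ 2)) := by
  have hex : ∃ o, IsGenericPoint octahedron P o := ⟨o, ho⟩
  rw [orientedVolume, dif_pos hex]
  have hc := hex.choose_spec
  set o₁ := hex.choose
  have hedge : ∀ o : S3, IsGenericPoint octahedron P o → ∀ u v : OctV, u.1 ≠ v.1 →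
      LinearIndependent ℝ ![(o : E4), P u, P v] := by
    intro o ho u v huv
    obtain ⟨w, hw⟩ := octFace_of_ne u v huv
    exact LinearIndependent.vec4_drop (ho u v w hw)
  have hP : ∀ u v w, OctFace u v w → LinearIndependent ℝ ![(P u : E4), P v, P w] :=
    fun u v w h => (linearIndependent_finCons.1 (ho u v w h)).1
  -- The points `o` and `o₁` need not be in general position to each other, so both are compared
  -- with a third point `o₂`.
  obtain ⟨o₂, h₂⟩ := exists_forall_linearIndependent
    (κ := {k : OctV × OctV × OctV // OctFace k.1 k.2.1 k.2.2} ⊕ (Bool × AdjPair))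
    (Sum.elim (fun k => ![(P k.1.1 : E4), P k.1.2.1, P k.1.2.2])
      (fun k => ![((if k.1 then o else o₁ : S3) : E4), P k.2.1.1, P k.2.1.2])) (by
    rintro (k | ⟨b, k⟩)
    · exact hP _ _ _ k.2
    · cases b
      · exact hedge o₁ hc _ _ k.2
      · exact hedge o ho _ _ k.2)
  have hg : IsGenericPoint octahedron P o₂ := fun u v w h => h₂ (.inl ⟨(u, v, w), h⟩)
  obtain ⟨n, hn⟩ := exists_volumeFrom_sub hg ho fun u v h => h₂ (.inr (true, ⟨(u, v), h⟩))
  obtain ⟨m, hm⟩ := exists_volumeFrom_sub hg hc fun u v h => h₂ (.inr (false, ⟨(u, v), h⟩))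
  rw [← sub_eq_zero, ← AddCircle.coe_sub, AddCircle.coe_eq_zero_iff]
  exact ⟨n - m, by simp only [zsmul_eq_mul]; push_cast; linear_combination hm - hn⟩

/-- The oriented volume of an octahedron as a sum over the four tetrahedra that contain
a diagonal. -/
theorem orientedVolume_octahedron {P : OctV → S3} (hP : IsNondegenerate octahedron P)
    (h : ∀ i j, LinearIndependent ℝ
      ![(P (2, false) : E4), P (2, true), P (0, i), P (1, j)]) :
    orientedVolume octahedron P = ((-(
      signedVolume ![(P (2, false) : E4), P (2, true), P (0, false), P (1, false)] -
      signedVolume ![(P (2, false) : E4), P (2, true), P (0, true), P (1, false)] +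
      signedVolume ![(P (2, false) : E4), P (2, true), P (0, true), P (1, true)] -
      signedVolume ![(P (2, false) : E4), P (2, true), P (0, false), P (1, true)]) : ℝ) :
        AddCircle (2 * Real.pi ^ 2)) := by
  obtain ⟨o, ho'⟩ := exists_forall_linearIndependent
    (κ := {k : OctV × OctV × OctV // OctFace k.1 k.2.1 k.2.2} ⊕ (Bool ⊕ Bool))
    (Sum.elim (fun k => ![(P k.1.1 : E4), P k.1.2.1, P k.1.2.2])
      (Sum.elim (fun i => ![(P (2, false) : E4), P (2, true), P (0, i)])
        (fun i => ![(P (2, false) : E4), P (2, true), P (1, i)]))) (by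
    rintro (k | i | i)
    · exact hP _ _ _ k.2
    · exact LinearIndependent.vec4_drop (h i false)
    · exact LinearIndependent.vec4_drop (linearIndependent_swap_23 (h false i)))
  have ho : IsGenericPoint octahedron P o := fun u v w h => ho' (.inl ⟨(u, v, w), h⟩)
  have hx : ∀ i, LinearIndependent ℝ ![(o : E4), P (2, false), P (2, true), P (0, i)] :=
    fun i => ho' (.inr (.inl i))
  have hy : ∀ i, LinearIndependent ℝ ![(o : E4), P (2, false), P (2, true), P (1, i)] :=
    fun i => ho' (.inr (.inr i))
  have hf : ∀ k i j, LinearIndependent ℝ ![(o : E4), P (2, k), P (0, i), P (1, j)] := by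
    intro k i j
    have : OctFace (2, k) (0, i) (1, j) ∨ OctFace (2, k) (1, j) (0, i) := by
      revert k i j; decide
    rcases this with h | h
    · exact ho _ _ _ h
    · exact linearIndependent_swap_23 (ho _ _ _ h)
  -- The five points are `o`, the ends of the third diagonal and the ends of an edge `(0, i) (1,
  -- j)`. In the alternating sum around the quadrilateral of these edges, the terms that contain
  -- both `o` and the diagonal cancel.
  have key : ∀ i j, ∃ n : ℤ, _ := fun i j =>
    signedVolume_cocycle' (h i j) (hf true i j) (hf false i j) (hy j) (hx i)
  choose n hn using key
  rw [orientedVolume_eq_volumeFrom ho, volumeFrom_octahedron_eq, ← sub_eq_zero,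
    ← AddCircle.coe_sub, AddCircle.coe_eq_zero_iff]
  refine ⟨n false false - n true false + n true true - n false true, ?_⟩
  simp only [zsmul_eq_mul]
  push_cast
  linear_combination -hn false false + hn true false - hn true true + hn false true -
    signedVolume_swap_23 (o : E4) (P (2, true)) (P (0, false)) (P (1, false)) -
    signedVolume_swap_23 (o : E4) (P (2, false)) (P (0, true)) (P (1, false)) -
    signedVolume_swap_23 (o : E4) (P (2, true)) (P (0, true)) (P (1, true)) -
    signedVolume_swap_23 (o : E4) (P (2, false)) (P (0, false)) (P (1, true))

/-! ### Permuting the indices of the vertices -/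

/-- The permutation of the vertices induced by a permutation of the indices. -/
def reindex (ρ : Equiv.Perm (Fin 3)) : Equiv.Perm OctV := ρ.prodCongr (Equiv.refl Bool)

/-- Even permutations of the indices preserve the orientation of the octahedron and odd ones reverse
it. -/
theorem octFace_reindex : ∀ ρ : Equiv.Perm (Fin 3),
    (∀ u v w, OctFace (reindex ρ u) (reindex ρ v) (reindex ρ w) ↔ OctFace u v w) ∨
    (∀ u v w, OctFace (reindex ρ u) (reindex ρ v) (reindex ρ w) ↔ OctFace v u w) := by
  decide

theorem isGenericPoint_reindex {P : OctV → S3} {o : S3} (ho : IsGenericPoint octahedron P o)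
    (ρ : Equiv.Perm (Fin 3)) : IsGenericPoint octahedron (P ∘ reindex ρ) o := by
  intro u v w h
  rcases octFace_reindex ρ with hr | hr
  · exact ho _ _ _ ((hr _ _ _).2 h)
  · exact LinearIndependent.vec4_perm (ho _ _ _ ((hr _ _ _).2 h)) (Equiv.swap 1 2)
      (by ext i; fin_cases i <;> rfl)

theorem sum_comp_reindex {α : Type*} [Fintype α] (e : Equiv.Perm α) (F : α → α → α → ℝ) :
    ∑ u, ∑ v, ∑ w, F (e u) (e v) (e w) = ∑ u, ∑ v, ∑ w, F u v w := by
  rw [← Equiv.sum_comp e fun u => ∑ v, ∑ w, F u v w]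
  refine Finset.sum_congr rfl fun u _ => ?_
  rw [← Equiv.sum_comp e fun v => ∑ w, F (e u) v w]
  refine Finset.sum_congr rfl fun v _ => ?_
  rw [← Equiv.sum_comp e fun w => F (e u) (e v) w]

theorem orientedVolume_reindex (ρ : Equiv.Perm (Fin 3)) :
    (∀ P : OctV → S3, IsNondegenerate octahedron P →
      orientedVolume octahedron (P ∘ reindex ρ) = orientedVolume octahedron P) ∨
    ∀ P : OctV → S3, IsNondegenerate octahedron P →
      orientedVolume octahedron (P ∘ reindex ρ) = -orientedVolume octahedron P := by
  have key : ∀ (P : OctV → S3) (o : S3), volumeFrom octahedron P o = 1 / 3 * ∑ u, ∑ v, ∑ w,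
      (if OctFace (reindex ρ u) (reindex ρ v) (reindex ρ w) then
        signedVolume ![(o : E4), P (reindex ρ u), P (reindex ρ v), P (reindex ρ w)] else 0) := by
    intro P o
    rw [volumeFrom_octahedron, ← sum_comp_reindex (reindex ρ) fun u v w =>
      (if OctFace u v w then signedVolume ![(o : E4), P u, P v, P w] else 0)]
  rcases octFace_reindex ρ with hr | hr
  · left
    intro P hP
    obtain ⟨o, ho⟩ := exists_isGenericPoint hP
    rw [orientedVolume_eq_volumeFrom ho,
      orientedVolume_eq_volumeFrom (isGenericPoint_reindex ho ρ), key P, volumeFrom_octahedron]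
    simp only [hr, Function.comp]
  · right
    intro P hP
    obtain ⟨o, ho⟩ := exists_isGenericPoint hP
    rw [orientedVolume_eq_volumeFrom ho,
      orientedVolume_eq_volumeFrom (isGenericPoint_reindex ho ρ), key P, volumeFrom_octahedron,
      ← AddCircle.coe_neg]
    congr 1
    rw [← mul_neg, ← Finset.sum_neg_distrib, Finset.sum_comm]
    simp only [hr, Function.comp, ← Finset.sum_neg_distrib]
    congr 1
    refine Finset.sum_congr rfl fun u _ => Finset.sum_congr rfl fun v _ =>
      Finset.sum_congr rfl fun w _ => ?_
    split_ifs
    · exact signedVolume_swap_12 _ _ _ _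
    · simp

/-- Whether the volume is constant does not depend on the labelling of the vertices. -/
theorem hasConstantVolume_reindex {P : I → OctV → S3}
    (hP : ∀ s, IsNondegenerate octahedron (P s)) (ρ : Equiv.Perm (Fin 3))
    (h : HasConstantVolume octahedron P) :
    HasConstantVolume octahedron fun s => P s ∘ reindex ρ := by
  obtain ⟨c, hc⟩ := h
  rcases orientedVolume_reindex ρ with h | h
  · exact ⟨c, fun s => (h _ (hP s)).trans (hc s)⟩
  · exact ⟨-c, fun s => (h _ (hP s)).trans (congrArg _ (hc s))⟩

/-! ### Tetrahedra with a half-turn symmetry -/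

theorem exists_isometry_of_gram {v w : Fin 4 → E4} (hv : LinearIndependent ℝ v)
    (h : ∀ i j, inner ℝ (v i) (v j) = inner ℝ (w i) (w j)) :
    ∃ g : E4 ≃ₗᵢ[ℝ] E4, ∀ i, g (v i) = w i := by
  let b := basisOfLinearIndependentOfCardEqFinrank hv (by simp)
  have hb : ∀ i, b i = v i := fun i => by simp [b]
  let L := b.constr ℝ w
  have hL : ∀ i, L (v i) = w i := fun i => by rw [← hb, Module.Basis.constr_basis]
  have hin : ∀ x y, inner ℝ (L x) (L y) = inner ℝ x y := by
    intro x y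
    rw [← b.sum_repr x, ← b.sum_repr y]
    simp only [map_sum, map_smul, hb, hL, sum_inner, inner_sum, inner_smul_left, inner_smul_right,
      h]
  refine ⟨(L.isometryOfInner hin).toLinearIsometryEquiv rfl, fun i => ?_⟩
  exact hL i

theorem linearIndependent_of_dual {v f : Fin 4 → E4} {k : Fin 4 → ℝ} (hk : ∀ i, k i ≠ 0)
    (h : ∀ i j, inner ℝ (f i) (v j) = if i = j then k i else 0) : LinearIndependent ℝ v := by
  rw [Fintype.linearIndependent_iff]
  intro g hg i
  have := congrArg (fun x => inner ℝ (f i) x) hg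
  simp only [inner_sum, inner_smul_right, h, inner_zero_right] at this
  simpa [hk i] using this

/-- The inner product with `f i` is `k i` times the `i`-th coordinate, so the `f i` are inner
normals of the facets of the cone. -/
theorem coneSpan_eq_of_dual {v f : Fin 4 → E4} {k : Fin 4 → ℝ} (hk : ∀ i, 0 < k i)
    (h : ∀ i j, inner ℝ (f i) (v j) = if i = j then k i else 0) :
    coneSpan v = {x | ∀ i, 0 ≤ inner ℝ (f i) x} := by
  have hv := linearIndependent_of_dual (fun i => (hk i).ne') h
  ext x
  obtain ⟨r, rfl⟩ := exists_coordinates hv x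
  rw [mem_coneSpan_iff hv]
  simp only [Set.mem_ofPred_eq, inner_sum, inner_smul_right, h]
  simp [mul_nonneg_iff_of_pos_right (hk _)]

/-- The volume of a spherical tetrahedron `cdxy` with a half-turn that swaps `c, d` and fixes `x`;
`X` is the squared length of `(c + d) / 2`. -/
def tetVolume (p q X : ℝ) : ℝ :=
  Real.pi / 4 * (2 * Real.pi
    - Real.arccos (((1 - X - q ^ 2) - (X - p ^ 2)) / (1 - p ^ 2 - q ^ 2))
    - 2 * Real.arccos (-p * √((1 - X - q ^ 2) / (X * (1 - p ^ 2 - q ^ 2)))))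

theorem angle_eq_arccos_of_inner {f g : E4} {a b c : ℝ} (hf : inner ℝ f f = a) (hg : inner ℝ g g = b)
    (hfg : inner ℝ f g = c) :
    InnerProductGeometry.angle f g = Real.arccos (c / √(a * b)) := by
  rw [InnerProductGeometry.angle, hfg, norm_eq_sqrt_real_inner f, norm_eq_sqrt_real_inner g, hf, hg,
    Real.sqrt_mul (hf ▸ real_inner_self_nonneg)]

theorem arccos_mem_Ioo {z : ℝ} (h : z ^ 2 < 1) : Real.arccos z ∈ Set.Ioo 0 Real.pi := by
  have := abs_lt.1 ((sq_lt_one_iff_abs_lt_one z).1 h)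
  exact ⟨Real.arccos_pos.2 this.2, Real.arccos_lt_pi.2 this.1⟩

/-- Brings the cosine of the angle between the normals `f0`, `f2` in `coneMeasure_tetrahedron` to
the form used in `tetVolume`. -/
theorem tetVolume_sqrt {p X Y Z m : ℝ} (hXp : 0 < X) (hYp : 0 < Y) (hZp : 0 < Z) (hmp : 0 < m) :
    -p * Y * Z / √(Y * Z * m * (X * Z)) = -p * √(Y / (X * m)) := by
  have h1 : √(Y * Z * m * (X * Z)) = Z * √(Y * (X * m)) := by
    rw [show Y * Z * m * (X * Z) = Z ^ 2 * (Y * (X * m)) by ring,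
      Real.sqrt_mul (sq_nonneg Z), Real.sqrt_sq hZp.le]
  have h2 : √(Y / (X * m)) = Y / √(Y * (X * m)) := by
    rw [Real.sqrt_div hYp.le, Real.sqrt_mul hYp.le]
    have := Real.mul_self_sqrt hYp.le
    have := Real.sqrt_pos.2 hYp
    field_simp
    linarith
  rw [h1, h2]
  have := Real.sqrt_pos.2 (show 0 < Y * (X * m) by positivity)
  field_simp

theorem arccos_sub_div_add_mem {Y Z : ℝ} (hYp : 0 < Y) (hZp : 0 < Z) :
    Real.arccos ((Y - Z) / (Y + Z)) ∈ Set.Ioo 0 Real.pi := by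
  apply arccos_mem_Ioo
  rw [div_pow, div_lt_one (by positivity)]
  nlinarith [mul_pos hYp hZp]

theorem arccos_mul_sqrt_mem {p X Y Z : ℝ} (hXp : 0 < X) (hYp : 0 < Y) (hZp : 0 < Z)
    (h : p ^ 2 = X - Z) :
    Real.arccos (-p * √(Y / (X * (Y + Z)))) ∈ Set.Ioo 0 Real.pi := by
  apply arccos_mem_Ioo
  rw [mul_pow, Real.sq_sqrt (by positivity), neg_sq, mul_div_assoc', div_lt_one (by positivity), h]
  nlinarith [mul_pos hYp hZp, mul_pos hXp hZp]

-- The half-turn that swaps `c, d`, fixes `x` and negates `y` shows that the cones over `cdxy` and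
-- `cdx(-y)` have equal measure. Their facets other than `cdx` lie in the same three hyperplanes,
-- which contain `y`. So the two cones fill the intersection of three half-spaces, and each is half
-- of what `coneMeasure_triple` gives.
set_option maxHeartbeats 1000000 in
set_option linter.unusedSimpArgs false in
theorem coneMeasure_tetrahedron {c d x y : E4} {p q X : ℝ} (hc : inner ℝ c c = 1)
    (hd : inner ℝ d d = 1) (hx : inner ℝ x x = 1) (hy : inner ℝ y y = 1)
    (hcd : inner ℝ c d = 2 * X - 1) (hcx : inner ℝ c x = p) (hdx : inner ℝ d x = p)
    (hcy : inner ℝ c y = q) (hdy : inner ℝ d y = -q) (hxy : inner ℝ x y = 0)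
    (hp : p ^ 2 < X) (hq : q ^ 2 < 1 - X) :
    LinearIndependent ℝ ![c, d, x, y] ∧
      coneMeasure.real (coneSpan ![c, d, x, y]) = tetVolume p q X := by
  set m := 1 - p ^ 2 - q ^ 2 with hm
  set Y := 1 - X - q ^ 2 with hY
  set Z := X - p ^ 2 with hZ
  have hYp : 0 < Y := by linarith
  have hZp : 0 < Z := by linarith
  have hXp : 0 < X := lt_of_le_of_lt (sq_nonneg p) hp
  have hX1 : 0 < 1 - X := lt_of_le_of_lt (sq_nonneg q) hq
  have hmYZ : m = Y + Z := by rw [hm, hY, hZ]; ring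
  have hmp : 0 < m := by linarith
  have hdc : inner ℝ d c = 2 * X - 1 := by rw [real_inner_comm, hcd]
  have hxc : inner ℝ x c = p := by rw [real_inner_comm, hcx]
  have hxd : inner ℝ x d = p := by rw [real_inner_comm, hdx]
  have hyc : inner ℝ y c = q := by rw [real_inner_comm, hcy]
  have hyd : inner ℝ y d = -q := by rw [real_inner_comm, hdy]
  have hyx : inner ℝ y x = 0 := by rw [real_inner_comm, hxy]
  -- `fu` is the component of `(c + d) / 2` orthogonal to `x` and `fw` that of `(c - d) / 2`
  -- orthogonal to `y`; their squared lengths are `Z` and `Y`. The vectors `f0, f1, f2, f3` are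
  -- inner normals of the facets opposite to `c, d, x, y`.
  let fu : E4 := (1 / 2 : ℝ) • (c + d) - p • x
  let fw : E4 := (1 / 2 : ℝ) • (c - d) - q • y
  let f0 : E4 := Y • fu + Z • fw
  let f1 : E4 := Y • fu - Z • fw
  let f2 : E4 := X • x - (p / 2) • (c + d)
  let f3 : E4 := (1 - X) • y - (q / 2) • (c - d)
  -- The values `ε = 1` and `ε = -1` give the tetrahedra with `y` and with `-y`.
  have key : ∀ ε : ℝ, ∀ i j, inner ℝ (![f0, f1, f2, ε • f3] i) (![c, d, x, ε • y] j) =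
      if i = j then ![2 * Y * Z, 2 * Y * Z, Z, ε ^ 2 * Y] i else 0 := by
    intro ε i j
    fin_cases i <;> fin_cases j <;> simp only [Fin.zero_eta, Fin.mk_one, Fin.reduceFinMk,
        Matrix.cons_val, Fin.reduceEq, if_true, if_false, f0, f1, f2, f3, fu, fw, inner_add_left,
        inner_sub_left, real_inner_smul_left, real_inner_smul_right, hc, hd, hx, hy, hcd, hcx, hdx,
        hcy, hdy, hxy, hdc, hxc, hxd, hyc, hyd, hyx, hY, hZ] <;> ring
  have hpos : ∀ ε : ℝ, ε ≠ 0 → ∀ i, 0 < ![2 * Y * Z, 2 * Y * Z, Z, ε ^ 2 * Y] i := by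
    intro ε hε i
    fin_cases i <;> simp <;> positivity
  have hli : ∀ ε : ℝ, ε ≠ 0 → LinearIndependent ℝ ![c, d, x, ε • y] := fun ε hε =>
    linearIndependent_of_dual (fun i => (hpos ε hε i).ne') (key ε)
  have hcone : ∀ ε : ℝ, ε ≠ 0 → coneSpan ![c, d, x, ε • y] =
      {z | (0 ≤ inner ℝ f0 z ∧ 0 ≤ inner ℝ f1 z ∧ 0 ≤ inner ℝ f2 z) ∧ 0 ≤ ε * inner ℝ f3 z} := by
    intro ε hε
    rw [coneSpan_eq_of_dual (hpos ε hε) (key ε)]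
    ext z
    simp [Fin.forall_fin_succ, inner_smul_left, and_assoc]
  have h1 := hcone 1 one_ne_zero
  have h2 := hcone (-1) (by norm_num)
  have li1 := hli 1 one_ne_zero
  simp only [one_smul, one_mul, neg_smul, neg_mul] at h1 h2 li1
  refine ⟨li1, ?_⟩
  have li2 : LinearIndependent ℝ ![d, c, x, -y] := by
    have := linearIndependent_swap_01 (hli (-1) (by norm_num))
    simpa using this
  -- the half-turn
  obtain ⟨g, hg⟩ := exists_isometry_of_gram (v := ![c, d, x, y]) (w := ![d, c, x, -y]) li1 (by
    intro i j
    fin_cases i <;> fin_cases j <;> simp only [Fin.zero_eta, Fin.mk_one, Fin.reduceFinMk,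
        Matrix.cons_val, inner_neg_left, inner_neg_right, neg_neg, neg_zero, hc, hd, hx, hy, hcd,
        hcx, hdx, hcy, hdy, hxy, hdc, hxc, hxd, hyc, hyd, hyx])
  have hsym : coneMeasure.real (coneSpan ![c, d, x, -y]) =
      coneMeasure.real (coneSpan ![c, d, x, y]) := by
    have e : coneSpan ![c, d, x, -y] = coneSpan ![d, c, x, -y] := by
      rw [← coneSpan_comp_perm ![d, c, x, -y] (Equiv.swap 0 1)]
      congr 1
      ext i; fin_cases i <;> rfl
    rw [e, ← coneMeasure_preimage g (measurableSet_coneSpan li2)]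
    congr 1
    ext z
    obtain ⟨r, rfl⟩ := exists_coordinates li1 z
    rw [mem_coneSpan_iff li1, Set.mem_preimage]
    simp only [map_sum, map_smul, hg]
    exact mem_coneSpan_iff li2 r
  have i00 : inner ℝ f0 f0 = Y * Z * m := by
    simp only [f0, f1, f2, fu, fw, inner_add_left, inner_sub_left, inner_add_right,
      inner_sub_right, real_inner_smul_left, real_inner_smul_right, hc, hd, hx, hy, hcd, hcx, hdx,
      hcy, hdy, hxy, hdc, hxc, hxd, hyc, hyd, hyx, hY, hZ, hm]
    ring
  have i11 : inner ℝ f1 f1 = Y * Z * m := by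
    simp only [f0, f1, f2, fu, fw, inner_add_left, inner_sub_left, inner_add_right,
      inner_sub_right, real_inner_smul_left, real_inner_smul_right, hc, hd, hx, hy, hcd, hcx, hdx,
      hcy, hdy, hxy, hdc, hxc, hxd, hyc, hyd, hyx, hY, hZ, hm]
    ring
  have i01 : inner ℝ f0 f1 = Y * Z * (Y - Z) := by
    simp only [f0, f1, f2, fu, fw, inner_add_left, inner_sub_left, inner_add_right,
      inner_sub_right, real_inner_smul_left, real_inner_smul_right, hc, hd, hx, hy, hcd, hcx, hdx,
      hcy, hdy, hxy, hdc, hxc, hxd, hyc, hyd, hyx, hY, hZ, hm]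
    ring
  have i22 : inner ℝ f2 f2 = X * Z := by
    simp only [f0, f1, f2, fu, fw, inner_add_left, inner_sub_left, inner_add_right,
      inner_sub_right, real_inner_smul_left, real_inner_smul_right, hc, hd, hx, hy, hcd, hcx, hdx,
      hcy, hdy, hxy, hdc, hxc, hxd, hyc, hyd, hyx, hY, hZ, hm]
    ring
  have i02 : inner ℝ f0 f2 = -p * Y * Z := by
    simp only [f0, f1, f2, fu, fw, inner_add_left, inner_sub_left, inner_add_right,
      inner_sub_right, real_inner_smul_left, real_inner_smul_right, hc, hd, hx, hy, hcd, hcx, hdx,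
      hcy, hdy, hxy, hdc, hxc, hxd, hyc, hyd, hyx, hY, hZ, hm]
    ring
  have i12 : inner ℝ f1 f2 = -p * Y * Z := by
    simp only [f0, f1, f2, fu, fw, inner_add_left, inner_sub_left, inner_add_right,
      inner_sub_right, real_inner_smul_left, real_inner_smul_right, hc, hd, hx, hy, hcd, hcx, hdx,
      hcy, hdy, hxy, hdc, hxc, hxd, hyc, hyd, hyx, hY, hZ, hm]
    ring
  have a01 : InnerProductGeometry.angle f0 f1 = Real.arccos ((Y - Z) / m) := by
    rw [angle_eq_arccos_of_inner i00 i11 i01, Real.sqrt_mul_self (by positivity)]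
    congr 1
    field_simp
  have hroot := tetVolume_sqrt (p := p) hXp hYp hZp hmp
  have a02 : InnerProductGeometry.angle f0 f2 = Real.arccos (-p * √(Y / (X * m))) := by
    rw [angle_eq_arccos_of_inner i00 i22 i02, hroot]
  have a12 : InnerProductGeometry.angle f1 f2 = Real.arccos (-p * √(Y / (X * m))) := by
    rw [angle_eq_arccos_of_inner i11 i22 i12, hroot]
  have hA : Real.arccos ((Y - Z) / m) ∈ Set.Ioo 0 Real.pi := by
    rw [hmYZ]
    exact arccos_sub_div_add_mem hYp hZp
  have hB : Real.arccos (-p * √(Y / (X * m))) ∈ Set.Ioo 0 Real.pi := by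
    rw [hmYZ]
    exact arccos_mul_sqrt_mem hXp hYp hZp (by rw [hZ]; ring)
  have n0 : f0 ≠ 0 := by
    rintro h; rw [h, inner_zero_left] at i00; exact (mul_pos (mul_pos hYp hZp) hmp).ne i00
  have n1 : f1 ≠ 0 := by
    rintro h; rw [h, inner_zero_left] at i11; exact (mul_pos (mul_pos hYp hZp) hmp).ne i11
  have n2 : f2 ≠ 0 := by
    rintro h; rw [h, inner_zero_left] at i22; exact (mul_pos hXp hZp).ne i22
  have n3 : f3 ≠ 0 := by
    rintro h
    have := key 1 3 3
    simp [h] at this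
    linarith
  have htriple := coneMeasure_triple n0 n1 n2 (a01 ▸ hA) (a02 ▸ hB) (a12 ▸ hB)
  rw [a01, a02, a12] at htriple
  have hsplit : coneMeasure.real {z | 0 ≤ inner ℝ f0 z ∧ 0 ≤ inner ℝ f1 z ∧ 0 ≤ inner ℝ f2 z} =
      coneMeasure.real (coneSpan ![c, d, x, y]) + coneMeasure.real (coneSpan ![c, d, x, -y]) := by
    rw [h1, h2, ← measureReal_inter_add_sdiff (μ := coneMeasure)
      (s := {z | 0 ≤ inner ℝ f0 z ∧ 0 ≤ inner ℝ f1 z ∧ 0 ≤ inner ℝ f2 z})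
      (measurableSet_halfspace f3)]
    congr 1
    apply measureReal_congr
    filter_upwards [measure_eq_zero_iff_ae_notMem.1 (coneMeasure_hyperplane n3)] with z hz
    apply propext
    have hz : inner ℝ f3 z ≠ 0 := hz
    exact and_congr_right fun _ => ⟨fun h => lt_of_le_of_ne (not_le.1 h).le hz |> fun h => by linarith,
      fun h h' => hz (le_antisymm (by linarith) h')⟩
  rw [hsym] at hsplit
  rw [tetVolume]
  linarith

/-! ### The volume as a function on the configuration curve -/

/-- What matters is that the derivative is algebraic in `X`, with one root that depends only on `q`
and one that depends only on `p`. -/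
theorem hasDerivAt_tetVolume {p q X : ℝ} (hp : p ^ 2 < X) (hq : q ^ 2 < 1 - X) :
    HasDerivAt (tetVolume p q) (-(Real.pi / 4) * ((X - p * √(1 - q ^ 2)) /
      (X * (√(1 - X - q ^ 2) * √(X - p ^ 2))))) X := by
  have hXp : 0 < X := lt_of_le_of_lt (sq_nonneg p) hp
  have hYp : 0 < 1 - X - q ^ 2 := by linarith
  have hZp : 0 < X - p ^ 2 := by linarith
  have hmp : 0 < 1 - p ^ 2 - q ^ 2 := by linarith
  have hrp : 0 < 1 - q ^ 2 := by linarith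
  have hm : 1 - p ^ 2 - q ^ 2 = (1 - X - q ^ 2) + (X - p ^ 2) := by ring
  set sY := √(1 - X - q ^ 2) with hsY
  set sZ := √(X - p ^ 2) with hsZ
  set r := √(1 - q ^ 2) with hr
  set sM := √(X * (1 - p ^ 2 - q ^ 2)) with hsM
  have pY : 0 < sY := Real.sqrt_pos.2 hYp
  have pZ : 0 < sZ := Real.sqrt_pos.2 hZp
  have pr : 0 < r := Real.sqrt_pos.2 hrp
  have pM : 0 < sM := Real.sqrt_pos.2 (by positivity)
  have eY : sY ^ 2 = 1 - X - q ^ 2 := Real.sq_sqrt hYp.le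
  have eZ : sZ ^ 2 = X - p ^ 2 := Real.sq_sqrt hZp.le
  have er : r ^ 2 = 1 - q ^ 2 := Real.sq_sqrt hrp.le
  have eM : sM ^ 2 = X * (1 - p ^ 2 - q ^ 2) := Real.sq_sqrt (by positivity)
  -- the first angle
  have hA := arccos_sub_div_add_mem hYp hZp
  have d1 : HasDerivAt (fun X : ℝ => ((1 - X - q ^ 2) - (X - p ^ 2)) / (1 - p ^ 2 - q ^ 2))
      (-2 / (1 - p ^ 2 - q ^ 2)) X := by
    have h := (((hasDerivAt_const X (1 : ℝ)).sub (hasDerivAt_id X)).sub_const (q ^ 2)).sub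
      ((hasDerivAt_id X).sub_const (p ^ 2)) |>.div_const (1 - p ^ 2 - q ^ 2)
    refine h.congr_deriv ?_
    ring
  rw [← hm] at hA
  -- With `Y = 1 - X - q²` and `Z = X - p²` this is `1 - ((Y - Z) / (Y + Z))² = 4YZ / (Y + Z)²`.
  have s1 : √(1 - (((1 - X - q ^ 2) - (X - p ^ 2)) / (1 - p ^ 2 - q ^ 2)) ^ 2) =
      2 * sY * sZ / (1 - p ^ 2 - q ^ 2) := by
    rw [Real.sqrt_eq_iff_eq_sq (by
      have := abs_lt.1 (show |((1 - X - q ^ 2) - (X - p ^ 2)) / (1 - p ^ 2 - q ^ 2)| < 1 from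
        abs_lt.2 ⟨Real.arccos_lt_pi.1 hA.2, Real.arccos_pos.1 hA.1⟩)
      nlinarith) (by positivity), div_pow (2 * sY * sZ), mul_pow, mul_pow, eY, eZ]
    field_simp
    ring
  have D1 := (Real.hasDerivAt_arccos (Real.arccos_lt_pi.1 hA.2).ne'
    (Real.arccos_pos.1 hA.1).ne).comp X d1
  rw [s1] at D1
  -- the second angle
  have hB := arccos_mul_sqrt_mem hXp hYp hZp (p := p) (by ring)
  rw [← hm] at hB
  have hroot : √((1 - X - q ^ 2) / (X * (1 - p ^ 2 - q ^ 2))) = sY / sM :=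
    Real.sqrt_div hYp.le _
  have d2 : HasDerivAt (fun X : ℝ => -p * √((1 - X - q ^ 2) / (X * (1 - p ^ 2 - q ^ 2))))
      (-p * (-r ^ 2 / (X * sM ^ 2) / (2 * (sY / sM)))) X := by
    have h1 : HasDerivAt (fun X : ℝ => (1 - X - q ^ 2) / (X * (1 - p ^ 2 - q ^ 2)))
        (-r ^ 2 / (X * sM ^ 2)) X := by
      have h := (((hasDerivAt_const X (1 : ℝ)).sub (hasDerivAt_id X)).sub_const (q ^ 2)).div
        ((hasDerivAt_id X).mul_const (1 - p ^ 2 - q ^ 2)) (by simp; constructor <;> positivity)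
      refine h.congr_deriv ?_
      rw [er, eM]
      simp only [id, Pi.sub_apply]
      field_simp
      ring
    have := (h1.sqrt (by positivity)).const_mul (-p)
    rwa [hroot] at this
  have s2 : √(1 - (-p * √((1 - X - q ^ 2) / (X * (1 - p ^ 2 - q ^ 2)))) ^ 2) = r * sZ / sM := by
    rw [Real.sqrt_eq_iff_eq_sq (by
      have := abs_lt.1 (show |-p * √((1 - X - q ^ 2) / (X * (1 - p ^ 2 - q ^ 2)))| < 1 from
        abs_lt.2 ⟨Real.arccos_lt_pi.1 hB.2, Real.arccos_pos.1 hB.1⟩)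
      nlinarith) (by positivity), mul_pow, Real.sq_sqrt (by positivity), div_pow (r * sZ), mul_pow,
      er, eZ, eM]
    field_simp
    ring
  have D2 := (Real.hasDerivAt_arccos (Real.arccos_lt_pi.1 hB.2).ne'
    (Real.arccos_pos.1 hB.1).ne).comp X d2
  rw [s2] at D2
  have D := ((D1.const_sub (2 * Real.pi)).sub (D2.const_mul 2)).const_mul (Real.pi / 4)
  refine D.congr_deriv ?_
  field_simp
  ring

/-- By Rolle's theorem a zero of `f'` lies between any two points of `A`. If there were only
finitely many zeros, counting those below `x` would map `A` injectively to a finite set of natural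
numbers. -/
theorem infinite_deriv_zeros {f f' : ℝ → ℝ} {a b c : ℝ} {A : Set ℝ} (hA : A ⊆ Set.Ioo a b)
    (hinf : A.Infinite) (hf : ∀ x ∈ Set.Ioo a b, HasDerivAt f (f' x) x) (hc : ∀ x ∈ A, f x = c) :
    {x ∈ Set.Ioo a b | f' x = 0}.Infinite := by
  intro hZ
  refine hinf ?_
  have hstep : ∀ x ∈ A, ∀ y ∈ A, x < y → ∃ z ∈ hZ.toFinset, x < z ∧ z < y := by
    intro x hx y hy hxy
    have hsub : Set.Icc x y ⊆ Set.Ioo a b := fun z hz =>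
      ⟨(hA hx).1.trans_le hz.1, hz.2.trans_lt (hA hy).2⟩
    obtain ⟨z, hz, h0⟩ := exists_hasDerivAt_eq_zero (f := f) (f' := f') hxy
      (fun z hz => (hf z (hsub hz)).continuousAt.continuousWithinAt)
      ((hc x hx).trans (hc y hy).symm) (fun z hz => hf z (hsub (Set.Ioo_subset_Icc_self hz)))
    exact ⟨z, by simpa using ⟨hsub (Set.Ioo_subset_Icc_self hz), h0⟩, hz⟩
  let φ : ℝ → ℕ := fun x => (hZ.toFinset.filter (· < x)).card
  have hmono : ∀ x ∈ A, ∀ y ∈ A, x < y → φ x < φ y := by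
    intro x hx y hy hxy
    obtain ⟨z, hz, h1, h2⟩ := hstep x hx y hy hxy
    refine Finset.card_lt_card (Finset.ssubset_iff_of_subset ?_ |>.2 ⟨z, ?_, ?_⟩)
    · intro w hw
      rw [Finset.mem_filter] at hw ⊢
      exact ⟨hw.1, hw.2.trans hxy⟩
    · exact Finset.mem_filter.2 ⟨hz, h2⟩
    · simp [h1.le]
  have hinj : Set.InjOn φ A := by
    intro x hx y hy h
    rcases lt_trichotomy x y with hl | hl | hl
    · exact absurd h (hmono x hx y hy hl).ne
    · exact hl
    · exact absurd h (hmono y hy x hx hl).ne'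
  refine Set.Finite.of_finite_image ((Set.finite_Iic hZ.toFinset.card).subset ?_) hinj
  rintro _ ⟨x, -, rfl⟩
  exact Finset.card_le_card (Finset.filter_subset _ _)

-- For `G ≠ 0` the multiplicity of the root `α` would be even on the left and odd on the right.
open Polynomial in
theorem eq_zero_of_sq_eq_sq_mul {F G : ℝ[X]} {α β : ℝ} (hαβ : α ≠ β)
    (h : F ^ 2 = G ^ 2 * ((X - C α) * (X - C β))) : G = 0 := by
  by_contra hG
  have hl : (X - C α) * (X - C β) ≠ 0 := mul_ne_zero (X_sub_C_ne_zero α) (X_sub_C_ne_zero β)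
  have hr : G ^ 2 * ((X - C α) * (X - C β)) ≠ 0 := mul_ne_zero (pow_ne_zero 2 hG) hl
  have hF : F ^ 2 ≠ 0 := h ▸ hr
  have h1 := congrArg (rootMultiplicity α) h
  rw [rootMultiplicity_mul hr, rootMultiplicity_mul hl, rootMultiplicity_X_sub_C_self,
    rootMultiplicity_X_sub_C, if_neg hαβ, sq, sq, rootMultiplicity_mul (sq F ▸ hF),
    rootMultiplicity_mul (mul_ne_zero hG hG)] at h1
  omega

-- Let `yⱼ, zᵢ` be the four roots in the denominators. Multiplied by all of them, the equation reads
-- `z₂ (a y₂ + b y₁) = -z₁ (c y₂ + d y₁)` with polynomials `a, b, c, d` in `x`. Squaring leaves only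
-- `y₁ y₂` irrational, and squaring again gives `F² = G² (x - r₁²) (x - r₂²)` at infinitely many
-- `x`, hence identically. So `G = 0`, and its values at `p₁²` and `p₂²` force `p₁ = p₂ = 0`.
open Polynomial in
theorem not_infinite_zeros {p₁ p₂ q₁ q₂ a₁₁ a₁₂ a₂₁ a₂₂ : ℝ} (hp : |p₁| ≠ |p₂|) (hq : |q₁| ≠ |q₂|)
    (h₁₁ : p₁ ^ 2 + q₁ ^ 2 < 1) (h₁₂ : p₁ ^ 2 + q₂ ^ 2 < 1) (h₂₁ : p₂ ^ 2 + q₁ ^ 2 < 1)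
    (h₂₂ : p₂ ^ 2 + q₂ ^ 2 < 1)
    (n₁₁ : a₁₁ ≠ 0) (n₁₂ : a₁₂ ≠ 0) (n₂₁ : a₂₁ ≠ 0) (n₂₂ : a₂₂ ≠ 0) :
    ¬ {x : ℝ | (p₁ ^ 2 < x ∧ p₂ ^ 2 < x ∧ q₁ ^ 2 < 1 - x ∧ q₂ ^ 2 < 1 - x) ∧
      a₁₁ * ((x - p₁ * √(1 - q₁ ^ 2)) / (√(1 - x - q₁ ^ 2) * √(x - p₁ ^ 2))) +
      a₁₂ * ((x - p₁ * √(1 - q₂ ^ 2)) / (√(1 - x - q₂ ^ 2) * √(x - p₁ ^ 2))) +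
      a₂₁ * ((x - p₂ * √(1 - q₁ ^ 2)) / (√(1 - x - q₁ ^ 2) * √(x - p₂ ^ 2))) +
      a₂₂ * ((x - p₂ * √(1 - q₂ ^ 2)) / (√(1 - x - q₂ ^ 2) * √(x - p₂ ^ 2))) = 0}.Infinite := by
  intro hinf
  set r₁ := √(1 - q₁ ^ 2) with hr₁
  set r₂ := √(1 - q₂ ^ 2) with hr₂
  have e₁ : r₁ ^ 2 = 1 - q₁ ^ 2 := Real.sq_sqrt (by nlinarith [sq_nonneg p₁])
  have e₂ : r₂ ^ 2 = 1 - q₂ ^ 2 := Real.sq_sqrt (by nlinarith [sq_nonneg p₁])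
  have hne : r₁ ^ 2 ≠ r₂ ^ 2 := by
    rw [e₁, e₂]
    intro h
    exact hq ((sq_eq_sq_iff_abs_eq_abs _ _).1 (by linarith))
  let a : ℝ[X] := C a₁₁ * (X - C (p₁ * r₁))
  let b : ℝ[X] := C a₁₂ * (X - C (p₁ * r₂))
  let c : ℝ[X] := C a₂₁ * (X - C (p₂ * r₁))
  let d : ℝ[X] := C a₂₂ * (X - C (p₂ * r₂))
  let Z₁ : ℝ[X] := X - C (p₁ ^ 2)
  let Z₂ : ℝ[X] := X - C (p₂ ^ 2)
  let Y₁ : ℝ[X] := C (r₁ ^ 2) - X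
  let Y₂ : ℝ[X] := C (r₂ ^ 2) - X
  let F : ℝ[X] := Z₂ * (a ^ 2 * Y₂ + b ^ 2 * Y₁) - Z₁ * (c ^ 2 * Y₂ + d ^ 2 * Y₁)
  let G : ℝ[X] := 2 * (Z₂ * a * b - Z₁ * c * d)
  have hpoly : F ^ 2 = G ^ 2 * ((X - C (r₁ ^ 2)) * (X - C (r₂ ^ 2))) := by
    refine eq_of_infinite_eval_eq _ _ (hinf.mono ?_)
    rintro x ⟨⟨g1, g2, g3, g4⟩, hx⟩
    have hz₁ : 0 < √(x - p₁ ^ 2) := Real.sqrt_pos.2 (by linarith)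
    have hz₂ : 0 < √(x - p₂ ^ 2) := Real.sqrt_pos.2 (by linarith)
    have hy₁ : 0 < √(1 - x - q₁ ^ 2) := Real.sqrt_pos.2 (by linarith)
    have hy₂ : 0 < √(1 - x - q₂ ^ 2) := Real.sqrt_pos.2 (by linarith)
    have ez₁ : √(x - p₁ ^ 2) ^ 2 = x - p₁ ^ 2 := Real.sq_sqrt (by linarith)
    have ez₂ : √(x - p₂ ^ 2) ^ 2 = x - p₂ ^ 2 := Real.sq_sqrt (by linarith)
    have ey₁ : √(1 - x - q₁ ^ 2) ^ 2 = r₁ ^ 2 - x := by rw [Real.sq_sqrt (by linarith), e₁]; ring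
    have ey₂ : √(1 - x - q₂ ^ 2) ^ 2 = r₂ ^ 2 - x := by rw [Real.sq_sqrt (by linarith), e₂]; ring
    generalize √(x - p₁ ^ 2) = z₁ at *
    generalize √(x - p₂ ^ 2) = z₂ at *
    generalize √(1 - x - q₁ ^ 2) = y₁ at *
    generalize √(1 - x - q₂ ^ 2) = y₂ at *
    have hlin : z₂ * (a₁₁ * (x - p₁ * r₁) * y₂ + a₁₂ * (x - p₁ * r₂) * y₁) =
        -(z₁ * (a₂₁ * (x - p₂ * r₁) * y₂ + a₂₂ * (x - p₂ * r₂) * y₁)) := by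
      field_simp at hx
      linear_combination hx
    have hsq : eval x F = - eval x G * (y₁ * y₂) := by
      simp only [F, G, a, b, c, d, Z₁, Z₂, Y₁, Y₂, eval_sub, eval_mul, eval_add, eval_pow, eval_X,
        eval_C, eval_ofNat]
      rw [← ez₁, ← ez₂, ← ey₁, ← ey₂]
      linear_combination (z₂ * (a₁₁ * (x - p₁ * r₁) * y₂ + a₁₂ * (x - p₁ * r₂) * y₁) -
        z₁ * (a₂₁ * (x - p₂ * r₁) * y₂ + a₂₂ * (x - p₂ * r₂) * y₁)) * hlin
    change eval x (F ^ 2) = eval x (G ^ 2 * ((X - C (r₁ ^ 2)) * (X - C (r₂ ^ 2))))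
    rw [eval_pow, hsq]
    simp only [eval_mul, eval_pow, eval_sub, eval_X, eval_C]
    rw [mul_pow, mul_pow, ey₁, ey₂]
    ring
  have hG := eq_zero_of_sq_eq_sq_mul hne hpoly
  have hlt : ∀ p q : ℝ, p ^ 2 + q ^ 2 < 1 → p < √(1 - q ^ 2) := fun p q h =>
    Real.lt_sqrt_of_sq_lt (by linarith)
  have hpsq : p₁ ^ 2 ≠ p₂ ^ 2 := fun h => hp ((sq_eq_sq_iff_abs_eq_abs _ _).1 h)
  have g1 : eval (p₁ ^ 2) G = 0 := by rw [hG, eval_zero]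
  have g2 : eval (p₂ ^ 2) G = 0 := by rw [hG, eval_zero]
  simp only [G, a, b, c, d, Z₁, Z₂, eval_sub, eval_mul, eval_X, eval_C, eval_ofNat] at g1 g2
  -- At `p₁²` the summand with `Z₁` vanishes, and `a`, `b` have the values `a₁ⱼ p₁ (p₁ - rⱼ)`, where
  -- `p₁ < rⱼ`.
  have k1 : p₁ = 0 := by
    by_contra h0
    have : 2 * ((p₁ ^ 2 - p₂ ^ 2) * (a₁₁ * (p₁ * (p₁ - r₁))) * (a₁₂ * (p₁ * (p₁ - r₂)))) = 0 := by
      linear_combination g1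
    have := sub_ne_zero.2 hpsq
    have := sub_ne_zero.2 (hlt _ _ h₁₁).ne
    have := sub_ne_zero.2 (hlt _ _ h₁₂).ne
    simp_all
  have k2 : p₂ = 0 := by
    by_contra h0
    have : 2 * ((p₂ ^ 2 - p₁ ^ 2) * (a₂₁ * (p₂ * (p₂ - r₁))) * (a₂₂ * (p₂ * (p₂ - r₂)))) = 0 := by
      linear_combination -g2
    have := sub_ne_zero.2 hpsq.symm
    have := sub_ne_zero.2 (hlt _ _ h₂₁).ne
    have := sub_ne_zero.2 (hlt _ _ h₂₂).ne
    simp_all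
  exact hp (by rw [k1, k2])

/-- Level sets of the signed sums of volumes are finite. -/
theorem not_infinite_levelSet {p₁ p₂ q₁ q₂ a₁₁ a₁₂ a₂₁ a₂₂ lo hi c : ℝ}
    (hp : |p₁| ≠ |p₂|) (hq : |q₁| ≠ |q₂|)
    (hlt : lo < hi)
    (hlo₁ : p₁ ^ 2 ≤ lo) (hlo₂ : p₂ ^ 2 ≤ lo) (hhi₁ : q₁ ^ 2 ≤ 1 - hi) (hhi₂ : q₂ ^ 2 ≤ 1 - hi)
    (n₁₁ : a₁₁ ≠ 0) (n₁₂ : a₁₂ ≠ 0) (n₂₁ : a₂₁ ≠ 0) (n₂₂ : a₂₂ ≠ 0) :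
    ¬ {x ∈ Set.Ioo lo hi | a₁₁ * tetVolume p₁ q₁ x + a₁₂ * tetVolume p₁ q₂ x +
      a₂₁ * tetVolume p₂ q₁ x + a₂₂ * tetVolume p₂ q₂ x = c}.Infinite := by
  intro hinf
  have hd := infinite_deriv_zeros (fun x hx => hx.1) hinf (f := fun x =>
    a₁₁ * tetVolume p₁ q₁ x + a₁₂ * tetVolume p₁ q₂ x +
      a₂₁ * tetVolume p₂ q₁ x + a₂₂ * tetVolume p₂ q₂ x)
    (fun x hx => (((((hasDerivAt_tetVolume (p := p₁) (q := q₁) (X := x) (by linarith [hx.1])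
      (by linarith [hx.2])).const_mul a₁₁).add
      ((hasDerivAt_tetVolume (p := p₁) (q := q₂) (X := x) (by linarith [hx.1])
      (by linarith [hx.2])).const_mul a₁₂)).add
      ((hasDerivAt_tetVolume (p := p₂) (q := q₁) (X := x) (by linarith [hx.1])
      (by linarith [hx.2])).const_mul a₂₁)).add
      ((hasDerivAt_tetVolume (p := p₂) (q := q₂) (X := x) (by linarith [hx.1])
      (by linarith [hx.2])).const_mul a₂₂))) fun x hx => hx.2
  refine not_infinite_zeros hp hq (by linarith) (by linarith) (by linarith) (by linarith)
    n₁₁ n₁₂ n₂₁ n₂₂ (hd.mono ?_)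
  rintro x ⟨hx, h0⟩
  refine ⟨⟨by linarith [hx.1], by linarith [hx.1], by linarith [hx.2], by linarith [hx.2]⟩, ?_⟩
  have hx0 : x ≠ 0 := by nlinarith [hx.1, sq_nonneg p₁]
  have := Real.pi_ne_zero
  simp only [← div_div, mul_comm x] at h0
  -- The four derivatives have this factor in common.
  have h1 : -(Real.pi / 4) / x ≠ 0 := by simp [hx0, this]
  refine (mul_eq_zero.1 (?_ : -(Real.pi / 4) / x * _ = 0)).resolve_left h1
  rw [← h0]
  ring

/-! ### Octahedra with the Gram matrices of the explicit family -/

/-- The relations between the inner products of the vertices of an octahedron of the explicit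
family: the first two diagonals are orthogonal, and the vertices `c, d` of the third one satisfy
`⟪x, c⟫ = ⟪x, d⟫` for `x` on the first diagonal and `⟪y, c⟫ = -⟪y, d⟫` for `y` on the second. -/
structure FlexGram (p q : Bool → ℝ) (P : OctV → S3) : Prop where
  fst_snd : ∀ i j, inner ℝ (P (0, i) : E4) (P (1, j)) = 0
  fst_thd : ∀ i k, inner ℝ (P (0, i) : E4) (P (2, k)) = p i
  snd_thd : ∀ j, inner ℝ (P (1, j) : E4) (P (2, false)) = q j
  snd_thd' : ∀ j, inner ℝ (P (1, j) : E4) (P (2, true)) = -q j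

theorem inner_self_S3 (x : S3) : inner ℝ (x : E4) x = 1 := by
  rw [real_inner_self_eq_norm_sq, norm_eq_of_mem_sphere, one_pow]

/-- The squared length of the midpoint of the third diagonal. -/
def midSq (P : OctV → S3) : ℝ := (1 + inner ℝ (P (2, false) : E4) (P (2, true))) / 2

namespace FlexGram

variable {p q : Bool → ℝ} {P : OctV → S3}

/-- Cauchy–Schwarz for a vertex of the first diagonal and `c + d`, whose squared length is `4 *
midSq P`. -/
theorem sq_le_midSq (h : FlexGram p q P) (i : Bool) : p i ^ 2 ≤ midSq P := by
  have h1 := real_inner_mul_inner_self_le (P (0, i) : E4)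
    ((P (2, false) : E4) + (P (2, true) : E4))
  simp only [inner_add_left, inner_add_right, inner_self_S3, h.fst_thd,
    real_inner_comm (P (2, false) : E4) (P (2, true))] at h1
  rw [midSq]
  linarith

/-- Cauchy–Schwarz for a vertex of the second diagonal and `c - d`, whose squared length is `4 * (1
- midSq P)`. -/
theorem sq_le_one_sub_midSq (h : FlexGram p q P) (j : Bool) : q j ^ 2 ≤ 1 - midSq P := by
  have h1 := real_inner_mul_inner_self_le (P (1, j) : E4)
    ((P (2, false) : E4) - (P (2, true) : E4))
  simp only [inner_sub_left, inner_sub_right, inner_self_S3, h.snd_thd, h.snd_thd',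
    real_inner_comm (P (2, false) : E4) (P (2, true))] at h1
  rw [midSq]
  linarith

/-- The Gram determinant of the face is `1 - p i ^ 2 - q j ^ 2`. -/
theorem linearIndependent (h : FlexGram p q P) {i j k : Bool} (hpq : p i ^ 2 + q j ^ 2 < 1) :
    LinearIndependent ℝ ![(P (0, i) : E4), P (1, j), P (2, k)] := by
  obtain ⟨q', hq', hin⟩ : ∃ q' : ℝ, q' ^ 2 = q j ^ 2 ∧
      inner ℝ (P (1, j) : E4) (P (2, k)) = q' := by
    cases k
    · exact ⟨q j, rfl, h.snd_thd j⟩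
    · exact ⟨-q j, neg_sq _, h.snd_thd' j⟩
  rw [Fintype.linearIndependent_iff]
  intro g hg
  simp only [Fin.sum_univ_three, Matrix.cons_val] at hg
  have e0 := congrArg (inner ℝ (P (0, i) : E4)) hg
  have e1 := congrArg (inner ℝ (P (1, j) : E4)) hg
  have e2 := congrArg (inner ℝ (P (2, k) : E4)) hg
  simp only [inner_add_right, real_inner_smul_right, inner_zero_right, inner_self_S3, h.fst_snd,
    h.fst_thd, hin, real_inner_comm (P (0, i) : E4) (P (1, j)),
    real_inner_comm (P (0, i) : E4) (P (2, k)), real_inner_comm (P (1, j) : E4) (P (2, k))]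
    at e0 e1 e2
  have e3 : g 2 * (1 - p i ^ 2 - q j ^ 2) = 0 := by
    rw [← hq']; linear_combination e2 - p i * e0 - q' * e1
  have g2 : g 2 = 0 := (mul_eq_zero.1 e3).resolve_right (by linarith)
  have g0 : g 0 = 0 := by rw [g2] at e0; linarith
  have g1 : g 1 = 0 := by rw [g2] at e1; linarith
  intro n
  fin_cases n <;> assumption

theorem isNondegenerate (h : FlexGram p q P) (hpq : ∀ i j, p i ^ 2 + q j ^ 2 < 1) :
    IsNondegenerate octahedron P := by
  have key : ∀ b : Fin 3 → Bool, LinearIndependent ℝ fun n => (P (n, b n) : E4) := by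
    intro b
    convert h.linearIndependent (k := b 2) (hpq (b 0) (b 1)) using 1
    ext n; fin_cases n <;> rfl
  intro u v w hf
  obtain ⟨h1, h2, h3⟩ := octFace_adj u v w hf
  have := (key fun n => if n = u.1 then u.2 else if n = v.1 then v.2 else w.2).comp ![u.1, v.1, w.1]
    (by
      intro a b hab
      fin_cases a <;> fin_cases b <;> simp_all [eq_comm])
  convert this using 1
  ext n
  fin_cases n <;> simp [h1.symm, h2.symm, h3.symm]

/-- The volume at the interior points of the configuration curve. -/
theorem exists_orientedVolume_eq (h : FlexGram p q P) (hp : ∀ i, p i ^ 2 < midSq P)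
    (hq : ∀ j, q j ^ 2 < 1 - midSq P) :
    ∃ ε : Bool × Bool → ℤˣ, orientedVolume octahedron P =
      (((ε (false, false) : ℤ) * tetVolume (p false) (q false) (midSq P) +
        (ε (false, true) : ℤ) * tetVolume (p false) (q true) (midSq P) +
        (ε (true, false) : ℤ) * tetVolume (p true) (q false) (midSq P) +
        (ε (true, true) : ℤ) * tetVolume (p true) (q true) (midSq P) : ℝ) :
        AddCircle (2 * Real.pi ^ 2)) := by
  have key : ∀ i j, LinearIndependent ℝ ![(P (2, false) : E4), P (2, true), P (0, i), P (1, j)] ∧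
      coneMeasure.real (coneSpan ![(P (2, false) : E4), P (2, true), P (0, i), P (1, j)]) =
        tetVolume (p i) (q j) (midSq P) := fun i j =>
    coneMeasure_tetrahedron (inner_self_S3 _) (inner_self_S3 _) (inner_self_S3 _)
      (inner_self_S3 _) (by rw [midSq]; ring) (by rw [real_inner_comm, h.fst_thd])
      (by rw [real_inner_comm, h.fst_thd]) (by rw [real_inner_comm, h.snd_thd])
      (by rw [real_inner_comm, h.snd_thd']) (h.fst_snd i j) (hp i) (hq j)
  have hsign : ∀ i j, ∃ e : ℤˣ,
      signedVolume ![(P (2, false) : E4), P (2, true), P (0, i), P (1, j)] =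
        (e : ℤ) * tetVolume (p i) (q j) (midSq P) := by
    intro i j
    obtain ⟨hl, hv⟩ := key i j
    rw [signedVolume, hv]
    rcases lt_or_gt_of_ne ((detFour_ne_zero_iff _).2 hl) with hs | hs
    · exact ⟨-1, by simp [sign_neg hs]⟩
    · exact ⟨1, by simp [sign_pos hs]⟩
  choose e he using hsign
  -- The signs of the decomposition along the third diagonal, `-1` for `i = j` and `1` otherwise,
  -- are merged with the orientations of the tetrahedra.
  refine ⟨fun k => if k.1 = k.2 then -e k.1 k.2 else e k.1 k.2, ?_⟩
  rw [orientedVolume_octahedron (h.isNondegenerate fun i j => by linarith [hp i, hq j])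
    fun i j => (key i j).1]
  simp only [he]
  congr 1
  simp
  ring

end FlexGram

/-- The volume is nonconstant along every family in which the third diagonal changes. -/
theorem not_hasConstantVolume_of_midSq {p q : Bool → ℝ} {P : I → OctV → S3} (hP : Continuous P)
    (hG : ∀ s, FlexGram p q (P s)) (hp : |p false| ≠ |p true|) (hq : |q false| ≠ |q true|)
    {s₀ s₁ : I} (hne : midSq (P s₀) ≠ midSq (P s₁)) : ¬ HasConstantVolume octahedron P := by
  wlog hlt : midSq (P s₀) < midSq (P s₁) generalizing s₀ s₁
  · exact this hne.symm (lt_of_le_of_ne (not_lt.1 hlt) hne.symm)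
  rintro ⟨c, hc⟩
  obtain ⟨c₀, rfl⟩ := QuotientAddGroup.mk_surjective c
  have hcont : Continuous fun s => midSq (P s) := by
    unfold midSq
    have h1 : ∀ v, Continuous fun s => (P s v : E4) := fun v =>
      continuous_subtype_val.comp ((continuous_apply v).comp hP)
    exact (continuous_const.add ((h1 _).inner (h1 _))).div_const 2
  set lo := midSq (P s₀)
  set hi := midSq (P s₁)
  -- The orientations of the tetrahedra may change with `s`, and the volume is known only modulo
  -- `2π²`. One level set for every choice of four signs and every integer takes care of both, and
  -- there are only countably many.
  let A : (Bool × Bool → ℤˣ) × ℤ → Set ℝ := fun k => {x ∈ Set.Ioo lo hi |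
    ((k.1 (false, false) : ℤ) : ℝ) * tetVolume (p false) (q false) x +
        ((k.1 (false, true) : ℤ) : ℝ) * tetVolume (p false) (q true) x +
        ((k.1 (true, false) : ℤ) : ℝ) * tetVolume (p true) (q false) x +
        ((k.1 (true, true) : ℤ) : ℝ) * tetVolume (p true) (q true) x =
      c₀ + k.2 * (2 * Real.pi ^ 2)}
  have hA : ∀ k, (A k).Finite := by
    intro k
    by_contra h
    have hu : ∀ e : ℤˣ, ((e : ℤ) : ℝ) ≠ 0 := fun e => by exact_mod_cast e.ne_zero
    exact not_infinite_levelSet hp hq hlt ((hG s₀).sq_le_midSq _) ((hG s₀).sq_le_midSq _)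
      ((hG s₁).sq_le_one_sub_midSq _) ((hG s₁).sq_le_one_sub_midSq _) (hu _) (hu _) (hu _) (hu _) h
  have hcover : Set.Ioo lo hi ⊆ ⋃ k, A k := by
    intro x hx
    obtain ⟨s, hs⟩ := mem_range_of_exists_le_of_exists_ge hcont ⟨s₀, hx.1.le⟩ ⟨s₁, hx.2.le⟩
    have hs : midSq (P s) = x := hs
    obtain ⟨ε, hε⟩ := (hG s).exists_orientedVolume_eq
      (fun i => by rw [hs]; exact ((hG s₀).sq_le_midSq i).trans_lt hx.1)
      (fun j => by rw [hs]; linarith [(hG s₁).sq_le_one_sub_midSq j, hx.2])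
    rw [hc s, hs] at hε
    have h0 := sub_eq_zero.2 hε.symm
    erw [← AddCircle.coe_sub, AddCircle.coe_eq_zero_iff] at h0
    obtain ⟨n, hn⟩ := h0
    rw [zsmul_eq_mul] at hn
    exact Set.mem_iUnion.2 ⟨(ε, n), hx, by linarith⟩
  have hcount : (Set.Ioo lo hi).Countable :=
    (Set.countable_iUnion fun k => (hA k).countable).mono hcover
  have := hcount.measure_zero volume
  rw [Real.volume_Ioo, ENNReal.ofReal_eq_zero] at this
  linarith

/-! ### Families with constant Gram matrices -/

theorem continuous_vertex {V : Type} {P : I → V → S3} (hP : Continuous P) (v : V) :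
    Continuous fun s => (P s v : E4) :=
  continuous_subtype_val.comp ((continuous_apply v).comp hP)

/-- A family with constant Gram matrix is induced by isometries. -/
theorem isInducedByIsometries_of_gram {V : Type} {P : I → V → S3} (hP : Continuous P)
    (hG : ∀ s u v, inner ℝ (P s u : E4) (P s v) = inner ℝ (P 0 u : E4) (P 0 v)) (b : Fin 4 → V)
    (hb : LinearIndependent ℝ fun i => (P 0 (b i) : E4)) : IsInducedByIsometries P := by
  have hspan : ⊤ ≤ Submodule.span ℝ (Set.range fun i => (P 0 (b i) : E4)) :=
    (hb.span_eq_top_of_card_eq_finrank (by simp)).ge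
  let B : Module.Basis (Fin 4) ℝ E4 := .mk hb hspan
  have hB : ∀ i, B i = (P 0 (b i) : E4) := fun i => by simp [B]
  choose g hg using fun s => exists_isometry_of_gram hb
    (w := fun i => (P s (b i) : E4)) fun i j => (hG s (b i) (b j)).symm
  refine ⟨g, fun x => ?_, fun s v => ?_⟩
  · have hx : ∀ s, g s x = ∑ i, B.repr x i • (P s (b i) : E4) := fun s => by
      conv_lhs => rw [← B.sum_repr x]
      simp [hB, hg]
    simp only [hx]
    exact continuous_finsetSum _ fun i _ => continuous_const.fun_smul (continuous_vertex hP (b i))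
  · rw [← (g s).symm_apply_eq]
    refine InnerProductSpace.ext_inner_left_basis B fun i => ?_
    rw [hB, ← (g s).inner_map_map, (g s).apply_symm_apply, hg, hG]

/-- The vectors `a, b, u` lie in the plane orthogonal to the independent vectors `y, y'`, so their
Gram determinant vanishes. -/
theorem gram_relation_of_orthogonal {a b u y y' : E4} (ha : inner ℝ a a = 1)
    (hb : inner ℝ b b = 1) (hy : inner ℝ y y = 1) (hy' : inner ℝ y' y' = 1)
    (hyy : inner ℝ y y' ^ 2 ≠ 1) (hay : inner ℝ a y = 0) (hay' : inner ℝ a y' = 0)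
    (hby : inner ℝ b y = 0) (hby' : inner ℝ b y' = 0) (huy : inner ℝ u y = 0)
    (huy' : inner ℝ u y' = 0) :
    inner ℝ u u * (1 - inner ℝ a b ^ 2) - inner ℝ a u ^ 2 - inner ℝ b u ^ 2 +
      2 * inner ℝ a b * inner ℝ a u * inner ℝ b u = 0 := by
  have hdep : ¬ LinearIndependent ℝ ![a, b, u, y, y'] := fun h => by
    have := h.fintype_card_le_finrank
    simp at this
  rw [Fintype.not_linearIndependent_iff] at hdep
  obtain ⟨c, hc, i, hi⟩ := hdep
  simp only [Fin.sum_univ_five, Matrix.cons_val] at hc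
  have ea := congrArg (inner ℝ a) hc
  have eb := congrArg (inner ℝ b) hc
  have eu := congrArg (inner ℝ u) hc
  have ey := congrArg (inner ℝ y) hc
  have ey' := congrArg (inner ℝ y') hc
  simp only [inner_add_right, real_inner_smul_right, inner_zero_right, ha, hb, hy, hy', hay, hay',
    hby, hby', huy, huy', real_inner_comm a b, real_inner_comm a u, real_inner_comm b u,
    real_inner_comm a y, real_inner_comm b y, real_inner_comm u y, real_inner_comm a y',
    real_inner_comm b y', real_inner_comm u y', real_inner_comm y y'] at ea eb eu ey ey'
  set z := inner ℝ a b
  set p := inner ℝ a u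
  set p' := inner ℝ b u
  set X := inner ℝ u u
  set t := inner ℝ y y'
  have h3 : c 3 = 0 := by
    have : c 3 * (1 - t ^ 2) = 0 := by linear_combination ey - t * ey'
    exact (mul_eq_zero.1 this).resolve_right fun h => hyy (by linarith)
  have h4 : c 4 = 0 := by rw [h3] at ey'; linarith
  -- Otherwise the Gram matrix of `a, b, u` is invertible; the multipliers below are the rows of its
  -- adjugate.
  by_contra hD
  have h0 : c 0 = 0 := by
    refine (mul_eq_zero.1 (?_ : _ * c 0 = 0)).resolve_left hD
    linear_combination (X - p' ^ 2) * ea + (p * p' - z * X) * eb + (z * p' - p) * eu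
  have h1 : c 1 = 0 := by
    refine (mul_eq_zero.1 (?_ : _ * c 1 = 0)).resolve_left hD
    linear_combination (p * p' - z * X) * ea + (X - p ^ 2) * eb + (z * p - p') * eu
  have h2 : c 2 = 0 := by
    refine (mul_eq_zero.1 (?_ : _ * c 2 = 0)).resolve_left hD
    linear_combination (z * p' - p) * ea + (z * p - p') * eb + (1 - z ^ 2) * eu
  fin_cases i <;> exact hi (by assumption)

theorem eq_smul_of_inner_sq_eq_one {a b : E4} (ha : inner ℝ a a = 1) (hb : inner ℝ b b = 1)
    (hab : inner ℝ a b ^ 2 = 1) : b = inner ℝ a b • a := by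
  rw [← sub_eq_zero, ← inner_self_eq_zero (𝕜 := ℝ)]
  simp only [inner_sub_left, inner_sub_right, real_inner_smul_left, real_inner_smul_right, ha, hb,
    real_inner_comm a b]
  linear_combination -hab

/-- A continuous real function whose values are roots of a fixed quadratic is constant. -/
theorem eq_of_quadratic {f : I → ℝ} (hf : Continuous f) {x y z : ℝ} (hx : x ≠ 0)
    (h : ∀ s, x * f s ^ 2 + y * f s + z = 0) (s t : I) : f s = f t := by
  -- The mean of two values is a value too, and the second difference of the three equations is `x
  -- (f s - f t)² = 0`.
  have key : (f s + f t) / 2 ∈ Set.range f := by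
    rcases le_total (f s) (f t) with hst | hst
    · exact mem_range_of_exists_le_of_exists_ge hf ⟨s, by linarith⟩ ⟨t, by linarith⟩
    · exact mem_range_of_exists_le_of_exists_ge hf ⟨t, by linarith⟩ ⟨s, by linarith⟩
  obtain ⟨r, hr⟩ := key
  have h1 := h r
  rw [hr] at h1
  have : x * (f s - f t) ^ 2 = 0 := by linear_combination 2 * h s + 2 * h t - 4 * h1
  simpa [hx, sub_eq_zero] using this

namespace FlexGram

variable {p q : Bool → ℝ}

/-- Equal or antipodal vertices of the first diagonal would have the same `|p|`. -/
theorem inner_fst_sq_ne_one {P : OctV → S3} (h : FlexGram p q P) (hp : |p false| ≠ |p true|) :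
    inner ℝ (P (0, false) : E4) (P (0, true)) ^ 2 ≠ 1 := fun h1 => by
  have h2 := eq_smul_of_inner_sq_eq_one (inner_self_S3 _) (inner_self_S3 _) h1
  have h3 := h.fst_thd true false
  rw [h2, real_inner_smul_left, h.fst_thd] at h3
  refine hp (sq_eq_sq_iff_abs_eq_abs _ _ |>.1 ?_)
  rw [← h3, mul_pow, h1, one_mul]

theorem inner_snd_sq_ne_one {P : OctV → S3} (h : FlexGram p q P) (hq : |q false| ≠ |q true|) :
    inner ℝ (P (1, false) : E4) (P (1, true)) ^ 2 ≠ 1 := fun h1 => by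
  have h2 := eq_smul_of_inner_sq_eq_one (inner_self_S3 _) (inner_self_S3 _) h1
  have h3 := h.snd_thd true
  rw [h2, real_inner_smul_left, h.snd_thd] at h3
  refine hq (sq_eq_sq_iff_abs_eq_abs _ _ |>.1 ?_)
  rw [← h3, mul_pow, h1, one_mul]

/-- The vertices of the first diagonal and `c + d` are all orthogonal to the second diagonal, so
they lie in a plane. Their Gram relation is a quadratic equation for `⟪a₁, b₁⟫` whose coefficients
depend only on `p` and `midSq P`. -/
theorem fst_quadratic {P : OctV → S3} (h : FlexGram p q P) (hq : |q false| ≠ |q true|) :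
    -midSq P * inner ℝ (P (0, false) : E4) (P (0, true)) ^ 2 +
      2 * p false * p true * inner ℝ (P (0, false) : E4) (P (0, true)) +
      (midSq P - p false ^ 2 - p true ^ 2) = 0 := by
  have h1 := gram_relation_of_orthogonal (a := P (0, false)) (b := P (0, true))
    (u := (P (2, false) : E4) + P (2, true)) (y := P (1, false)) (y' := P (1, true))
    (inner_self_S3 _) (inner_self_S3 _) (inner_self_S3 _) (inner_self_S3 _)
    (h.inner_snd_sq_ne_one hq) (h.fst_snd _ _) (h.fst_snd _ _) (h.fst_snd _ _) (h.fst_snd _ _)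
    (by rw [real_inner_comm, inner_add_right, h.snd_thd, h.snd_thd']; ring)
    (by rw [real_inner_comm, inner_add_right, h.snd_thd, h.snd_thd']; ring)
  simp only [inner_add_left, inner_add_right, inner_self_S3, h.fst_thd,
    real_inner_comm (P (2, false) : E4) (P (2, true))] at h1
  rw [midSq]
  linear_combination h1 / 4

theorem snd_quadratic {P : OctV → S3} (h : FlexGram p q P) (hp : |p false| ≠ |p true|) :
    -(1 - midSq P) * inner ℝ (P (1, false) : E4) (P (1, true)) ^ 2 +
      2 * q false * q true * inner ℝ (P (1, false) : E4) (P (1, true)) +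
      (1 - midSq P - q false ^ 2 - q true ^ 2) = 0 := by
  have hsf : ∀ i j, inner ℝ (P (1, i) : E4) (P (0, j)) = 0 := fun i j => by
    rw [real_inner_comm, h.fst_snd]
  have h1 := gram_relation_of_orthogonal (a := P (1, false)) (b := P (1, true))
    (u := (P (2, false) : E4) - P (2, true)) (y := P (0, false)) (y' := P (0, true))
    (inner_self_S3 _) (inner_self_S3 _) (inner_self_S3 _) (inner_self_S3 _)
    (h.inner_fst_sq_ne_one hp) (hsf _ _) (hsf _ _) (hsf _ _) (hsf _ _)
    (by rw [real_inner_comm, inner_sub_right, h.fst_thd, h.fst_thd]; ring)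
    (by rw [real_inner_comm, inner_sub_right, h.fst_thd, h.fst_thd]; ring)
  simp only [inner_sub_left, inner_sub_right, inner_self_S3, h.snd_thd, h.snd_thd',
    real_inner_comm (P (2, false) : E4) (P (2, true))] at h1
  rw [midSq]
  linear_combination h1 / 4

theorem linearIndependent_diagonals {P : OctV → S3} (h : FlexGram p q P)
    (hp : |p false| ≠ |p true|) (hq : |q false| ≠ |q true|) :
    LinearIndependent ℝ fun i : Fin 4 =>
      (P (![(0, false), (0, true), (1, false), (1, true)] i) : E4) := by
  have hz := h.inner_fst_sq_ne_one hp
  have ht := h.inner_snd_sq_ne_one hq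
  rw [Fintype.linearIndependent_iff]
  intro c hc
  simp only [Fin.sum_univ_four, Matrix.cons_val] at hc
  have e0 := congrArg (inner ℝ (P (0, false) : E4)) hc
  have e1 := congrArg (inner ℝ (P (0, true) : E4)) hc
  have e2 := congrArg (inner ℝ (P (1, false) : E4)) hc
  have e3 := congrArg (inner ℝ (P (1, true) : E4)) hc
  have hsf : ∀ i j, inner ℝ (P (1, i) : E4) (P (0, j)) = 0 := fun i j => by
    rw [real_inner_comm, h.fst_snd]
  simp only [inner_add_right, real_inner_smul_right, inner_zero_right, inner_self_S3, h.fst_snd,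
    hsf, real_inner_comm (P (0, false) : E4) (P (0, true)),
    real_inner_comm (P (1, false) : E4) (P (1, true))] at e0 e1 e2 e3
  set z := inner ℝ (P (0, false) : E4) (P (0, true))
  set t := inner ℝ (P (1, false) : E4) (P (1, true))
  have h1 : c 1 = 0 := by
    have : c 1 * (1 - z ^ 2) = 0 := by linear_combination e1 - z * e0
    exact (mul_eq_zero.1 this).resolve_right fun h => hz (by linarith)
  have h0 : c 0 = 0 := by rw [h1] at e0; linarith
  have h3 : c 3 = 0 := by
    have : c 3 * (1 - t ^ 2) = 0 := by linear_combination e3 - t * e2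
    exact (mul_eq_zero.1 this).resolve_right fun h => ht (by linarith)
  have h2 : c 2 = 0 := by rw [h3] at e2; linarith
  intro i
  fin_cases i <;> assumption

end FlexGram

theorem exists_sq_pos {p : Bool → ℝ} (hp : |p false| ≠ |p true|) : ∃ i, 0 < p i ^ 2 := by
  by_contra! h
  have h0 : ∀ i, p i = 0 := fun i => by simpa using le_antisymm (h i) (sq_nonneg _)
  exact hp (by rw [h0, h0])

/-- A family along which the third diagonal does not change is induced by isometries. -/
theorem isInducedByIsometries_of_midSq {p q : Bool → ℝ} {P : I → OctV → S3} (hP : Continuous P)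
    (hG : ∀ s, FlexGram p q (P s)) (hp : |p false| ≠ |p true|) (hq : |q false| ≠ |q true|)
    (hmid : ∀ s, midSq (P s) = midSq (P 0)) : IsInducedByIsometries P := by
  have hz := eq_of_quadratic
    ((continuous_vertex hP (0, false)).inner (𝕜 := ℝ) (continuous_vertex hP (0, true)))
    (x := -midSq (P 0)) (y := 2 * p false * p true) (z := midSq (P 0) - p false ^ 2 - p true ^ 2)
    (by
      obtain ⟨i, hi⟩ := exists_sq_pos hp
      have := (hG 0).sq_le_midSq i
      linarith)
    fun s => by have := (hG s).fst_quadratic hq; rwa [hmid] at this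
  have ht := eq_of_quadratic
    ((continuous_vertex hP (1, false)).inner (𝕜 := ℝ) (continuous_vertex hP (1, true)))
    (x := -(1 - midSq (P 0))) (y := 2 * q false * q true)
    (z := 1 - midSq (P 0) - q false ^ 2 - q true ^ 2)
    (by
      obtain ⟨i, hi⟩ := exists_sq_pos hq
      have := (hG 0).sq_le_one_sub_midSq i
      linarith)
    fun s => by have := (hG s).snd_quadratic hp; rwa [hmid] at this
  have hk : ∀ s, inner ℝ (P s (2, false) : E4) (P s (2, true)) =
      inner ℝ (P 0 (2, false) : E4) (P 0 (2, true)) := fun s => by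
    have := hmid s
    unfold midSq at this
    linarith
  refine isInducedByIsometries_of_gram hP (fun s u v => ?_) _
    ((hG 0).linearIndependent_diagonals hp hq)
  have hsymm : ∀ (s : I) (u v : OctV), inner ℝ (P s u : E4) (P s v) = inner ℝ (P s v : E4) (P s u) :=
    fun s u v => real_inner_comm _ _
  obtain ⟨u, i⟩ := u
  obtain ⟨v, j⟩ := v
  fin_cases u <;> fin_cases v <;> cases i <;> cases j <;>
    first
    | (simp only [Fin.zero_eta, Fin.mk_one, Fin.reduceFinMk, inner_self_S3, (hG _).fst_snd,
        (hG _).fst_thd, (hG _).snd_thd, (hG _).snd_thd', hk, hz s 0, ht s 0]; done)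
    | (rw [hsymm s, hsymm 0]
       simp only [Fin.zero_eta, Fin.mk_one, Fin.reduceFinMk, (hG _).fst_snd,
        (hG _).fst_thd, (hG _).snd_thd, (hG _).snd_thd', hk, hz s 0, ht s 0])

/-! ### Replacing vertices with their antipodes -/

open Classical in
/-- The sign with which a vertex occurs after replacing the vertices in `S` with their antipodes. -/
def antipodeSign {V : Type} (S : Set V) (v : V) : ℝ := if v ∈ S then -1 else 1

theorem antipodeSign_eq {V : Type} (S : Set V) (v : V) :
    antipodeSign S v = 1 ∨ antipodeSign S v = -1 := by
  unfold antipodeSign; split_ifs <;> simp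

theorem antipodeSign_sq {V : Type} (S : Set V) (v : V) : antipodeSign S v ^ 2 = 1 := by
  rcases antipodeSign_eq S v with h | h <;> simp [h]

theorem inner_antipodes {V : Type} (S : Set V) (P : V → S3) (u v : V) :
    inner ℝ (antipodes S P u : E4) (antipodes S P v) =
      antipodeSign S u * antipodeSign S v * inner ℝ (P u : E4) (P v) := by
  unfold antipodes antipodeSign
  split_ifs <;> simp

theorem continuous_antipodes {V : Type} (S : Set V) {P : I → V → S3} (hP : Continuous P) :
    Continuous fun s => antipodes S (P s) := by
  refine continuous_pi fun v => ?_
  have h : Continuous fun s => P s v := (continuous_apply v).comp hP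
  unfold antipodes
  split_ifs
  exacts [h.neg, h]

theorem isNondegenerate_antipodes {V : Type} {K : OrientedSurface V} (S : Set V) {P : V → S3}
    (h : IsNondegenerate K P) : IsNondegenerate K (antipodes S P) := by
  intro u v w hf
  let e : V → ℝˣ := fun v => Units.mk0 (antipodeSign S v) fun h0 => by
    simpa [h0] using antipodeSign_sq S v
  have he : ∀ v, (antipodes S P v : E4) = e v • (P v : E4) := fun v => by
    simp only [antipodes, antipodeSign, e, Units.smul_mk0]
    split_ifs <;> simp
  convert (h u v w hf).units_smul ![e u, e v, e w] using 1
  ext i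
  fin_cases i <;> simp [he]

/-- The core of the theorem: along every continuous family of octahedra with the Gram matrices of
the explicit family that is not induced by isometries, the volume is nonconstant for every choice
of antipodes. -/
theorem not_hasConstantVolume_antipodes {p q : Bool → ℝ} {P : I → OctV → S3} (hP : Continuous P)
    (hG : ∀ s, FlexGram p q (P s)) (hp : |p false| ≠ |p true|) (hq : |q false| ≠ |q true|)
    (hpq : ∀ i j, p i ^ 2 + q j ^ 2 < 1) (hI : ¬ IsInducedByIsometries P) (S : Set OctV) :
    ¬ HasConstantVolume octahedron fun s => antipodes S (P s) := by
  obtain ⟨s, hs⟩ : ∃ s, midSq (P s) ≠ midSq (P 0) := by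
    by_contra! h
    exact hI (isInducedByIsometries_of_midSq hP hG hp hq h)
  have hsq : ∀ u v, (antipodeSign S u * antipodeSign S v) ^ 2 = 1 := fun u v => by
    rw [mul_pow, antipodeSign_sq, antipodeSign_sq, one_mul]
  have habs : ∀ (r : Bool → ℝ) (u v : Bool → OctV), |r false| ≠ |r true| →
      |antipodeSign S (u false) * antipodeSign S (v false) * r false| ≠
        |antipodeSign S (u true) * antipodeSign S (v true) * r true| := fun r u v h => by
    have h1 : ∀ w, |antipodeSign S w| = 1 := fun w => by
      rcases antipodeSign_eq S w with h | h <;> simp [h]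
    simpa [abs_mul, h1] using h
  have hmid : midSq (antipodes S (P s)) ≠ midSq (antipodes S (P 0)) := fun h => hs (by
    unfold midSq at h ⊢
    rw [inner_antipodes, inner_antipodes] at h
    have h1 := hsq (2, false) (2, true)
    linear_combination (antipodeSign S (2, false) * antipodeSign S (2, true)) * h -
      h1 * (inner ℝ (P s (2, false) : E4) (P s (2, true)) -
        inner ℝ (P 0 (2, false) : E4) (P 0 (2, true))) / 2)
  have hcont := continuous_antipodes S hP
  have hc : antipodeSign S (2, true) = antipodeSign S (2, false) ∨
      antipodeSign S (2, true) = -antipodeSign S (2, false) := by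
    rcases antipodeSign_eq S (2, true) with h | h <;>
      rcases antipodeSign_eq S (2, false) with h' | h' <;> simp [h, h']
  -- If both or none of `c, d` are replaced, the relations persist with other signs of the `p i` and
  -- `q j`. If exactly one is replaced, the vertices of the second diagonal have equal inner
  -- products with `c` and `d` and those of the first have opposite ones, so the first two diagonals
  -- exchange their roles.
  rcases hc with hc | hc
  · refine not_hasConstantVolume_of_midSq
      (p := fun i => antipodeSign S (0, i) * antipodeSign S (2, false) * p i)
      (q := fun j => antipodeSign S (1, j) * antipodeSign S (2, false) * q j) hcont (fun s => ?_)
      (habs p (fun i => (0, i)) (fun _ => (2, false)) hp)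
      (habs q (fun i => (1, i)) (fun _ => (2, false)) hq) hmid
    refine ⟨fun i j => ?_, fun i k => ?_, fun j => ?_, fun j => ?_⟩
    · rw [inner_antipodes, (hG s).fst_snd, mul_zero]
    · rw [inner_antipodes, (hG s).fst_thd]
      cases k <;> simp [hc]
    · rw [inner_antipodes, (hG s).snd_thd]
    · rw [inner_antipodes, (hG s).snd_thd', hc]; ring
  · have hrel : ∀ k b, reindex (Equiv.swap 0 1) (k, b) = (Equiv.swap 0 1 k, b) := fun k b => rfl
    have hF : ∀ s, FlexGram (fun i => antipodeSign S (1, i) * antipodeSign S (2, false) * q i)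
        (fun j => antipodeSign S (0, j) * antipodeSign S (2, false) * p j)
        (antipodes S (P s) ∘ reindex (Equiv.swap 0 1)) := fun s => by
      refine ⟨fun i j => ?_, fun i k => ?_, fun j => ?_, fun j => ?_⟩
      all_goals simp only [Function.comp_apply, hrel, Equiv.swap_apply_left, Equiv.swap_apply_right,
        Equiv.swap_apply_of_ne_of_ne (a := (0 : Fin 3)) (b := 1) (x := 2) (by decide) (by decide)]
      · rw [inner_antipodes, real_inner_comm, (hG s).fst_snd, mul_zero]
      · rw [inner_antipodes]
        cases k
        · rw [(hG s).snd_thd]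
        · rw [(hG s).snd_thd', hc]; ring
      · rw [inner_antipodes, (hG s).fst_thd]
      · rw [inner_antipodes, (hG s).fst_thd, hc]; ring
    intro hcv
    refine not_hasConstantVolume_of_midSq
      (P := fun s => antipodes S (P s) ∘ reindex (Equiv.swap 0 1))
      (continuous_pi fun v => (continuous_apply _).comp hcont) hF
      (habs q (fun i => (1, i)) (fun _ => (2, false)) hq)
      (habs p (fun i => (0, i)) (fun _ => (2, false)) hp) hmid
      (hasConstantVolume_reindex (fun s => ?_) _ hcv)
    exact isNondegenerate_antipodes S ((hG s).isNondegenerate hpq)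

/-! ### The explicit family -/

section ExplicitFamily

variable {p₁ p₂ q₁ q₂ θ : ℝ}

theorem max_abs_pos {x y : ℝ} (h : |x| ≠ |y|) : 0 < max |x| |y| := by
  rcases lt_or_gt_of_ne h with h | h
  · exact lt_max_of_lt_right ((abs_nonneg _).trans_lt h)
  · exact lt_max_of_lt_left ((abs_nonneg _).trans_lt h)

theorem max_abs_sq (x y : ℝ) : max |x| |y| ^ 2 = max (x ^ 2) (y ^ 2) := by
  rcases le_total |x| |y| with h | h
  · rw [max_eq_right h, max_eq_right (sq_le_sq.2 h), sq_abs]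
  · rw [max_eq_left h, max_eq_left (sq_le_sq.2 h), sq_abs]

theorem max_abs_le_one (hpq : max (p₁ ^ 2) (p₂ ^ 2) + max (q₁ ^ 2) (q₂ ^ 2) < 1) :
    max |p₁| |p₂| ≤ 1 ∧ max |q₁| |q₂| ≤ 1 := by
  have h1 := max_abs_sq p₁ p₂
  have h2 := max_abs_sq q₁ q₂
  constructor <;> refine abs_le_one_iff_mul_self_le_one.2 ?_ |> (le_abs_self _).trans <;>
    nlinarith [sq_nonneg (max |p₁| |p₂|), sq_nonneg (max |q₁| |q₂|)]

theorem thetaMin_lt_thetaMax (hp : |p₁| ≠ |p₂|)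
    (hpq : max (p₁ ^ 2) (p₂ ^ 2) + max (q₁ ^ 2) (q₂ ^ 2) < 1) :
    thetaMin q₁ q₂ < thetaMax p₁ p₂ := by
  have h0 := max_abs_pos hp
  have h1 := max_abs_sq p₁ p₂
  have h2 := max_abs_sq q₁ q₂
  have hq0 : 0 ≤ max |q₁| |q₂| := le_max_of_le_left (abs_nonneg _)
  rw [thetaMin, thetaMax, Real.arccos_eq_arcsin h0.le]
  refine Real.arcsin_lt_arcsin (by linarith) (Real.lt_sqrt_of_sq_lt (by linarith)) ?_
  exact Real.sqrt_le_one.2 (by nlinarith)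

/-- In the range of the parameter, all quantities of the explicit family are well defined. -/
theorem bounds_of_mem_Icc (hp : |p₁| ≠ |p₂|) (hq : |q₁| ≠ |q₂|)
    (hpq : max (p₁ ^ 2) (p₂ ^ 2) + max (q₁ ^ 2) (q₂ ^ 2) < 1)
    (hθ : θ ∈ Set.Icc (thetaMin q₁ q₂) (thetaMax p₁ p₂)) :
    0 < Real.cos θ ∧ 0 < Real.sin θ ∧ p₁ ^ 2 ≤ Real.cos θ ^ 2 ∧ p₂ ^ 2 ≤ Real.cos θ ^ 2 ∧
      q₁ ^ 2 ≤ Real.sin θ ^ 2 ∧ q₂ ^ 2 ≤ Real.sin θ ^ 2 := by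
  obtain ⟨hM1, hm1⟩ := max_abs_le_one hpq
  have hM := max_abs_pos hp
  have hm := max_abs_pos hq
  have hmin : 0 < thetaMin q₁ q₂ := Real.arcsin_pos.2 hm
  have hmax : thetaMax p₁ p₂ < Real.pi / 2 := Real.arccos_lt_pi_div_two.2 hM
  have hc : max |p₁| |p₂| ≤ Real.cos θ := by
    rw [← Real.cos_arccos (x := max |p₁| |p₂|) (by linarith) hM1]
    exact Real.cos_le_cos_of_nonneg_of_le_pi (by linarith [hθ.1])
      (Real.arccos_le_pi _) hθ.2
  have hs : max |q₁| |q₂| ≤ Real.sin θ := by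
    rw [← Real.sin_arcsin (x := max |q₁| |q₂|) (by linarith) hm1]
    exact Real.sin_le_sin_of_le_of_le_pi_div_two (Real.neg_pi_div_two_le_arcsin _)
      (by linarith [hθ.2]) hθ.1
  have key : ∀ {x y : ℝ}, |x| ≤ y → x ^ 2 ≤ y ^ 2 := fun h => sq_le_sq.2 (h.trans (le_abs_self _))
  exact ⟨hM.trans_le hc, hm.trans_le hs, key ((le_max_left _ _).trans hc),
    key ((le_max_right _ _).trans hc), key ((le_max_left _ _).trans hs),
    key ((le_max_right _ _).trans hs)⟩

theorem units_sq (ε : ℤˣ) : ((ε : ℤ) : ℝ) ^ 2 = 1 := by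
  rcases Int.units_eq_one_or ε with rfl | rfl <;> simp

theorem sq_add_sq_sqrt {x c : ℝ} (ε : ℤˣ) (hc : 0 < c) (h : x ^ 2 ≤ c ^ 2) :
    (x / c) ^ 2 + (((ε : ℤ) : ℝ) * √(1 - x ^ 2 / c ^ 2)) ^ 2 = 1 := by
  rw [mul_pow, units_sq, Real.sq_sqrt (sub_nonneg.2 ((div_le_one (by positivity)).2 h)), div_pow]
  ring

theorem norm_flexVertex (hc : 0 < Real.cos θ) (hs : 0 < Real.sin θ) (h1 : p₁ ^ 2 ≤ Real.cos θ ^ 2)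
    (h2 : p₂ ^ 2 ≤ Real.cos θ ^ 2) (h3 : q₁ ^ 2 ≤ Real.sin θ ^ 2) (h4 : q₂ ^ 2 ≤ Real.sin θ ^ 2)
    (δ₁ δ₂ ε₁ ε₂ : ℤˣ) : ∀ v, ‖flexVertex p₁ p₂ q₁ q₂ θ δ₁ δ₂ ε₁ ε₂ v‖ = 1 := by
  have hcs := Real.sin_sq_add_cos_sq θ
  rintro ⟨i, b⟩
  refine (sq_eq_sq₀ (norm_nonneg _) zero_le_one).1 ?_
  rw [EuclideanSpace.norm_sq_eq, Fin.sum_univ_four]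
  fin_cases i <;> cases b <;>
    simp only [flexVertex, Real.norm_eq_abs, sq_abs, Matrix.cons_val]
  · linarith [sq_add_sq_sqrt δ₁ hc h1]
  · linarith [sq_add_sq_sqrt δ₂ hc h2]
  · linarith [sq_add_sq_sqrt ε₁ hs h3]
  · linarith [sq_add_sq_sqrt ε₂ hs h4]
  · linarith
  · linarith

theorem flexGram_of_eq_flexVertex (hc : Real.cos θ ≠ 0) (hs : Real.sin θ ≠ 0)
    {δ₁ δ₂ ε₁ ε₂ : ℤˣ} {P : OctV → S3} {g : E4 ≃ₗᵢ[ℝ] E4}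
    (hP : ∀ v, (P v : E4) = g (flexVertex p₁ p₂ q₁ q₂ θ δ₁ δ₂ ε₁ ε₂ v)) :
    FlexGram (fun b => cond b p₂ p₁) (fun b => cond b q₂ q₁) P := by
  refine ⟨?_, ?_, ?_, ?_⟩
  · rintro (_ | _) (_ | _) <;> rw [hP, hP, g.inner_map_map, PiLp.inner_apply, Fin.sum_univ_four] <;>
      simp [flexVertex]
  · rintro (_ | _) (_ | _) <;> rw [hP, hP, g.inner_map_map, PiLp.inner_apply, Fin.sum_univ_four] <;>
      simp [flexVertex] <;> field_simp
  · rintro (_ | _) <;> rw [hP, hP, g.inner_map_map, PiLp.inner_apply, Fin.sum_univ_four] <;>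
      simp [flexVertex] <;> field_simp
  · rintro (_ | _) <;> rw [hP, hP, g.inner_map_map, PiLp.inner_apply, Fin.sum_univ_four] <;>
      simp [flexVertex] <;> field_simp

theorem flexGram_of_mem_configCurve (hp : |p₁| ≠ |p₂|) (hq : |q₁| ≠ |q₂|)
    (hpq : max (p₁ ^ 2) (p₂ ^ 2) + max (q₁ ^ 2) (q₂ ^ 2) < 1) {P : OctV → S3}
    (hP : P ∈ configCurve p₁ p₂ q₁ q₂) :
    FlexGram (fun b => cond b p₂ p₁) (fun b => cond b q₂ q₁) P := by
  obtain ⟨θ, hθ, δ₁, δ₂, ε₁, ε₂, g, hg⟩ := hP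
  obtain ⟨hc, hs, -⟩ := bounds_of_mem_Icc hp hq hpq hθ
  exact flexGram_of_eq_flexVertex hc.ne' hs.ne' hg

theorem sq_add_sq_lt_one (hpq : max (p₁ ^ 2) (p₂ ^ 2) + max (q₁ ^ 2) (q₂ ^ 2) < 1) (i j : Bool) :
    (cond i p₂ p₁) ^ 2 + (cond j q₂ q₁) ^ 2 < 1 := by
  have h1 := le_max_left (p₁ ^ 2) (p₂ ^ 2)
  have h2 := le_max_right (p₁ ^ 2) (p₂ ^ 2)
  have h3 := le_max_left (q₁ ^ 2) (q₂ ^ 2)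
  have h4 := le_max_right (q₁ ^ 2) (q₂ ^ 2)
  cases i <;> cases j <;> simp only [cond] <;> linarith

theorem not_hasConstantVolume_of_configCurve (hp : |p₁| ≠ |p₂|) (hq : |q₁| ≠ |q₂|)
    (hpq : max (p₁ ^ 2) (p₂ ^ 2) + max (q₁ ^ 2) (q₂ ^ 2) < 1) {P : I → OctV → S3}
    (hP : Continuous P) (hC : ∀ s, P s ∈ configCurve p₁ p₂ q₁ q₂) (hI : ¬ IsInducedByIsometries P)
    (S : Set OctV) : ¬ HasConstantVolume octahedron fun s => antipodes S (P s) :=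
  not_hasConstantVolume_antipodes hP (fun s => flexGram_of_mem_configCurve hp hq hpq (hC s))
    (by simpa using hp) (by simpa using hq) (sq_add_sq_lt_one hpq) hI S

theorem inner_eq_of_isInducedByIsometries {V : Type} {P : I → V → S3}
    (h : IsInducedByIsometries P) (s : I) (u v : V) :
    inner ℝ (P s u : E4) (P s v) = inner ℝ (P 0 u : E4) (P 0 v) := by
  obtain ⟨g, -, hg⟩ := h
  rw [hg s u, hg s v, (g s).inner_map_map]

/-- The inner product of two vertices does not depend on the position on the curve, unless these
are opposite. -/
theorem FlexGram.inner_eq {p q : Bool → ℝ} {P Q : OctV → S3} (hP : FlexGram p q P)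
    (hQ : FlexGram p q Q) {u v : OctV} (huv : u.1 ≠ v.1) :
    inner ℝ (P u : E4) (P v) = inner ℝ (Q u : E4) (Q v) := by
  have h1 : ∀ (R : OctV → S3) u v, inner ℝ (R u : E4) (R v) = inner ℝ (R v : E4) (R u) :=
    fun R u v => real_inner_comm _ _
  obtain ⟨u, i⟩ := u
  obtain ⟨v, j⟩ := v
  fin_cases u <;> fin_cases v <;> cases i <;> cases j <;>
    first
    | exact absurd rfl huv
    | (simp only [Fin.zero_eta, Fin.mk_one, Fin.reduceFinMk, hP.fst_snd, hP.fst_thd, hP.snd_thd,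
        hP.snd_thd', hQ.fst_snd, hQ.fst_thd, hQ.snd_thd, hQ.snd_thd']; done)
    | (rw [h1 P, h1 Q]
       simp only [Fin.zero_eta, Fin.mk_one, Fin.reduceFinMk, hP.fst_snd, hP.fst_thd, hP.snd_thd,
        hP.snd_thd', hQ.fst_snd, hQ.fst_thd, hQ.snd_thd, hQ.snd_thd'])

theorem exists_counterexample (hp : |p₁| ≠ |p₂|) (hq : |q₁| ≠ |q₂|)
    (hpq : max (p₁ ^ 2) (p₂ ^ 2) + max (q₁ ^ 2) (q₂ ^ 2) < 1) (δ₁ δ₂ ε₁ ε₂ : ℤˣ) :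
    ∃ P : I → OctV → S3,
      (∀ (s : I) (v : OctV), (P s v : E4) = flexVertex p₁ p₂ q₁ q₂
        ((1 - s) * thetaMin q₁ q₂ + s * thetaMax p₁ p₂) δ₁ δ₂ ε₁ ε₂ v) ∧
      IsCounterexample octahedron P := by
  have hlt := thetaMin_lt_thetaMax hp hpq
  let θ : I → ℝ := fun s => (1 - s) * thetaMin q₁ q₂ + s * thetaMax p₁ p₂
  have hθ : ∀ s, θ s ∈ Set.Icc (thetaMin q₁ q₂) (thetaMax p₁ p₂) := fun s => by
    have h0 := s.2.1
    have h1 := s.2.2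
    constructor <;> simp only [θ] <;> nlinarith
  have hθc : Continuous θ := by fun_prop
  have hb := fun s => bounds_of_mem_Icc hp hq hpq (hθ s)
  let P : I → OctV → S3 := fun s v => ⟨flexVertex p₁ p₂ q₁ q₂ (θ s) δ₁ δ₂ ε₁ ε₂ v, by
    obtain ⟨hc, hs, h1, h2, h3, h4⟩ := hb s
    simpa using norm_flexVertex hc hs h1 h2 h3 h4 δ₁ δ₂ ε₁ ε₂ v⟩
  have hPc : Continuous P := by
    have hc0 : ∀ s, Real.cos (θ s) ≠ 0 := fun s => (hb s).1.ne'
    have hs0 : ∀ s, Real.sin (θ s) ≠ 0 := fun s => (hb s).2.1.ne'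
    have hc2 : ∀ s, Real.cos (θ s) ^ 2 ≠ 0 := fun s => pow_ne_zero 2 (hc0 s)
    have hs2 : ∀ s, Real.sin (θ s) ^ 2 ≠ 0 := fun s => pow_ne_zero 2 (hs0 s)
    refine continuous_pi fun v => Continuous.subtype_mk ?_ _
    refine (PiLp.continuous_toLp 2 _).comp (continuous_pi fun k => ?_)
    obtain ⟨i, b⟩ := v
    fin_cases i <;> cases b <;> fin_cases k <;> simp <;> fun_prop (disch := assumption)
  have hC : ∀ s, P s ∈ configCurve p₁ p₂ q₁ q₂ := fun s =>
    ⟨θ s, hθ s, δ₁, δ₂, ε₁, ε₂, .refl ℝ E4, fun v => rfl⟩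
  have hG := fun s => flexGram_of_mem_configCurve hp hq hpq (hC s)
  -- The third diagonal has `⟪a₃, b₃⟫ = cos 2θ`, which is different at the two ends of the range of
  -- `θ`.
  have hI : ¬ IsInducedByIsometries P := fun h => by
    have h1 := inner_eq_of_isInducedByIsometries h 1 (2, false) (2, true)
    have key : ∀ s, inner ℝ (P s (2, false) : E4) (P s (2, true)) = 2 * Real.cos (θ s) ^ 2 - 1 := by
      intro s
      rw [PiLp.inner_apply, Fin.sum_univ_four]
      simp [P, flexVertex]
      linarith [Real.sin_sq_add_cos_sq (θ s)]
    have h0 : θ 0 = thetaMin q₁ q₂ := by simp [θ]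
    have h2 : θ 1 = thetaMax p₁ p₂ := by simp [θ]
    have hmin : 0 < thetaMin q₁ q₂ := Real.arcsin_pos.2 (max_abs_pos hq)
    have hmax : thetaMax p₁ p₂ < Real.pi / 2 := Real.arccos_lt_pi_div_two.2 (max_abs_pos hp)
    have h3 : Real.cos (θ 1) < Real.cos (θ 0) := by
      rw [h0, h2]
      exact Real.cos_lt_cos_of_nonneg_of_le_pi hmin.le (by linarith [Real.pi_pos]) hlt
    rw [key, key] at h1
    nlinarith [(hb 0).1, (hb 1).1]
  refine ⟨P, fun s v => rfl, ⟨hPc, fun s => (hG s).isNondegenerate (sq_add_sq_lt_one hpq),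
    fun u v w hf s => ?_, hI⟩, not_hasConstantVolume_of_configCurve hp hq hpq hPc hC hI⟩
  rw [sdist, sdist, InnerProductGeometry.angle, InnerProductGeometry.angle,
    (hG s).inner_eq (hG 0) (octFace_adj u v w hf).1]
  simp only [norm_eq_of_mem_sphere]

end ExplicitFamily

theorem not_modifiedBellowsConjecture : ¬ ModifiedBellowsConjecture := fun h => by
  obtain ⟨P, -, hflex, hP⟩ := exists_counterexample (p₁ := 0) (p₂ := 1 / 2) (q₁ := 0) (q₂ := 1 / 2)
    (by norm_num) (by norm_num) (by norm_num) 1 1 1 1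
  obtain ⟨S, hS⟩ := h OctV octahedron P hflex
  exact hP S hS

/-! ### Biquadratic relations between generators of function fields -/

section Biquadratic

open Polynomial

/-- If a quadratic equation with even coefficients `a X ^ 2 + d`, `b X ^ 2 + e` and odd middle
coefficient has the solution `f / g`, then `f` is at most linear. -/
theorem natDegree_le_one_of_biquadratic {f g : ℝ[X]} (hfg : IsCoprime f g) {a b c d e : ℝ}
    (hc : c ≠ 0) (had : C a * X ^ 2 + C d ≠ 0) (hbe : C b * X ^ 2 + C e ≠ 0)
    (h : (C a * X ^ 2 + C d) * f ^ 2 + 2 * C c * X * f * g + (C b * X ^ 2 + C e) * g ^ 2 = 0) :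
    f.natDegree ≤ 1 := by
  obtain ⟨m, hm⟩ : f ∣ C b * X ^ 2 + C e := by
    refine (hfg.pow_right (n := 2)).dvd_of_dvd_mul_right ?_
    exact ⟨-((C a * X ^ 2 + C d) * f + 2 * C c * X * g), by linear_combination h⟩
  obtain ⟨k, hk⟩ : g ∣ C a * X ^ 2 + C d := by
    refine (hfg.symm.pow_right (n := 2)).dvd_of_dvd_mul_right ?_
    exact ⟨-((C b * X ^ 2 + C e) * g + 2 * C c * X * f), by linear_combination h⟩
  have hf0 : f ≠ 0 := fun h0 => hbe (by rw [hm, h0, zero_mul])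
  have hm0 : m ≠ 0 := fun h0 => hbe (by rw [hm, h0, mul_zero])
  have hg0 : g ≠ 0 := fun h0 => had (by rw [hk, h0, zero_mul])
  have hk0 : k ≠ 0 := fun h0 => had (by rw [hk, h0, mul_zero])
  -- This is the relation divided by `f g`.
  have key : k * f = -(C (2 * c) * X + m * g) := by
    refine mul_left_cancel₀ (mul_ne_zero hf0 hg0) ?_
    rw [hm, hk] at h
    simp only [map_mul, map_ofNat]
    linear_combination h
  have hdeg : ∀ x y : ℝ, (C x * X ^ 2 + C y : ℝ[X]).natDegree ≤ 2 := fun x y => by compute_degree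
  have h1 : f.natDegree + m.natDegree ≤ 2 := by
    rw [← natDegree_mul hf0 hm0, ← hm]; exact hdeg _ _
  have h2 : g.natDegree + k.natDegree ≤ 2 := by
    rw [← natDegree_mul hg0 hk0, ← hk]; exact hdeg _ _
  by_contra! hf
  have h3 : k.natDegree + f.natDegree ≤ max 1 (m.natDegree + g.natDegree) := by
    rw [← natDegree_mul hk0 hf0, key, natDegree_neg, ← natDegree_mul hm0 hg0]
    refine (natDegree_add_le _ _).trans (max_le_max ?_ le_rfl)
    compute_degree
  -- If `f` has degree two, then `m` and `k` are constants. So `f` and `g` are multiples of `b X² +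
  -- e` and `a X² + d` and have no linear term, whereas `k f + m g = -2 c X` has one.
  have hm1 : m.natDegree = 0 := by omega
  have hk1 : k.natDegree = 0 := by
    rcases le_max_iff.1 h3 with h | h <;> omega
  obtain ⟨m', rfl⟩ := natDegree_eq_zero.1 hm1
  obtain ⟨k', rfl⟩ := natDegree_eq_zero.1 hk1
  have hm' : m' ≠ 0 := fun h0 => hm0 (by rw [h0, C_0])
  have hk' : k' ≠ 0 := fun h0 => hk0 (by rw [h0, C_0])
  have ef := congrArg (coeff · 1) hm
  have eg := congrArg (coeff · 1) hk
  have ek := congrArg (coeff · 1) key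
  simp only [coeff_add, coeff_mul_C, coeff_C_mul, coeff_X_pow, coeff_C, coeff_neg, coeff_X] at ef eg ek
  norm_num at ef eg ek
  rw [(ef.resolve_right hm'), eg.resolve_right hk'] at ek
  exact hc (by linarith)

variable {L : Type*} [Field L] [Algebra ℝ L]

theorem coeff_eq_zero_of_transcendental {t : L} (ht : Transcendental ℝ t) {a b c d e : ℝ}
    (h : algebraMap ℝ L a * t ^ 4 + algebraMap ℝ L b * t ^ 3 + algebraMap ℝ L c * t ^ 2 +
      algebraMap ℝ L d * t + algebraMap ℝ L e = 0) : a = 0 ∧ b = 0 ∧ c = 0 ∧ d = 0 ∧ e = 0 := by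
  have h0 := transcendental_iff.1 ht (C a * X ^ 4 + C b * X ^ 3 + C c * X ^ 2 + C d * X + C e)
    (by simpa using h)
  have h1 := fun n => congrArg (coeff · n) h0
  simp only [coeff_add, coeff_C_mul, coeff_X_pow, coeff_C, coeff_X, coeff_zero] at h1
  have e0 := h1 0
  have e1 := h1 1
  have e2 := h1 2
  have e3 := h1 3
  have e4 := h1 4
  norm_num at e0 e1 e2 e3 e4
  exact ⟨e4, e3, e2, e1, e0⟩

theorem transcendental_ne_zero {t : L} (ht : Transcendental ℝ t) : t ≠ 0 := fun h =>
  ht (h ▸ isAlgebraic_zero)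

theorem exists_isCoprime_of_mem_adjoin {t x : L} (ht : Transcendental ℝ t)
    (hx : x ∈ IntermediateField.adjoin ℝ {t}) :
    ∃ f g : ℝ[X], IsCoprime f g ∧ aeval t g ≠ 0 ∧ x * aeval t g = aeval t f := by
  obtain ⟨r, s, rfl⟩ := IntermediateField.mem_adjoin_simple_iff ℝ x |>.1 hx
  by_cases hs : s = 0
  · exact ⟨0, 1, isCoprime_one_right, by simp, by simp [hs]⟩
  have hs0 : aeval t s ≠ 0 := fun h => hs (transcendental_iff.1 ht s h)
  obtain ⟨f, hf⟩ := EuclideanDomain.gcd_dvd_left r s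
  obtain ⟨g, hg⟩ := EuclideanDomain.gcd_dvd_right r s
  have hgcd : EuclideanDomain.gcd r s ≠ 0 := fun h => hs (by rw [hg, h, zero_mul])
  refine ⟨f, g, ?_, ?_, ?_⟩
  · refine ⟨EuclideanDomain.gcdA r s, EuclideanDomain.gcdB r s, ?_⟩
    refine mul_left_cancel₀ hgcd ?_
    have := EuclideanDomain.gcd_eq_gcd_ab r s
    linear_combination -this - EuclideanDomain.gcdA r s * hf - EuclideanDomain.gcdB r s * hg
  · intro h
    apply hs0
    rw [hg, map_mul, h, mul_zero]
  · have e1 : aeval t r = aeval t (EuclideanDomain.gcd r s) * aeval t f := by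
      conv_lhs => rw [hf, map_mul]
    have e2 : aeval t s = aeval t (EuclideanDomain.gcd r s) * aeval t g := by
      conv_lhs => rw [hg, map_mul]
    have h1 : aeval t (EuclideanDomain.gcd r s) ≠ 0 := fun h => hs0 (by rw [e2, h, zero_mul])
    have h2 : aeval t g ≠ 0 := fun h => hs0 (by rw [e2, h, mul_zero])
    rw [e1, e2]
    field_simp

/-- A biquadratic relation between `t` and `x ∈ ℝ(t)`, where `ℝ(x) ≠ ℝ(t)`, is reducible of a
special kind. -/
theorem biquadratic_degenerate {t x : L} (ht : Transcendental ℝ t)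
    (hx : x ∈ IntermediateField.adjoin ℝ {t}) (htx : t ∉ IntermediateField.adjoin ℝ {x})
    {a b c d e : ℝ} (hc : c ≠ 0)
    (h : (algebraMap ℝ L a * t ^ 2 + algebraMap ℝ L d) * x ^ 2 + 2 * algebraMap ℝ L c * t * x +
      (algebraMap ℝ L b * t ^ 2 + algebraMap ℝ L e) = 0) :
    (a = 0 ∧ d = 0) ∨ (b = 0 ∧ e = 0) := by
  obtain ⟨f, g, hfg, hg, hxg⟩ := exists_isCoprime_of_mem_adjoin ht hx
  have hzero : ∀ {u v : ℝ}, (C u * X ^ 2 + C v : ℝ[X]) = 0 → u = 0 ∧ v = 0 := fun {u v} h0 => by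
    have h2 := congrArg (coeff · 2) h0
    have h1 := congrArg (coeff · 0) h0
    simp [coeff_C] at h1 h2
    exact ⟨h2, h1⟩
  by_contra! hne
  have had : (C a * X ^ 2 + C d : ℝ[X]) ≠ 0 := fun h0 => hne.1 (hzero h0).1 (hzero h0).2
  have hbe : (C b * X ^ 2 + C e : ℝ[X]) ≠ 0 := fun h0 => hne.2 (hzero h0).1 (hzero h0).2
  have hpoly : (C a * X ^ 2 + C d) * f ^ 2 + 2 * C c * X * f * g + (C b * X ^ 2 + C e) * g ^ 2 = 0 := by
    refine transcendental_iff.1 ht _ ?_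
    simp only [map_add, map_mul, map_pow, aeval_C, aeval_X, ← hxg, map_ofNat]
    linear_combination h * aeval t g ^ 2
  -- The relation is symmetric under exchange of numerator and denominator together with `(a, d)`
  -- and `(b, e)`. So both degrees are at most one: `x` is a constant or a fractional linear
  -- function of `t`. The first contradicts the relation and the second `t ∉ ℝ(x)`.
  have h1 := natDegree_le_one_of_biquadratic hfg hc had hbe hpoly
  have h2 := natDegree_le_one_of_biquadratic hfg.symm hc hbe had (by linear_combination hpoly)
  obtain ⟨f1, f0, rfl⟩ := exists_eq_X_add_C_of_natDegree_le_one h1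
  obtain ⟨g1, g0, rfl⟩ := exists_eq_X_add_C_of_natDegree_le_one h2
  simp only [map_add, map_mul, aeval_C, aeval_X] at hg hxg
  have hreal : ∀ r : ℝ, x ≠ algebraMap ℝ L r := by
    rintro r rfl
    obtain ⟨-, -, h3, h4, h5⟩ := coeff_eq_zero_of_transcendental ht (a := 0) (b := 0)
      (c := a * r ^ 2 + b) (d := 2 * c * r) (e := d * r ^ 2 + e) (by
        simp only [map_add, map_mul, map_pow, map_zero, map_ofNat]
        linear_combination h)
    have hr : r = 0 := by simpa [hc] using h4
    rw [hr] at h3 h5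
    exact hne.2 (by linarith) (by linarith)
  by_cases h3 : x * algebraMap ℝ L g1 - algebraMap ℝ L f1 = 0
  · have h4 : x * algebraMap ℝ L g0 = algebraMap ℝ L f0 := by linear_combination hxg - t * h3
    by_cases hg1 : g1 = 0
    · have hg0 : algebraMap ℝ L g0 ≠ 0 := by simpa [hg1] using hg
      exact hreal (f0 / g0) (by rw [map_div₀, eq_div_iff hg0, h4])
    · have hg1' : algebraMap ℝ L g1 ≠ 0 := by simpa using hg1
      exact hreal (f1 / g1) (by rw [map_div₀, eq_div_iff hg1', ← sub_eq_zero, h3])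
  · refine htx ?_
    have : t = (algebraMap ℝ L f0 - x * algebraMap ℝ L g0) /
        (x * algebraMap ℝ L g1 - algebraMap ℝ L f1) := by
      rw [eq_div_iff h3]; linear_combination hxg
    rw [this]
    have hx' := IntermediateField.mem_adjoin_simple_self ℝ x
    have ha := fun r => (IntermediateField.adjoin ℝ {x}).algebraMap_mem r
    exact div_mem (sub_mem (ha _) (mul_mem hx' (ha _))) (sub_mem (mul_mem hx' (ha _)) (ha _))

/-- Since `t ∉ F`, no nonzero linear polynomial over `F` annihilates `t`; eliminating the leading or
the constant terms from the two quadratics shows that they are proportional. -/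
theorem proportional_of_not_mem {F : IntermediateField ℝ L} {t : L} (ht : t ∉ F)
    {u v w u' v' w' : L} (hu : u ∈ F) (hv : v ∈ F) (hw : w ∈ F) (hu' : u' ∈ F) (hv' : v' ∈ F)
    (hw' : w' ∈ F) (h : u * t ^ 2 + v * t + w = 0) (h' : u' * t ^ 2 + v' * t + w' = 0) :
    u * v' = u' * v ∧ v * w' = v' * w := by
  have key : ∀ {x y : L}, x ∈ F → y ∈ F → x * t + y = 0 → x = 0 := by
    intro x y hx hy hxy
    by_contra h0
    have : t = -y / x := by rw [eq_div_iff h0]; linear_combination hxy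
    exact ht (this ▸ div_mem (neg_mem hy) hx)
  have ht0 : t ≠ 0 := fun h0 => ht (h0 ▸ zero_mem F)
  constructor
  · have := key (sub_mem (mul_mem hu hv') (mul_mem hu' hv))
      (sub_mem (mul_mem hu hw') (mul_mem hu' hw)) (by linear_combination u * h' - u' * h)
    exact sub_eq_zero.1 this
  · have h1 : (w' * u - w * u') * t + (w' * v - w * v') = 0 := by
      refine mul_left_cancel₀ ht0 ?_
      linear_combination w' * h - w * h'
    have h2 := key (sub_mem (mul_mem hw' hu) (mul_mem hw hu'))
      (sub_mem (mul_mem hw' hv) (mul_mem hw hv')) h1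
    rw [h2] at h1
    linear_combination h1

/-- Without `a` or without `d` the relation could be solved for `t` rationally in `x`. -/
theorem ne_zero_of_kite {t x : L} (ht : t ≠ 0)
    (htx : t ∉ IntermediateField.adjoin ℝ {x}) {a c d : ℝ} (hc : c ≠ 0)
    (h : x * (algebraMap ℝ L a * t ^ 2 + algebraMap ℝ L d) = -2 * algebraMap ℝ L c * t) :
    a ≠ 0 ∧ d ≠ 0 := by
  have hx' := IntermediateField.mem_adjoin_simple_self ℝ x
  have hF := fun r => (IntermediateField.adjoin ℝ {x}).algebraMap_mem r
  have hc' : algebraMap ℝ L (-2 * c) ≠ 0 := by simpa using hc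
  constructor
  · rintro rfl
    have : t = x * algebraMap ℝ L d / algebraMap ℝ L (-2 * c) := by
      rw [eq_div_iff hc']; simp only [map_zero, map_mul, map_neg, map_ofNat] at h ⊢; linear_combination -h
    exact htx (this ▸ div_mem (mul_mem hx' (hF _)) (hF _))
  · rintro rfl
    have h1 : t * (x * algebraMap ℝ L a) = algebraMap ℝ L (-2 * c) := by
      refine mul_left_cancel₀ ht ?_
      simp only [map_zero, map_mul, map_neg, map_ofNat] at h ⊢; linear_combination h
    have ha : x * algebraMap ℝ L a ≠ 0 := fun h0 => hc' (by rw [← h1, h0, mul_zero])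
    exact htx (eq_div_of_mul_eq ha h1 ▸ div_mem (hF _) (mul_mem hx' (hF _)))

/-- Passing from `x` to `x⁻¹` turns this relation into that of `ne_zero_of_kite`. -/
theorem ne_zero_of_antikite {t x : L} (hx : x ≠ 0) (ht : t ≠ 0)
    (htx : t ∉ IntermediateField.adjoin ℝ {x}) {b c e : ℝ} (hc : c ≠ 0)
    (h : algebraMap ℝ L b * t ^ 2 + algebraMap ℝ L e = -2 * algebraMap ℝ L c * t * x) :
    b ≠ 0 ∧ e ≠ 0 := by
  refine ne_zero_of_kite (x := x⁻¹) ht (fun h0 => htx ?_) hc ?_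
  · refine IntermediateField.adjoin_le_iff.2 ?_ h0
    simpa using inv_mem (IntermediateField.mem_adjoin_simple_self ℝ x)
  · rw [h]; field_simp

/-! ### Three generators with pairwise biquadratic relations -/

section Triple

variable {t₁ t₂ t₃ : L} {A₁ B₁ C₁ D₁ E₁ A₂ B₂ C₂ D₂ E₂ A₃ B₃ C₃ D₃ E₃ : ℝ}

/-- The excluded equation is what elimination of `t₃` from two relations of the same type would
give. As a quadratic equation for `t₂` over `ℝ(t₁)` it would be proportional to `h3`; comparing
coefficients gives `A₃ = D₃ = 0` and then `C₂ a C₃ = 0`. -/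
theorem biquadratic_ne_of_same_type (h1 : Transcendental ℝ t₁)
    (h21 : t₂ ∉ IntermediateField.adjoin ℝ {t₁}) {a b d e : ℝ} (ha : a ≠ 0) (hb : b ≠ 0)
    (hd : d ≠ 0) (hC₁ : C₁ ≠ 0) (hC₂ : C₂ ≠ 0) (hC₃ : C₃ ≠ 0)
    (h3 : (algebraMap ℝ L A₃ * t₁ ^ 2 + algebraMap ℝ L D₃) * t₂ ^ 2 +
      2 * algebraMap ℝ L C₃ * t₁ * t₂ + (algebraMap ℝ L B₃ * t₁ ^ 2 + algebraMap ℝ L E₃) = 0) :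
    algebraMap ℝ L C₂ * t₁ * (algebraMap ℝ L a * t₂ ^ 2 + algebraMap ℝ L e) ≠
      algebraMap ℝ L C₁ * t₂ * (algebraMap ℝ L b * t₁ ^ 2 + algebraMap ℝ L d) := by
  intro h
  have ht := IntermediateField.mem_adjoin_simple_self ℝ t₁
  have hF := fun r => (IntermediateField.adjoin ℝ {t₁}).algebraMap_mem r
  have h2 : (2 : L) ∈ IntermediateField.adjoin ℝ {t₁} := ofNat_mem _ 2
  obtain ⟨hp, -⟩ := proportional_of_not_mem h21 (u := algebraMap ℝ L C₂ * algebraMap ℝ L a * t₁)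
    (v := -(algebraMap ℝ L C₁ * (algebraMap ℝ L b * t₁ ^ 2 + algebraMap ℝ L d)))
    (w := algebraMap ℝ L C₂ * algebraMap ℝ L e * t₁)
    (mul_mem (mul_mem (hF _) (hF _)) ht)
    (neg_mem (mul_mem (hF _) (add_mem (mul_mem (hF _) (pow_mem ht 2)) (hF _))))
    (mul_mem (mul_mem (hF _) (hF _)) ht)
    (add_mem (mul_mem (hF _) (pow_mem ht 2)) (hF _)) (mul_mem (mul_mem h2 (hF _)) ht)
    (add_mem (mul_mem (hF _) (pow_mem ht 2)) (hF _)) (by linear_combination h) h3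
  obtain ⟨e4, -, e2, -, e0⟩ := coeff_eq_zero_of_transcendental h1 (a := A₃ * C₁ * b) (b := 0)
    (c := 2 * C₂ * a * C₃ + C₁ * (A₃ * d + D₃ * b)) (d := 0) (e := D₃ * C₁ * d) (by
      simp only [map_add, map_mul, map_zero, map_ofNat]
      linear_combination hp)
  have hA : A₃ = 0 := by simpa [hC₁, hb] using e4
  have hD : D₃ = 0 := by simpa [hC₁, hd] using e0
  rw [hA, hD] at e2
  have : C₂ * a * C₃ = 0 := by linarith
  simp [hC₂, ha, hC₃] at this

/-- Of the two relations that contain `t₃`, one is of the kite and one of the antikite type. -/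
theorem kite_antikite (h1 : Transcendental ℝ t₁) (h2 : Transcendental ℝ t₂) (h3 : t₃ ≠ 0)
    (h31 : t₃ ∈ IntermediateField.adjoin ℝ {t₁}) (h32 : t₃ ∈ IntermediateField.adjoin ℝ {t₂})
    (h13 : t₁ ∉ IntermediateField.adjoin ℝ {t₃}) (h23 : t₂ ∉ IntermediateField.adjoin ℝ {t₃})
    (h21 : t₂ ∉ IntermediateField.adjoin ℝ {t₁}) (hC₁ : C₁ ≠ 0) (hC₂ : C₂ ≠ 0) (hC₃ : C₃ ≠ 0)
    (r1 : (algebraMap ℝ L A₁ * t₂ ^ 2 + algebraMap ℝ L D₁) * t₃ ^ 2 +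
      2 * algebraMap ℝ L C₁ * t₂ * t₃ + (algebraMap ℝ L B₁ * t₂ ^ 2 + algebraMap ℝ L E₁) = 0)
    (r2 : (algebraMap ℝ L A₂ * t₁ ^ 2 + algebraMap ℝ L D₂) * t₃ ^ 2 +
      2 * algebraMap ℝ L C₂ * t₁ * t₃ + (algebraMap ℝ L B₂ * t₁ ^ 2 + algebraMap ℝ L E₂) = 0)
    (r3 : (algebraMap ℝ L A₃ * t₁ ^ 2 + algebraMap ℝ L D₃) * t₂ ^ 2 +
      2 * algebraMap ℝ L C₃ * t₁ * t₂ + (algebraMap ℝ L B₃ * t₁ ^ 2 + algebraMap ℝ L E₃) = 0) :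
    (A₁ = 0 ∧ D₁ = 0 ∧ B₂ = 0 ∧ E₂ = 0) ∨ (B₁ = 0 ∧ E₁ = 0 ∧ A₂ = 0 ∧ D₂ = 0) := by
  have ht1 := transcendental_ne_zero h1
  have ht2 := transcendental_ne_zero h2
  rcases biquadratic_degenerate h2 h32 h23 hC₁ r1 with ⟨rfl, rfl⟩ | ⟨rfl, rfl⟩ <;>
    rcases biquadratic_degenerate h1 h31 h13 hC₂ r2 with ⟨rfl, rfl⟩ | ⟨rfl, rfl⟩
  -- Two antikites; the case of two kites is the last one. In both, `t₃` cancels from the quotient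
  -- of the two relations.
  · have e1 : algebraMap ℝ L B₁ * t₂ ^ 2 + algebraMap ℝ L E₁ =
        -2 * algebraMap ℝ L C₁ * t₂ * t₃ := by
      simp only [map_zero] at r1; linear_combination r1
    have e2 : algebraMap ℝ L B₂ * t₁ ^ 2 + algebraMap ℝ L E₂ =
        -2 * algebraMap ℝ L C₂ * t₁ * t₃ := by
      simp only [map_zero] at r2; linear_combination r2
    have n1 := ne_zero_of_antikite h3 ht2 h23 hC₁ e1
    have n2 := ne_zero_of_antikite h3 ht1 h13 hC₂ e2
    refine absurd ?_ (biquadratic_ne_of_same_type (e := E₁) h1 h21 n1.1 n2.1 n2.2 hC₁ hC₂ hC₃ r3)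
    rw [e1, e2]; ring
  · exact .inl ⟨rfl, rfl, rfl, rfl⟩
  · exact .inr ⟨rfl, rfl, rfl, rfl⟩
  · have e1 : t₃ * (algebraMap ℝ L A₁ * t₂ ^ 2 + algebraMap ℝ L D₁) =
        -2 * algebraMap ℝ L C₁ * t₂ := by
      refine mul_left_cancel₀ h3 ?_
      simp only [map_zero] at r1; linear_combination r1
    have e2 : t₃ * (algebraMap ℝ L A₂ * t₁ ^ 2 + algebraMap ℝ L D₂) =
        -2 * algebraMap ℝ L C₂ * t₁ := by
      refine mul_left_cancel₀ h3 ?_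
      simp only [map_zero] at r2; linear_combination r2
    have n1 := ne_zero_of_kite ht2 h23 hC₁ e1
    have n2 := ne_zero_of_kite ht1 h13 hC₂ e2
    refine absurd ?_ (biquadratic_ne_of_same_type (e := D₁) h1 h21 n1.1 n2.1 n2.2 hC₁ hC₂ hC₃ r3)
    refine mul_left_cancel₀ h3 ?_
    linear_combination algebraMap ℝ L C₂ * t₁ * e1 - algebraMap ℝ L C₁ * t₂ * e2

/-- Eliminating `t₃` from a kite and an antikite gives the third relation up to a factor. -/
theorem kite_antikite_proportional (h1 : Transcendental ℝ t₁) (h2 : Transcendental ℝ t₂)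
    (h3 : t₃ ≠ 0) (h13 : t₁ ∉ IntermediateField.adjoin ℝ {t₃})
    (h23 : t₂ ∉ IntermediateField.adjoin ℝ {t₃}) (h21 : t₂ ∉ IntermediateField.adjoin ℝ {t₁})
    (hC₁ : C₁ ≠ 0) (hC₂ : C₂ ≠ 0)
    (r1 : 2 * algebraMap ℝ L C₁ * t₂ * t₃ +
      (algebraMap ℝ L B₁ * t₂ ^ 2 + algebraMap ℝ L E₁) = 0)
    (r2 : (algebraMap ℝ L A₂ * t₁ ^ 2 + algebraMap ℝ L D₂) * t₃ ^ 2 +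
      2 * algebraMap ℝ L C₂ * t₁ * t₃ = 0)
    (r3 : (algebraMap ℝ L A₃ * t₁ ^ 2 + algebraMap ℝ L D₃) * t₂ ^ 2 +
      2 * algebraMap ℝ L C₃ * t₁ * t₂ + (algebraMap ℝ L B₃ * t₁ ^ 2 + algebraMap ℝ L E₃) = 0) :
    (B₁ ≠ 0 ∧ E₁ ≠ 0) ∧ (A₂ ≠ 0 ∧ D₂ ≠ 0) ∧
      -2 * C₁ * C₂ * A₃ = C₃ * A₂ * B₁ ∧ -2 * C₁ * C₂ * B₃ = C₃ * A₂ * E₁ ∧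
      -2 * C₁ * C₂ * D₃ = C₃ * D₂ * B₁ ∧ -2 * C₁ * C₂ * E₃ = C₃ * D₂ * E₁ := by
  have ht1 := transcendental_ne_zero h1
  have ht2 := transcendental_ne_zero h2
  have e1 : algebraMap ℝ L B₁ * t₂ ^ 2 + algebraMap ℝ L E₁ =
      -2 * algebraMap ℝ L C₁ * t₂ * t₃ := by linear_combination r1
  have e2 : t₃ * (algebraMap ℝ L A₂ * t₁ ^ 2 + algebraMap ℝ L D₂) =
      -2 * algebraMap ℝ L C₂ * t₁ := by
    refine mul_left_cancel₀ h3 ?_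
    linear_combination r2
  refine ⟨ne_zero_of_antikite h3 ht2 h23 hC₁ e1, ne_zero_of_kite ht1 h13 hC₂ e2, ?_⟩
  have ht := IntermediateField.mem_adjoin_simple_self ℝ t₁
  have hF := fun r => (IntermediateField.adjoin ℝ {t₁}).algebraMap_mem r
  have hn : ∀ r : ℕ, (r : L) ∈ IntermediateField.adjoin ℝ {t₁} := fun r => natCast_mem _ r
  have hq : ∀ a b, algebraMap ℝ L a * t₁ ^ 2 + algebraMap ℝ L b ∈ IntermediateField.adjoin ℝ {t₁} :=
    fun a b => add_mem (mul_mem (hF _) (pow_mem ht 2)) (hF _)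
  -- Substituting `e2` into `e1`, multiplied by the factor of `t₃`, gives a quadratic equation for
  -- `t₂` over `ℝ(t₁)`, which must be proportional to `r3`. Transcendence of `t₁` then allows
  -- coefficients to be compared.
  obtain ⟨hp, hp'⟩ := proportional_of_not_mem h21
    (u := (algebraMap ℝ L A₂ * t₁ ^ 2 + algebraMap ℝ L D₂) * algebraMap ℝ L B₁)
    (v := algebraMap ℝ L (-4 * C₁ * C₂) * t₁)
    (w := (algebraMap ℝ L A₂ * t₁ ^ 2 + algebraMap ℝ L D₂) * algebraMap ℝ L E₁)
    (u' := algebraMap ℝ L A₃ * t₁ ^ 2 + algebraMap ℝ L D₃)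
    (v' := algebraMap ℝ L (2 * C₃) * t₁)
    (w' := algebraMap ℝ L B₃ * t₁ ^ 2 + algebraMap ℝ L E₃)
    (mul_mem (hq _ _) (hF _)) (mul_mem (hF _) ht) (mul_mem (hq _ _) (hF _)) (hq _ _)
    (mul_mem (hF _) ht) (hq _ _)
    (by
      simp only [map_mul, map_neg, map_ofNat]
      linear_combination (algebraMap ℝ L A₂ * t₁ ^ 2 + algebraMap ℝ L D₂) * e1 -
        2 * algebraMap ℝ L C₁ * t₂ * e2)
    (by
      simp only [map_mul, map_ofNat]
      linear_combination r3)
  simp only [map_mul, map_neg, map_ofNat] at hp hp'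
  obtain ⟨-, a3, -, a1, -⟩ := coeff_eq_zero_of_transcendental h1 (a := 0)
    (b := 2 * C₃ * A₂ * B₁ + 4 * C₁ * C₂ * A₃) (c := 0)
    (d := 2 * C₃ * D₂ * B₁ + 4 * C₁ * C₂ * D₃) (e := 0) (by
      simp only [map_add, map_mul, map_zero, map_ofNat]
      linear_combination hp)
  obtain ⟨-, b3, -, b1, -⟩ := coeff_eq_zero_of_transcendental h1 (a := 0)
    (b := 2 * C₃ * A₂ * E₁ + 4 * C₁ * C₂ * B₃) (c := 0)
    (d := 2 * C₃ * D₂ * E₁ + 4 * C₁ * C₂ * E₃) (e := 0) (by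
      simp only [map_add, map_mul, map_zero, map_ofNat]
      linear_combination -hp')
  exact ⟨by linarith, by linarith, by linarith, by linarith⟩

end Triple

end Biquadratic

/-! ### The coefficients of the relations in terms of trigonometric functions -/

section BricardCoefficients

open Real

def bricardA (α β γ δ : ℝ) : ℝ := cos γ - cos (α + β + δ)
def bricardB (α β γ δ : ℝ) : ℝ := cos γ - cos (α - β + δ)
def bricardC (β δ : ℝ) : ℝ := -2 * sin β * sin δ
def bricardD (α β γ δ : ℝ) : ℝ := cos γ - cos (α + β - δ)
def bricardE (α β γ δ : ℝ) : ℝ := cos γ - cos (α - β - δ)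

/-- `B - E = 2 sin (α - β) sin δ`, so `α` and `β` have equal sine and cosine, and then `B = cos γ -
cos δ`: the adjacent sides of the quadrilateral are equal in pairs. -/
theorem kite_cos {α β γ δ : ℝ} (hα : 0 < sin α) (hβ : 0 < sin β) (hδ : 0 < sin δ)
    (hB : bricardB α β γ δ = 0) (hE : bricardE α β γ δ = 0) :
    cos β = cos α ∧ sin β = sin α ∧ cos γ = cos δ := by
  simp only [bricardB, bricardE, cos_add, cos_sub, sin_sub] at hB hE
  have h1 : sin α * cos β - cos α * sin β = 0 := by
    refine (mul_eq_zero.1 (?_ : sin δ * _ = 0)).resolve_left hδ.ne'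
    linear_combination (hB - hE) / 2
  have h2 : sin β = sin α := by
    refine (sq_eq_sq₀ hβ.le hα.le).1 ?_
    have ha := sin_sq_add_cos_sq α
    have hb := sin_sq_add_cos_sq β
    linear_combination (-(sin α * cos β + cos α * sin β)) * h1 + sin α ^ 2 * hb - sin β ^ 2 * ha
  have h3 : cos β = cos α := by
    refine mul_left_cancel₀ hα.ne' ?_
    rw [h2] at h1
    linear_combination h1
  refine ⟨h3, h2, ?_⟩
  rw [h2, h3] at hB
  linear_combination hB + cos δ * sin_sq_add_cos_sq α

/-- Replacing the vertex where the sides `β` and `γ` meet with its antipode turns an antikite into a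
kite. -/
theorem antikite_cos {α β γ δ : ℝ} (hα : 0 < sin α) (hβ : 0 < sin β) (hδ : 0 < sin δ)
    (hA : bricardA α β γ δ = 0) (hD : bricardD α β γ δ = 0) :
    cos β = -cos α ∧ sin β = sin α ∧ cos γ = -cos δ := by
  have h := kite_cos (α := α) (β := π - β) (γ := π - γ) (δ := δ) hα (by simpa) hδ
    (by
      rw [bricardB, show α - (π - β) + δ = α + β + δ - π by ring, cos_sub_pi, cos_pi_sub]
      rw [bricardA] at hA
      linarith)
    (by
      rw [bricardE, show α - (π - β) - δ = α + β - δ - π by ring, cos_sub_pi, cos_pi_sub]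
      rw [bricardD] at hD
      linarith)
  simp only [cos_pi_sub, sin_pi_sub] at h
  exact ⟨by linarith [h.1], h.2.1, by linarith [h.2.2]⟩

/-- The consequences of the relations between the coefficients for a kite with angles
`α₂, β₂, γ₂, δ₂`, an antikite with angles `α₁, β₁, γ₁, δ₁` and a third quadrilateral. -/
theorem kite_antikite_cos {α₁ β₁ γ₁ δ₁ α₂ β₂ γ₂ δ₂ α₃ β₃ γ₃ δ₃ : ℝ} (hα₁ : 0 < sin α₁)
    (hβ₁ : 0 < sin β₁) (hδ₁ : 0 < sin δ₁) (hα₂ : 0 < sin α₂) (hβ₂ : 0 < sin β₂) (hδ₂ : 0 < sin δ₂)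
    (hβ₃ : 0 < sin β₃) (hδ₃ : 0 < sin δ₃)
    (hA₁ : bricardA α₁ β₁ γ₁ δ₁ = 0) (hD₁ : bricardD α₁ β₁ γ₁ δ₁ = 0)
    (hB₂ : bricardB α₂ β₂ γ₂ δ₂ = 0) (hE₂ : bricardE α₂ β₂ γ₂ δ₂ = 0)
    (hB₁ : bricardB α₁ β₁ γ₁ δ₁ ≠ 0) (hE₁ : bricardE α₁ β₁ γ₁ δ₁ ≠ 0)
    (hA₂ : bricardA α₂ β₂ γ₂ δ₂ ≠ 0) (hD₂ : bricardD α₂ β₂ γ₂ δ₂ ≠ 0)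
    (hA₃ : -2 * bricardC β₁ δ₁ * bricardC β₂ δ₂ * bricardA α₃ β₃ γ₃ δ₃ =
      bricardC β₃ δ₃ * bricardA α₂ β₂ γ₂ δ₂ * bricardB α₁ β₁ γ₁ δ₁)
    (hB₃ : -2 * bricardC β₁ δ₁ * bricardC β₂ δ₂ * bricardB α₃ β₃ γ₃ δ₃ =
      bricardC β₃ δ₃ * bricardA α₂ β₂ γ₂ δ₂ * bricardE α₁ β₁ γ₁ δ₁)
    (hD₃ : -2 * bricardC β₁ δ₁ * bricardC β₂ δ₂ * bricardD α₃ β₃ γ₃ δ₃ =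
      bricardC β₃ δ₃ * bricardD α₂ β₂ γ₂ δ₂ * bricardB α₁ β₁ γ₁ δ₁)
    (hE₃ : -2 * bricardC β₁ δ₁ * bricardC β₂ δ₂ * bricardE α₃ β₃ γ₃ δ₃ =
      bricardC β₃ δ₃ * bricardD α₂ β₂ γ₂ δ₂ * bricardE α₁ β₁ γ₁ δ₁) :
    (cos α₁ ^ 2 ≠ cos δ₁ ^ 2 ∧ cos α₂ ^ 2 ≠ cos δ₂ ^ 2) ∧ cos α₃ = -(cos α₁ * cos α₂) ∧
      sin α₃ * cos δ₃ * sin δ₂ = -(sin δ₃ * cos α₁ * sin α₂ * cos δ₂) ∧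
      sin α₃ * cos β₃ * sin δ₁ = -(sin β₃ * cos α₂ * sin α₁ * cos δ₁) ∧
      (cos γ₃ - cos α₃ * cos β₃ * cos δ₃) * sin δ₁ * sin δ₂ =
        -(sin β₃ * sin δ₃ * sin α₁ * sin α₂ * cos δ₁ * cos δ₂) := by
  obtain ⟨c1, s1, g1⟩ := antikite_cos hα₁ hβ₁ hδ₁ hA₁ hD₁
  obtain ⟨c2, s2, g2⟩ := kite_cos hα₂ hβ₂ hδ₂ hB₂ hE₂
  have p1 := sin_sq_add_cos_sq α₁
  have p2 := sin_sq_add_cos_sq α₂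
  have d1 := sin_sq_add_cos_sq δ₁
  have d2 := sin_sq_add_cos_sq δ₂
  have eA : bricardA α₂ β₂ γ₂ δ₂ = 2 * sin α₂ * (sin α₂ * cos δ₂ + cos α₂ * sin δ₂) := by
    simp only [bricardA, cos_add, sin_add, c2, s2, g2]
    linear_combination -cos δ₂ * p2
  have eD : bricardD α₂ β₂ γ₂ δ₂ = 2 * sin α₂ * (sin α₂ * cos δ₂ - cos α₂ * sin δ₂) := by
    simp only [bricardD, cos_add, cos_sub, sin_add, c2, s2, g2]
    linear_combination -cos δ₂ * p2
  have eB : bricardB α₁ β₁ γ₁ δ₁ = -2 * sin α₁ * (sin α₁ * cos δ₁ + cos α₁ * sin δ₁) := by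
    simp only [bricardB, cos_add, cos_sub, sin_sub, c1, s1, g1]
    linear_combination cos δ₁ * p1
  have eE : bricardE α₁ β₁ γ₁ δ₁ = -2 * sin α₁ * (sin α₁ * cos δ₁ - cos α₁ * sin δ₁) := by
    simp only [bricardE, cos_sub, sin_sub, c1, s1, g1]
    linear_combination cos δ₁ * p1
  -- `B₁ E₁ = 4 sin² α₁ (cos² δ₁ - cos² α₁)` and `A₂ D₂ = 4 sin² α₂ (cos² δ₂ - cos² α₂)`.
  refine ⟨⟨fun h => ?_, fun h => ?_⟩, ?_⟩
  · refine mul_ne_zero hB₁ hE₁ ?_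
    rw [eB, eE]
    linear_combination 4 * sin α₁ ^ 2 * (cos δ₁ ^ 2 * p1 - cos α₁ ^ 2 * d1 - h)
  · refine mul_ne_zero hA₂ hD₂ ?_
    rw [eA, eD]
    linear_combination 4 * sin α₂ ^ 2 * (cos δ₂ ^ 2 * p2 - cos α₂ ^ 2 * d2 - h)
  rw [eA, eB] at hA₃
  rw [eA, eE] at hB₃
  rw [eD, eB] at hD₃
  rw [eD, eE] at hE₃
  have hne : sin β₃ * sin δ₃ * sin α₁ * sin α₂ * sin δ₁ * sin δ₂ ≠ 0 := by positivity
  simp only [bricardC, bricardA, bricardB, bricardD, bricardE, cos_add, cos_sub, sin_add, sin_sub,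
    s1, s2] at hA₃ hB₃ hD₃ hE₃
  -- Each of the four signed sums of the third coefficients isolates the part of `cos (α₃ ± β₃ ±
  -- δ₃)` of one parity in `β₃` and in `δ₃`.
  refine ⟨?_, ?_, ?_, ?_⟩
  · refine mul_left_cancel₀ hne ?_
    linear_combination -(hA₃ - hB₃ - hD₃ + hE₃) / 32
  · refine mul_left_cancel₀ (a := sin α₁ * sin α₂ * sin δ₁ * sin β₃) (by positivity) ?_
    linear_combination -(hA₃ - hB₃ + hD₃ - hE₃) / 32
  · refine mul_left_cancel₀ (a := sin α₁ * sin α₂ * sin δ₂ * sin δ₃) (by positivity) ?_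
    linear_combination -(hA₃ + hB₃ - hD₃ - hE₃) / 32
  · refine mul_left_cancel₀ (a := sin α₁ * sin α₂) (by positivity) ?_
    linear_combination -(hA₃ + hB₃ + hD₃ + hE₃) / 32

end BricardCoefficients

/-! ### Angles of spherical triangles in terms of inner products -/

section TriangleAngles

/-- The sine of the distance of two points of the sphere. -/
def sinDist (u v : E4) : ℝ := √(1 - inner ℝ u v ^ 2)

/-- The Gram determinant of three unit vectors. -/
def gramDet (u v w : E4) : ℝ :=
  1 - inner ℝ u v ^ 2 - inner ℝ u w ^ 2 - inner ℝ v w ^ 2 +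
    2 * inner ℝ u v * inner ℝ u w * inner ℝ v w

/-- The cosine of the angle at `u` of the spherical triangle `u v w`. -/
def cosAngle (u v w : E4) : ℝ :=
  (inner ℝ v w - inner ℝ u v * inner ℝ u w) / (sinDist u v * sinDist u w)

/-- The sine of the angle at `u` of the spherical triangle `u v w`. -/
def sinAngle (u v w : E4) : ℝ := √(gramDet u v w) / (sinDist u v * sinDist u w)

theorem sinDist_comm (u v : E4) : sinDist u v = sinDist v u := by
  rw [sinDist, sinDist, real_inner_comm]

theorem gramDet_comm (u v w : E4) : gramDet u v w = gramDet v u w := by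
  rw [gramDet, gramDet, real_inner_comm u v]; ring

theorem gramDet_comm' (u v w : E4) : gramDet u v w = gramDet u w v := by
  rw [gramDet, gramDet, real_inner_comm w v]; ring

theorem cosAngle_comm (u v w : E4) : cosAngle u v w = cosAngle u w v := by
  rw [cosAngle, cosAngle, real_inner_comm w v, mul_comm (inner ℝ u v), mul_comm (sinDist u v)]

theorem sinAngle_comm (u v w : E4) : sinAngle u v w = sinAngle u w v := by
  rw [sinAngle, sinAngle, gramDet_comm', mul_comm (sinDist u v)]

theorem gramDet_pos {u v w : S3} (h : LinearIndependent ℝ ![(u : E4), v, w]) :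
    0 < gramDet u v w := by
  have h1 := (Matrix.posDef_gram_of_linearIndependent (𝕜 := ℝ) h).det_pos
  rw [Matrix.det_fin_three] at h1
  simp only [Matrix.gram_apply, Matrix.cons_val, inner_self_S3, real_inner_comm (u : E4) v,
    real_inner_comm (u : E4) w, real_inner_comm (v : E4) w] at h1
  rw [gramDet]
  linarith

variable {u v w : S3}

theorem inner_sq_lt_one (h : 0 < gramDet u v w) : inner ℝ (u : E4) v ^ 2 < 1 := by
  have key : ∀ x y : S3, inner ℝ (x : E4) y ^ 2 ≤ 1 := fun x y => by
    have := real_inner_mul_inner_self_le (x : E4) y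
    rw [inner_self_S3, inner_self_S3] at this
    linarith
  refine lt_of_le_of_ne (key u v) fun h1 => ?_
  rw [gramDet] at h
  nlinarith [sq_nonneg (inner ℝ (v : E4) w - inner ℝ (u : E4) v * inner ℝ (u : E4) w)]

theorem sinDist_sq (h : 0 < gramDet u v w) : sinDist u v ^ 2 = 1 - inner ℝ (u : E4) v ^ 2 :=
  Real.sq_sqrt (by linarith [inner_sq_lt_one h])

theorem sinDist_pos (h : 0 < gramDet u v w) : 0 < sinDist u v :=
  Real.sqrt_pos.2 (by linarith [inner_sq_lt_one h])

theorem sinDist_eq_one {x y : E4} (h : inner ℝ x y = 0) : sinDist x y = 1 := by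
  rw [sinDist, h]; simp

theorem cosAngle_mul (h : 0 < gramDet u v w) : cosAngle u v w * (sinDist u v * sinDist u w) =
    inner ℝ (v : E4) w - inner ℝ (u : E4) v * inner ℝ (u : E4) w := by
  have h1 := sinDist_pos h
  have h2 := sinDist_pos (gramDet_comm' (u : E4) v w ▸ h)
  rw [cosAngle, div_mul_cancel₀ _ (by positivity)]

theorem sinAngle_mul (h : 0 < gramDet u v w) :
    sinAngle u v w * (sinDist u v * sinDist u w) = √(gramDet u v w) := by
  have h1 := sinDist_pos h
  have h2 := sinDist_pos (gramDet_comm' (u : E4) v w ▸ h)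
  rw [sinAngle, div_mul_cancel₀ _ (by positivity)]

theorem sinAngle_pos (h : 0 < gramDet u v w) : 0 < sinAngle u v w := by
  have h1 := sinDist_pos h
  have h2 := sinDist_pos (gramDet_comm' (u : E4) v w ▸ h)
  have h3 := Real.sqrt_pos.2 h
  rw [sinAngle]
  positivity

theorem sinAngle_sq_add_cosAngle_sq (h : 0 < gramDet u v w) :
    sinAngle u v w ^ 2 + cosAngle u v w ^ 2 = 1 := by
  have h1 := sinDist_pos h
  have h2 := sinDist_pos (gramDet_comm' (u : E4) v w ▸ h)
  have h3 := sinDist_sq h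
  have h4 := sinDist_sq (gramDet_comm' (u : E4) v w ▸ h)
  refine mul_right_cancel₀ (b := (sinDist u v * sinDist u w) ^ 2) (by positivity) ?_
  rw [add_mul, ← mul_pow, ← mul_pow, cosAngle_mul h, sinAngle_mul h, Real.sq_sqrt h.le, one_mul,
    mul_pow, h3, h4, gramDet]
  ring

theorem gramDet_rotate (u v w : E4) : gramDet u v w = gramDet v w u := by
  rw [gramDet_comm, gramDet_comm']

/-- By the dual spherical law of cosines, the cosine of the angle at `a₃` plus the product of the
other two is a multiple of `⟪a₁, a₂⟫`. -/
theorem inner_eq_zero_of_cosAngle {a₁ a₂ a₃ : S3} (h : 0 < gramDet a₁ a₂ a₃)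
    (hc : cosAngle a₃ a₂ a₁ = -(cosAngle a₁ a₃ a₂ * cosAngle a₂ a₃ a₁)) :
    inner ℝ (a₁ : E4) a₂ = 0 := by
  have g2 : 0 < gramDet a₂ a₃ a₁ := gramDet_rotate (a₁ : E4) a₂ a₃ ▸ h
  have g3 : 0 < gramDet a₃ a₁ a₂ := gramDet_rotate (a₂ : E4) a₃ a₁ ▸ g2
  rw [cosAngle_comm a₃, cosAngle_comm a₁] at hc
  have e1 := cosAngle_mul h
  have e2 := cosAngle_mul g2
  have e3 := cosAngle_mul g3
  have s12 := sinDist_sq h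
  rw [gramDet] at h
  simp only [real_inner_comm (a₁ : E4) a₂, real_inner_comm (a₁ : E4) a₃,
    real_inner_comm (a₂ : E4) a₃, sinDist_comm (a₂ : E4) a₁, sinDist_comm (a₃ : E4) a₁,
    sinDist_comm (a₃ : E4) a₂] at e1 e2 e3
  set x := inner ℝ (a₁ : E4) a₂
  set y := inner ℝ (a₁ : E4) a₃
  set z := inner ℝ (a₂ : E4) a₃
  refine (mul_eq_zero.1 (?_ : x * _ = 0)).resolve_right h.ne'
  have : (x - y * z) * sinDist a₁ a₂ ^ 2 = -((z - x * y) * (y - x * z)) := by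
    rw [← e1, show y - x * z = y - z * x by ring, ← e2, ← e3, hc]
    ring
  rw [s12] at this
  linear_combination this

/-- Put `X = ⟪b, a₂⟫`, `Y = ⟪b, a₃⟫`, `z = ⟪a₂, a₃⟫`. Since `a₁ ⟂ a₂`, clearing denominators turns
the hypothesis into `X - Y z = -z (Y - z X)`, that is, `X (1 - z²) = 0`. -/
theorem inner_eq_zero_of_sinAngle {a₁ a₂ a₃ b : S3} (h12 : inner ℝ (a₁ : E4) a₂ = 0)
    (h : 0 < gramDet a₁ a₂ a₃) (h' : 0 < gramDet b a₂ a₃)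
    (he : sinAngle a₃ a₂ a₁ * cosAngle a₃ b a₂ * sinAngle a₂ b a₃ =
      -(sinAngle a₃ b a₂ * cosAngle a₁ a₃ a₂ * sinAngle a₂ a₃ a₁ * cosAngle a₂ b a₃)) :
    inner ℝ (b : E4) a₂ = 0 := by
  have g2 : 0 < gramDet a₂ a₃ a₁ := gramDet_rotate (a₁ : E4) a₂ a₃ ▸ h
  have g3 : 0 < gramDet a₃ a₁ a₂ := gramDet_rotate (a₂ : E4) a₃ a₁ ▸ g2
  have g2' : 0 < gramDet a₂ a₃ b := gramDet_rotate (b : E4) a₂ a₃ ▸ h'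
  have g3' : 0 < gramDet a₃ b a₂ := gramDet_rotate (a₂ : E4) a₃ b ▸ g2'
  rw [sinAngle_comm a₃ a₂, cosAngle_comm a₁ a₃, cosAngle_comm a₂ b, sinAngle_comm a₂ b] at he
  have e1 := cosAngle_mul h
  have f2 := sinAngle_mul g2
  have f3 := sinAngle_mul g3
  have e2' := cosAngle_mul g2'
  have f2' := sinAngle_mul g2'
  have e3' := cosAngle_mul g3'
  have f3' := sinAngle_mul g3'
  rw [gramDet_rotate (b : E4), gramDet_rotate (a₂ : E4)] at h'
  rw [gramDet_rotate (a₁ : E4), gramDet_rotate (a₂ : E4)] at h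
  rw [gramDet_rotate (a₂ : E4)] at f2 f2'
  have hH := Real.sqrt_pos.2 h
  have hH' := Real.sqrt_pos.2 h'
  have hz := inner_sq_lt_one g2
  have hS : sinDist (a₁ : E4) a₂ = 1 := sinDist_eq_one h12
  simp only [real_inner_comm (a₂ : E4) a₃, sinDist_comm (a₂ : E4) a₁, sinDist_comm (a₃ : E4) a₁,
    sinDist_comm (a₃ : E4) a₂, real_inner_comm (b : E4) a₂, real_inner_comm (b : E4) a₃,
    sinDist_comm (a₂ : E4) b, sinDist_comm (a₃ : E4) b, h12, hS] at e1 f2 f3 e2' f2' e3' f3'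
  set H := √(gramDet a₃ a₁ a₂)
  set H' := √(gramDet a₃ b a₂)
  set X := inner ℝ (b : E4) a₂
  set Y := inner ℝ (b : E4) a₃
  set z := inner ℝ (a₂ : E4) a₃
  have key : H * (X - Y * z) * H' = -(H' * z * H * (Y - z * X)) := by
    rw [← e3', ← e2', show z = z - 0 * inner ℝ (a₁ : E4) a₃ by ring, ← e1]
    nth_rewrite 1 [← f3]
    nth_rewrite 1 [← f2']
    nth_rewrite 1 [← f3']
    nth_rewrite 1 [← f2]
    linear_combination sinDist a₁ a₃ * sinDist a₂ a₃ ^ 3 * sinDist b a₂ * sinDist b a₃ * he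
  have : X * (H * H' * (1 - z ^ 2)) = 0 := by linear_combination key
  refine (mul_eq_zero.1 this).resolve_right ?_
  have : 0 < 1 - z ^ 2 := by linarith
  positivity

/-- Let `y, z` and `y', z'` be the inner products of `c` and `d` with `a₁, a₂`. As `a₁ ⟂ a₂`, the
hypotheses say `y √(1 - z'²) = y' √(1 - z²)` and `z' √(1 - y²) = -z √(1 - y'²)`. Their squares give
`(y² - y'²) (1 - y² - z²) = 0`, where the second factor is the Gram determinant of `a₁, a₂, c`; the
signs follow from the unsquared equations. -/
theorem inner_eq_of_kite_antikite {a₁ a₂ c d : S3} (h12 : inner ℝ (a₁ : E4) a₂ = 0)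
    (hc : 0 < gramDet a₁ a₂ c) (hd : 0 < gramDet a₁ a₂ d)
    (h2 : cosAngle a₂ a₁ d = cosAngle a₂ c a₁) (h1 : cosAngle a₁ a₂ d = -cosAngle a₁ c a₂) :
    inner ℝ (a₁ : E4) d = inner ℝ (a₁ : E4) c ∧ inner ℝ (a₂ : E4) d = -inner ℝ (a₂ : E4) c := by
  have hc2 : 0 < gramDet a₂ a₁ c := gramDet_comm (a₁ : E4) a₂ c ▸ hc
  have hd2 : 0 < gramDet a₂ a₁ d := gramDet_comm (a₁ : E4) a₂ d ▸ hd
  have hS : sinDist (a₁ : E4) a₂ = 1 := sinDist_eq_one h12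
  have h21 : inner ℝ (a₂ : E4) a₁ = 0 := by rw [real_inner_comm, h12]
  rw [cosAngle_comm a₂ c] at h2
  rw [cosAngle_comm a₁ c] at h1
  have e1 := cosAngle_mul hd2
  have e2 := cosAngle_mul hc2
  have e3 := cosAngle_mul hd
  have e4 := cosAngle_mul hc
  have q1 : sinDist a₁ c ^ 2 = 1 - inner ℝ (a₁ : E4) c ^ 2 :=
    sinDist_sq (w := a₂) (gramDet_comm' (a₁ : E4) a₂ c ▸ hc)
  have q2 : sinDist a₁ d ^ 2 = 1 - inner ℝ (a₁ : E4) d ^ 2 :=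
    sinDist_sq (w := a₂) (gramDet_comm' (a₁ : E4) a₂ d ▸ hd)
  have q3 : sinDist a₂ c ^ 2 = 1 - inner ℝ (a₂ : E4) c ^ 2 :=
    sinDist_sq (w := a₁) (gramDet_comm' (a₂ : E4) a₁ c ▸ hc2)
  have q4 : sinDist a₂ d ^ 2 = 1 - inner ℝ (a₂ : E4) d ^ 2 :=
    sinDist_sq (w := a₁) (gramDet_comm' (a₂ : E4) a₁ d ▸ hd2)
  have n1 := sinDist_pos (w := a₂) (gramDet_comm' (a₁ : E4) a₂ c ▸ hc)
  have n2 := sinDist_pos (w := a₂) (gramDet_comm' (a₁ : E4) a₂ d ▸ hd)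
  have n3 := sinDist_pos (w := a₁) (gramDet_comm' (a₂ : E4) a₁ c ▸ hc2)
  have n4 := sinDist_pos (w := a₁) (gramDet_comm' (a₂ : E4) a₁ d ▸ hd2)
  rw [gramDet, h12] at hc
  simp only [sinDist_comm (a₂ : E4) a₁, h12, h21, hS, zero_mul, sub_zero, one_mul] at e1 e2 e3 e4
  set y := inner ℝ (a₁ : E4) c
  set y' := inner ℝ (a₁ : E4) d
  set z := inner ℝ (a₂ : E4) c
  set z' := inner ℝ (a₂ : E4) d
  have k1 : y * sinDist a₂ d = y' * sinDist a₂ c := by rw [← e1, ← e2, h2]; ring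
  have k2 : z' * sinDist a₁ c = -(z * sinDist a₁ d) := by rw [← e3, ← e4, h1]; ring
  have m1 : y ^ 2 * (1 - z' ^ 2) = y' ^ 2 * (1 - z ^ 2) := by
    rw [← q3, ← q4]; linear_combination (y * sinDist a₂ d + y' * sinDist a₂ c) * k1
  have m2 : z' ^ 2 * (1 - y ^ 2) = z ^ 2 * (1 - y' ^ 2) := by
    rw [← q1, ← q2]; linear_combination (z' * sinDist a₁ c - z * sinDist a₁ d) * k2
  have hy : y ^ 2 = y' ^ 2 := by
    have : (y ^ 2 - y' ^ 2) * (1 - y ^ 2 - z ^ 2) = 0 := by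
      linear_combination (1 - y ^ 2) * m1 + y ^ 2 * m2
    refine sub_eq_zero.1 ((mul_eq_zero.1 this).resolve_right ?_)
    intro h0
    linarith
  have hy1 : y ^ 2 < 1 := by linarith [sq_pos_of_pos n1]
  have hz : z' ^ 2 = z ^ 2 := by
    rw [← hy] at m2
    exact mul_right_cancel₀ (by linarith) m2
  have s1 : sinDist a₁ c = sinDist a₁ d := by
    rw [← sq_eq_sq₀ n1.le n2.le, q1, q2, hy]
  have s2 : sinDist a₂ c = sinDist a₂ d := by
    rw [← sq_eq_sq₀ n3.le n4.le, q3, q4, hz]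
  constructor
  · rw [s2] at k1
    exact (mul_right_cancel₀ n4.ne' k1).symm
  · rw [s1, ← neg_mul] at k2
    exact mul_right_cancel₀ n2.ne' k2

theorem inner_eq_of_cosAngle {a b c d : S3} (hab : inner ℝ (b : E4) a = 0)
    (hcd : inner ℝ (a : E4) d ^ 2 = inner ℝ (a : E4) c ^ 2) (hc : 0 < gramDet a b c)
    (hd : 0 < gramDet a d b) {ε : ℝ} (h : cosAngle a d b = ε * cosAngle a b c) :
    inner ℝ (b : E4) d = ε * inner ℝ (b : E4) c := by
  have e1 := cosAngle_mul hc
  have e2 := cosAngle_mul hd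
  have hS : sinDist (a : E4) d = sinDist (a : E4) c := by rw [sinDist, sinDist, hcd]
  rw [real_inner_comm (b : E4) a, hab] at e1
  rw [real_inner_comm (b : E4) d, real_inner_comm (b : E4) a, hab, h, hS] at e2
  linear_combination ε * e1 - e2

/-- The last orthogonality. With `y, z` the inner products of `c` with `a₁, a₂`, after clearing
denominators and inserting `gramDet c a₁ a₂ = 1 - y² - z²`, all terms cancel except a multiple of
`⟪b₁, b₂⟫ (1 - y²) (1 - z²)`. -/
theorem inner_eq_zero_of_quadrilateral {a₁ a₂ c b₁ b₂ : S3} (h12 : inner ℝ (a₁ : E4) a₂ = 0)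
    (hb₁ : inner ℝ (b₁ : E4) a₂ = 0) (hb₂ : inner ℝ (b₂ : E4) a₁ = 0) (h : 0 < gramDet c a₁ a₂)
    (h₁ : 0 < gramDet c b₁ a₂) (h₂ : 0 < gramDet c b₂ a₁) (h₃ : 0 < gramDet c b₂ b₁)
    (he : (cosAngle c b₂ b₁ - cosAngle c a₂ a₁ * cosAngle c a₁ b₂ * cosAngle c b₁ a₂) *
        sinAngle a₁ b₂ c * sinAngle a₂ b₁ c =
      -(sinAngle c a₁ b₂ * sinAngle c b₁ a₂ * sinAngle a₁ c a₂ * sinAngle a₂ c a₁ *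
        cosAngle a₁ b₂ c * cosAngle a₂ b₁ c)) :
    inner ℝ (b₁ : E4) b₂ = 0 := by
  have hH := Real.sqrt_pos.2 h
  have hH₁ := Real.sqrt_pos.2 h₁
  have hH₂ := Real.sqrt_pos.2 h₂
  have g1 : 0 < gramDet a₁ a₂ c := gramDet_rotate (c : E4) a₁ a₂ ▸ h
  have g2 : 0 < gramDet a₂ c a₁ := gramDet_rotate (a₁ : E4) a₂ c ▸ g1
  have g4 : 0 < gramDet a₁ c b₂ := by rwa [gramDet_rotate (a₁ : E4)]
  have g5 : 0 < gramDet a₂ c b₁ := by rwa [gramDet_rotate (a₂ : E4)]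
  rw [cosAngle_comm c a₂ a₁, cosAngle_comm c a₁ b₂, sinAngle_comm a₁ b₂, sinAngle_comm a₂ b₁,
    sinAngle_comm c a₁, sinAngle_comm a₁ c a₂, cosAngle_comm a₁ b₂, cosAngle_comm a₂ b₁] at he
  have hS : sinDist (a₁ : E4) a₂ = 1 := sinDist_eq_one h12
  have hS₁ : sinDist (b₁ : E4) a₂ = 1 := sinDist_eq_one hb₁
  have hS₂ : sinDist (b₂ : E4) a₁ = 1 := sinDist_eq_one hb₂
  have q1 := sinDist_sq h
  have q2 := sinDist_sq (w := a₁) (gramDet_comm' (c : E4) a₁ a₂ ▸ h)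
  have n1 := sinDist_pos h
  have n2 := sinDist_pos (w := a₁) (gramDet_comm' (c : E4) a₁ a₂ ▸ h)
  have n3 := sinDist_pos h₁
  have n4 := sinDist_pos h₂
  have hHsq : √(gramDet c a₁ a₂) ^ 2 = 1 - inner ℝ (c : E4) a₁ ^ 2 - inner ℝ (c : E4) a₂ ^ 2 := by
    rw [Real.sq_sqrt h.le, gramDet, h12]; ring
  have e1 := cosAngle_mul h₃
  have e2 := cosAngle_mul h
  have e3 := cosAngle_mul h₂
  have e4 := cosAngle_mul h₁
  have e5 := cosAngle_mul g4
  have e6 := cosAngle_mul g5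
  have f1 := sinAngle_mul g4
  have f2 := sinAngle_mul g5
  have f3 := sinAngle_mul h₂
  have f4 := sinAngle_mul h₁
  have f5 := sinAngle_mul g1
  have f6 := sinAngle_mul g2
  rw [gramDet_rotate (a₁ : E4)] at f1
  rw [gramDet_rotate (a₂ : E4)] at f2 f6
  rw [gramDet_rotate (a₁ : E4), gramDet_rotate (a₂ : E4)] at f5
  simp only [real_inner_comm (b₁ : E4) b₂, real_inner_comm (c : E4) a₁, real_inner_comm (c : E4) a₂,
    real_inner_comm (b₂ : E4) a₁, real_inner_comm (b₁ : E4) a₂,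
    sinDist_comm (a₁ : E4) c, sinDist_comm (a₂ : E4) c, sinDist_comm (a₂ : E4) a₁,
    sinDist_comm (a₁ : E4) b₂, sinDist_comm (a₂ : E4) b₁, h12, hb₁, hb₂, hS, hS₁, hS₂, mul_one,
    one_mul, zero_sub, sub_zero, mul_zero] at e1 e2 e3 e4 e5 e6 f1 f2 f3 f4 f5 f6
  set y := inner ℝ (c : E4) a₁
  set z := inner ℝ (c : E4) a₂
  set v := inner ℝ (b₁ : E4) b₂
  set p := inner ℝ (c : E4) b₁
  set q := inner ℝ (c : E4) b₂
  set H := √(gramDet c a₁ a₂)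
  set H₁ := √(gramDet c b₁ a₂)
  set H₂ := √(gramDet c b₂ a₁)
  have key : (cosAngle c b₂ b₁ * (sinDist c b₂ * sinDist c b₁) *
        (sinDist c a₁ ^ 2 * sinDist c a₂ ^ 2) -
      cosAngle c a₁ a₂ * (sinDist c a₁ * sinDist c a₂) *
        (cosAngle c b₂ a₁ * (sinDist c b₂ * sinDist c a₁)) *
        (cosAngle c b₁ a₂ * (sinDist c b₁ * sinDist c a₂))) *
      (sinAngle a₁ c b₂ * sinDist c a₁) * (sinAngle a₂ c b₁ * sinDist c a₂) =
      -((sinAngle c b₂ a₁ * (sinDist c b₂ * sinDist c a₁)) *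
        (sinAngle c b₁ a₂ * (sinDist c b₁ * sinDist c a₂)) *
        (sinAngle a₁ a₂ c * sinDist c a₁) * (sinAngle a₂ c a₁ * sinDist c a₂) *
        (cosAngle a₁ c b₂ * sinDist c a₁) * (cosAngle a₂ c b₁ * sinDist c a₂)) := by
    linear_combination sinDist c a₁ ^ 3 * sinDist c a₂ ^ 3 * sinDist c b₁ * sinDist c b₂ * he
  rw [e1, e2, e3, e4, e5, e6, f1, f2, f3, f4, f5, f6, q1, q2] at key
  have : v * (H₁ * H₂ * ((1 - y ^ 2) * (1 - z ^ 2))) = 0 := by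
    linear_combination key - H₁ * H₂ * q * p * hHsq
  refine (mul_eq_zero.1 this).resolve_right ?_
  rw [← q1, ← q2]
  positivity

/-- An octahedron with orthogonal diagonals `a₁b₁` and `a₂b₂`, recovered from the angles of the
links of `a₁`, `a₂`, `a₃`. -/
theorem flexGram_of_angles {Q : OctV → S3}
    (hG : ∀ u v w : OctV, u.1 ≠ v.1 → u.1 ≠ w.1 → v.1 ≠ w.1 → 0 < gramDet (Q u) (Q v) (Q w))
    {a₁ b₁ a₂ b₂ a₃ b₃ : E4} (ha₁ : a₁ = Q (0, false)) (hb₁ : b₁ = Q (0, true))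
    (ha₂ : a₂ = Q (1, false)) (hb₂ : b₂ = Q (1, true)) (ha₃ : a₃ = Q (2, false))
    (hb₃ : b₃ = Q (2, true))
    (k1 : cosAngle a₂ a₁ b₃ = cosAngle a₂ a₃ a₁) (k2 : cosAngle a₂ b₃ b₁ = cosAngle a₂ b₁ a₃)
    (n1 : cosAngle a₁ a₂ b₃ = -cosAngle a₁ a₃ a₂) (n2 : cosAngle a₁ b₃ b₂ = -cosAngle a₁ b₂ a₃)
    (d1 : cosAngle a₁ a₃ a₂ ^ 2 ≠ cosAngle a₁ b₂ a₃ ^ 2)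
    (d2 : cosAngle a₂ a₃ a₁ ^ 2 ≠ cosAngle a₂ b₁ a₃ ^ 2)
    (r1 : cosAngle a₃ a₂ a₁ = -(cosAngle a₁ a₃ a₂ * cosAngle a₂ a₃ a₁))
    (r2 : sinAngle a₃ a₂ a₁ * cosAngle a₃ b₁ a₂ * sinAngle a₂ b₁ a₃ =
      -(sinAngle a₃ b₁ a₂ * cosAngle a₁ a₃ a₂ * sinAngle a₂ a₃ a₁ * cosAngle a₂ b₁ a₃))
    (r3 : sinAngle a₃ a₂ a₁ * cosAngle a₃ a₁ b₂ * sinAngle a₁ b₂ a₃ =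
      -(sinAngle a₃ a₁ b₂ * cosAngle a₂ a₃ a₁ * sinAngle a₁ a₃ a₂ * cosAngle a₁ b₂ a₃))
    (r4 : (cosAngle a₃ b₂ b₁ - cosAngle a₃ a₂ a₁ * cosAngle a₃ a₁ b₂ * cosAngle a₃ b₁ a₂) *
        sinAngle a₁ b₂ a₃ * sinAngle a₂ b₁ a₃ =
      -(sinAngle a₃ a₁ b₂ * sinAngle a₃ b₁ a₂ * sinAngle a₁ a₃ a₂ * sinAngle a₂ a₃ a₁ *
        cosAngle a₁ b₂ a₃ * cosAngle a₂ b₁ a₃)) :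
    ∃ p q : Bool → ℝ, FlexGram p q Q ∧ |p false| ≠ |p true| ∧ |q false| ≠ |q true| ∧
      ∀ i j, p i ^ 2 + q j ^ 2 < 1 := by
  subst ha₁ hb₁ ha₂ hb₂ ha₃ hb₃
  have h12 : inner ℝ (Q (0, false) : E4) (Q (1, false)) = 0 :=
    inner_eq_zero_of_cosAngle (hG _ _ _ (by decide) (by decide) (by decide)) r1
  have h12' : inner ℝ (Q (1, false) : E4) (Q (0, false)) = 0 := by rw [real_inner_comm, h12]
  have hb1 : inner ℝ (Q (0, true) : E4) (Q (1, false)) = 0 :=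
    inner_eq_zero_of_sinAngle h12 (hG _ _ _ (by decide) (by decide) (by decide))
      (hG _ _ _ (by decide) (by decide) (by decide)) r2
  have hb2 : inner ℝ (Q (1, true) : E4) (Q (0, false)) = 0 := by
    refine inner_eq_zero_of_sinAngle (a₃ := Q (2, false)) h12'
      (hG _ _ _ (by decide) (by decide) (by decide))
      (hG _ _ _ (by decide) (by decide) (by decide)) ?_
    rw [sinAngle_comm _ (Q (0, false) : E4), cosAngle_comm _ (Q (1, true) : E4) (Q (0, false)),
      sinAngle_comm _ (Q (1, true) : E4) (Q (0, false))]
    exact r3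
  have hb12 : inner ℝ (Q (0, true) : E4) (Q (1, true)) = 0 :=
    inner_eq_zero_of_quadrilateral h12 hb1 hb2 (hG _ _ _ (by decide) (by decide) (by decide))
      (hG _ _ _ (by decide) (by decide) (by decide)) (hG _ _ _ (by decide) (by decide) (by decide))
      (hG _ _ _ (by decide) (by decide) (by decide)) r4
  obtain ⟨hy, hz⟩ := inner_eq_of_kite_antikite h12
    (hG _ _ _ (by decide) (by decide) (by decide)) (hG _ _ _ (by decide) (by decide) (by decide))
    k1 n1
  have hp : inner ℝ (Q (0, true) : E4) (Q (2, true)) = 1 * inner ℝ (Q (0, true) : E4) (Q (2, false)) :=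
    inner_eq_of_cosAngle hb1 (by rw [hz, neg_sq]) (hG _ _ _ (by decide) (by decide) (by decide))
      (hG _ _ _ (by decide) (by decide) (by decide)) (by rw [one_mul, k2])
  have hq : inner ℝ (Q (1, true) : E4) (Q (2, true)) = -1 * inner ℝ (Q (1, true) : E4) (Q (2, false)) :=
    inner_eq_of_cosAngle hb2 (by rw [hy]) (hG _ _ _ (by decide) (by decide) (by decide))
      (hG _ _ _ (by decide) (by decide) (by decide)) (by rw [neg_one_mul, n2])
  rw [one_mul] at hp
  rw [neg_one_mul] at hq
  have hF : FlexGram (fun i => inner ℝ (Q (0, i) : E4) (Q (2, false)))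
      (fun j => inner ℝ (Q (1, j) : E4) (Q (2, false))) Q := by
    refine ⟨?_, ?_, fun _ => rfl, ?_⟩
    · rintro (_ | _) (_ | _)
      exacts [h12, by rw [real_inner_comm, hb2], hb1, hb12]
    · rintro (_ | _) (_ | _)
      exacts [rfl, hy, rfl, hp]
    · rintro (_ | _)
      exacts [hz, hq]
  -- At a vertex `a` orthogonal to `u` and `v`, the cosines of the two angles are `⟪u, c⟫` and `⟪v,
  -- c⟫` divided by the same sine.
  have habs : ∀ {u v a c : OctV} (_ : 0 < gramDet (Q a) (Q c) (Q u))
      (_ : 0 < gramDet (Q a) (Q v) (Q c)), inner ℝ (Q a : E4) (Q u) = 0 →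
      inner ℝ (Q a : E4) (Q v) = 0 →
      cosAngle (Q a) (Q c) (Q u) ^ 2 ≠ cosAngle (Q a) (Q v) (Q c) ^ 2 →
      |inner ℝ (Q u : E4) (Q c)| ≠ |inner ℝ (Q v : E4) (Q c)| := by
    intro u v a c g1 g2 hu hv hne h0
    refine hne ?_
    have e1 := cosAngle_mul g1
    have e2 := cosAngle_mul g2
    rw [sinDist_eq_one hu, hu, real_inner_comm, mul_zero, sub_zero, mul_one] at e1
    rw [sinDist_eq_one hv, hv, zero_mul, sub_zero, one_mul] at e2
    rw [← sq_eq_sq_iff_abs_eq_abs, ← e1, ← e2, mul_pow, mul_pow] at h0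
    exact mul_right_cancel₀ (pow_ne_zero 2 (sinDist_pos g1).ne') h0
  refine ⟨_, _, hF, ?_, ?_, fun i j => ?_⟩
  · exact habs (a := (1, false)) (hG _ _ _ (by decide) (by decide) (by decide))
      (hG _ _ _ (by decide) (by decide) (by decide)) h12' (by rw [real_inner_comm, hb1]) d2
  · exact habs (a := (0, false)) (hG _ _ _ (by decide) (by decide) (by decide))
      (hG _ _ _ (by decide) (by decide) (by decide)) h12 (by rw [real_inner_comm, hb2]) d1
  · have := hG (0, i) (1, j) (2, false) (show (0 : Fin 3) ≠ 1 by decide)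
      (show (0 : Fin 3) ≠ 2 by decide) (show (1 : Fin 3) ≠ 2 by decide)
    rw [gramDet, hF.fst_snd] at this
    linarith

end TriangleAngles

/-! ### Exotic flexible octahedra -/

theorem gramDet_pos_of_isNondegenerate {P : OctV → S3} (h : IsNondegenerate octahedron P)
    {u v w : OctV} (huv : u.1 ≠ v.1) (huw : u.1 ≠ w.1) (hvw : v.1 ≠ w.1) :
    0 < gramDet (P u) (P v) (P w) := by
  have key : ∀ u v w : OctV, u.1 ≠ v.1 → u.1 ≠ w.1 → v.1 ≠ w.1 →
      OctFace u v w ∨ OctFace v u w := by decide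
  rcases key u v w huv huw hvw with hf | hf
  · exact gramDet_pos (h u v w hf)
  · rw [gramDet_comm]
    exact gramDet_pos (h v u w hf)

theorem sdist_eq_arccos (x y : S3) : sdist x y = Real.arccos (inner ℝ (x : E4) y) := by
  rw [sdist, InnerProductGeometry.angle, norm_eq_of_mem_sphere, norm_eq_of_mem_sphere, one_mul,
    div_one]

theorem cos_sdist (x y : S3) : Real.cos (sdist x y) = inner ℝ (x : E4) y := by
  rw [sdist, InnerProductGeometry.cos_angle, norm_eq_of_mem_sphere, norm_eq_of_mem_sphere, one_mul,
    div_one]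

theorem sin_sdist (x y : S3) : Real.sin (sdist x y) = sinDist x y := by
  rw [sdist_eq_arccos, Real.sin_arccos, sinDist]

/-- The angle at `u` of the spherical triangle `u v w`. -/
def triangleAngle (u v w : E4) : ℝ := Real.arccos (cosAngle u v w)

theorem faceAngle_eq {P : OctV → S3} {ℓ : OctEdge → ℝ} (h : HasEdgeLengths P ℓ) {u v w : OctV}
    (huv : u.1 ≠ v.1) (huw : u.1 ≠ w.1) (hvw : v.1 ≠ w.1) :
    faceAngle ℓ u v w huv huw hvw = triangleAngle (P u) (P v) (P w) := by
  rw [faceAngle, ← h, ← h, ← h, cos_sdist, cos_sdist, cos_sdist, sin_sdist, sin_sdist,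
    triangleAngle, cosAngle]

theorem cos_triangleAngle {u v w : S3} (h : 0 < gramDet u v w) :
    Real.cos (triangleAngle u v w) = cosAngle u v w := by
  have h1 := sinAngle_sq_add_cosAngle_sq h
  refine Real.cos_arccos ?_ ?_ <;> nlinarith [sq_nonneg (sinAngle u v w)]

theorem sin_triangleAngle {u v w : S3} (h : 0 < gramDet u v w) :
    Real.sin (triangleAngle u v w) = sinAngle u v w := by
  have h1 := sinAngle_sq_add_cosAngle_sq h
  rw [triangleAngle, Real.sin_arccos,
    show 1 - cosAngle u v w ^ 2 = sinAngle u v w ^ 2 by linarith, Real.sqrt_sq (sinAngle_pos h).le]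

/-- The representatives are multiples of `(x, 1)` and `(y, 1)`, and the relation is homogeneous of
degree two in each pair of coordinates. -/
theorem bricardRelation_affinePt {α β γ δ x y : ℝ}
    (h : BricardRelation α β γ δ (affinePt x) (affinePt y)) :
    (bricardA α β γ δ * x ^ 2 + bricardD α β γ δ) * y ^ 2 + 2 * bricardC β δ * x * y +
      (bricardB α β γ δ * x ^ 2 + bricardE α β γ δ) = 0 := by
  have hrep : ∀ x, ∃ a : ℝ, a ≠ 0 ∧ (affinePt x).rep 0 = a * x ∧ (affinePt x).rep 1 = a := by
    intro x
    obtain ⟨a, ha⟩ := Projectivization.exists_smul_eq_mk_rep ℝ ![x, 1]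
      fun h => one_ne_zero (congrFun h 1)
    refine ⟨a, a.ne_zero, ?_, ?_⟩
    · rw [affinePt, ← ha]; simp [Units.smul_def]
    · rw [affinePt, ← ha]; simp [Units.smul_def]
  obtain ⟨a, ha, ha0, ha1⟩ := hrep x
  obtain ⟨b, hb, hb0, hb1⟩ := hrep y
  simp only [BricardRelation, ha0, ha1, hb0, hb1] at h
  refine (mul_eq_zero.1 (?_ : (a ^ 2 * b ^ 2) * _ = 0)).resolve_left (by positivity)
  simp only [bricardA, bricardB, bricardC, bricardD, bricardE]
  linear_combination h

/-- The relations that define the configuration space hold in the function field. -/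
theorem coordFn_relation {ℓ : OctEdge → ℝ} {Γ : Set (OctEdge → RP1)} [(affineIdeal Γ).IsPrime]
    (hΓ : Γ ⊆ configSpace ℓ) {P : OctV → S3} (hℓ : HasEdgeLengths P ℓ) {u v w : OctV}
    (huv : u.1 ≠ v.1) (huw : u.1 ≠ w.1) (hvw : v.1 ≠ w.1) {α β γ δ : ℝ}
    (hα : α = triangleAngle (P u) (P v) (P w)) (hβ : β = triangleAngle (P u) (P w) (P (opp v)))
    (hγ : γ = triangleAngle (P u) (P (opp v)) (P (opp w)))
    (hδ : δ = triangleAngle (P u) (P (opp w)) (P v)) :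
    (algebraMap ℝ (FunctionField Γ) (bricardA α β γ δ) * coordFn Γ (edge u v huv) ^ 2 +
        algebraMap ℝ (FunctionField Γ) (bricardD α β γ δ)) * coordFn Γ (edge u w huw) ^ 2 +
      2 * algebraMap ℝ (FunctionField Γ) (bricardC β δ) * coordFn Γ (edge u v huv) *
        coordFn Γ (edge u w huw) +
      (algebraMap ℝ (FunctionField Γ) (bricardB α β γ δ) * coordFn Γ (edge u v huv) ^ 2 +
        algebraMap ℝ (FunctionField Γ) (bricardE α β γ δ)) = 0 := by
  let X := fun e : OctEdge => (MvPolynomial.X e : MvPolynomial OctEdge ℝ)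
  let c := (MvPolynomial.C : ℝ →+* MvPolynomial OctEdge ℝ)
  have hmem : (c (bricardA α β γ δ) * X (edge u v huv) ^ 2 + c (bricardD α β γ δ)) *
      X (edge u w huw) ^ 2 + 2 * c (bricardC β δ) * X (edge u v huv) * X (edge u w huw) +
      (c (bricardB α β γ δ) * X (edge u v huv) ^ 2 + c (bricardE α β γ δ)) ∈ affineIdeal Γ := by
    rw [affineIdeal, MvPolynomial.mem_vanishingIdeal_iff]
    intro x hx
    have h1 : BricardRelation α β γ δ (affinePt (x (edge u v huv)))
        (affinePt (x (edge u w huw))) := by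
      rw [hα, hβ, hγ, hδ, ← faceAngle_eq hℓ huv huw hvw,
        ← faceAngle_eq hℓ (w := opp v) huw huv hvw.symm,
        ← faceAngle_eq hℓ (v := opp v) (w := opp w) huv huw hvw,
        ← faceAngle_eq hℓ (v := opp w) huw huv hvw.symm]
      exact hΓ hx u v w huv huw hvw
    have h2 := bricardRelation_affinePt h1
    simpa [X, c] using h2
  have h0 := congrArg (algebraMap (MvPolynomial OctEdge ℝ ⧸ affineIdeal Γ) (FunctionField Γ))
    (Ideal.Quotient.eq_zero_iff_mem.2 hmem)
  have hc : ∀ r : ℝ, algebraMap (MvPolynomial OctEdge ℝ ⧸ affineIdeal Γ) (FunctionField Γ)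
      (Ideal.Quotient.mk (affineIdeal Γ) (c r)) = algebraMap ℝ (FunctionField Γ) r := fun r => by
    rw [IsScalarTower.algebraMap_apply ℝ (MvPolynomial OctEdge ℝ ⧸ affineIdeal Γ)
      (FunctionField Γ)]
    rfl
  have hX : ∀ e, algebraMap (MvPolynomial OctEdge ℝ ⧸ affineIdeal Γ) (FunctionField Γ)
      (Ideal.Quotient.mk (affineIdeal Γ) (X e)) = coordFn Γ e := fun _ => rfl
  simpa only [map_add, map_mul, map_pow, map_ofNat, map_zero, hc, hX] using h0

/-- The consequences of the degree conditions that are used below. -/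
structure ExoticFields {L : Type} [Field L] [Algebra ℝ L] (t₁ t₂ t₃ : L) : Prop where
  fst : Transcendental ℝ t₁
  snd : Transcendental ℝ t₂
  thd : t₃ ≠ 0
  thd_fst : t₃ ∈ IntermediateField.adjoin ℝ {t₁}
  thd_snd : t₃ ∈ IntermediateField.adjoin ℝ {t₂}
  fst_thd : t₁ ∉ IntermediateField.adjoin ℝ {t₃}
  snd_thd : t₂ ∉ IntermediateField.adjoin ℝ {t₃}
  snd_fst : t₂ ∉ IntermediateField.adjoin ℝ {t₁}
  fst_snd : t₁ ∉ IntermediateField.adjoin ℝ {t₂}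

theorem ExoticFields.symm {L : Type} [Field L] [Algebra ℝ L] {t₁ t₂ t₃ : L}
    (h : ExoticFields t₁ t₂ t₃) : ExoticFields t₂ t₁ t₃ :=
  ⟨h.snd, h.fst, h.thd, h.thd_snd, h.thd_fst, h.snd_thd, h.fst_thd, h.fst_snd, h.snd_fst⟩

/-- If `t` were algebraic, `L` would be finite over `ℝ(t)` and `ℝ(t)` finite over `ℝ`. -/
theorem transcendental_of_finrank {L : Type} [Field L] [Algebra ℝ L] (htr : Algebra.trdeg ℝ L = 1)
    {t : L} (h : 0 < Module.finrank (IntermediateField.adjoin ℝ {t}) L) : Transcendental ℝ t := by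
  intro ht
  have h1 : Module.Finite (IntermediateField.adjoin ℝ {t}) L := Module.finite_of_finrank_pos h
  have h2 : Module.Finite ℝ (IntermediateField.adjoin ℝ {t}) :=
    IntermediateField.adjoin.finiteDimensional ht.isIntegral
  have h3 : Module.Finite ℝ L := Module.Finite.trans (IntermediateField.adjoin ℝ {t}) L
  have h4 : Algebra.trdeg ℝ L = 0 := trdeg_eq_zero
  rw [h4] at htr
  exact zero_ne_one htr

/-- Relative degree two makes the inclusions of `ℝ(t₃)` proper. If `t₂` were in `ℝ(t₁)`, then
`ℝ(t₂)` would lie in the intersection `ℝ(t₃)`; likewise for `t₁` in `ℝ(t₂)`. -/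
theorem IsExoticTriple.exoticFields {L : Type} [Field L] [Algebra ℝ L] {t₁ t₂ t₃ : L}
    (htr : Algebra.trdeg ℝ L = 1) (h : IsExoticTriple t₁ t₂ t₃) : ExoticFields t₁ t₂ t₃ := by
  obtain ⟨hinf, h3, h1, h2, h31, h32⟩ := h
  have hle : ∀ {x : L} {F : IntermediateField ℝ L}, x ∈ F → IntermediateField.adjoin ℝ {x} ≤ F :=
    fun hx => IntermediateField.adjoin_simple_le_iff.2 hx
  have hm3 := IntermediateField.mem_adjoin_simple_self ℝ t₃
  have hne : ∀ {A B : IntermediateField ℝ L}, IntermediateField.relfinrank A B = 2 → ¬ B ≤ A :=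
    fun h hle => by
      rw [IntermediateField.relfinrank_eq_one_iff.2 hle] at h
      omega
  have n13 := hne h31
  have n23 := hne h32
  refine ⟨transcendental_of_finrank htr (by omega), transcendental_of_finrank htr (by omega),
    transcendental_ne_zero (transcendental_of_finrank htr (by omega)),
    (hinf.le hm3).1, (hinf.le hm3).2, fun h => n13 (hle h), fun h => n23 (hle h),
    fun h => n23 ?_, fun h => n13 ?_⟩
  · rw [hinf]; exact le_inf (hle h) le_rfl
  · rw [hinf]; exact le_inf le_rfl (hle h)

theorem edge_comm (u v : OctV) (h : u.1 ≠ v.1) : edge u v h = edge v u h.symm :=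
  Subtype.ext Sym2.eq_swap

theorem faceEdge_eq {i j k : Fin 3} (hij : i ≠ j) (hik : i ≠ k) (hjk : j ≠ k) :
    faceEdge i = edge (j, false) (k, false) hjk := by
  have key : ∀ i j k : Fin 3, i ≠ j → i ≠ k → j ≠ k →
      (j = i + 1 ∧ k = i + 2) ∨ (j = i + 2 ∧ k = i + 1) := by decide
  rcases key i j k hij hik hjk with ⟨rfl, rfl⟩ | ⟨rfl, rfl⟩
  · rfl
  · rw [edge_comm]; rfl

/-! ### From exotic function fields to Gram relations -/

section Exotic

variable {ℓ : OctEdge → ℝ} {Γ : Set (OctEdge → RP1)} [(affineIdeal Γ).IsPrime] {P : OctV → S3}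

/-- The relations for the links of the vertices `a_i`, `a_j`, `a_k`. -/
theorem coordFn_relations (hΓ : Γ ⊆ configSpace ℓ) (hℓ : HasEdgeLengths P ℓ) {i j k : Fin 3}
    (hij : i ≠ j) (hik : i ≠ k) (hjk : j ≠ k) :
    let c := algebraMap ℝ (FunctionField Γ)
    let t₁ := coordFn Γ (edge (j, false) (k, false) hjk)
    let t₂ := coordFn Γ (edge (i, false) (k, false) hik)
    let t₃ := coordFn Γ (edge (i, false) (j, false) hij)
    let α₁ := triangleAngle (P (i, false)) (P (k, false)) (P (j, false))
    let β₁ := triangleAngle (P (i, false)) (P (j, false)) (P (k, true))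
    let γ₁ := triangleAngle (P (i, false)) (P (k, true)) (P (j, true))
    let δ₁ := triangleAngle (P (i, false)) (P (j, true)) (P (k, false))
    let α₂ := triangleAngle (P (j, false)) (P (k, false)) (P (i, false))
    let β₂ := triangleAngle (P (j, false)) (P (i, false)) (P (k, true))
    let γ₂ := triangleAngle (P (j, false)) (P (k, true)) (P (i, true))
    let δ₂ := triangleAngle (P (j, false)) (P (i, true)) (P (k, false))
    let α₃ := triangleAngle (P (k, false)) (P (j, false)) (P (i, false))
    let β₃ := triangleAngle (P (k, false)) (P (i, false)) (P (j, true))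
    let γ₃ := triangleAngle (P (k, false)) (P (j, true)) (P (i, true))
    let δ₃ := triangleAngle (P (k, false)) (P (i, true)) (P (j, false))
    (c (bricardA α₁ β₁ γ₁ δ₁) * t₂ ^ 2 + c (bricardD α₁ β₁ γ₁ δ₁)) * t₃ ^ 2 +
        2 * c (bricardC β₁ δ₁) * t₂ * t₃ +
        (c (bricardB α₁ β₁ γ₁ δ₁) * t₂ ^ 2 + c (bricardE α₁ β₁ γ₁ δ₁)) = 0 ∧
      (c (bricardA α₂ β₂ γ₂ δ₂) * t₁ ^ 2 + c (bricardD α₂ β₂ γ₂ δ₂)) * t₃ ^ 2 +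
        2 * c (bricardC β₂ δ₂) * t₁ * t₃ +
        (c (bricardB α₂ β₂ γ₂ δ₂) * t₁ ^ 2 + c (bricardE α₂ β₂ γ₂ δ₂)) = 0 ∧
      (c (bricardA α₃ β₃ γ₃ δ₃) * t₁ ^ 2 + c (bricardD α₃ β₃ γ₃ δ₃)) * t₂ ^ 2 +
        2 * c (bricardC β₃ δ₃) * t₁ * t₂ +
        (c (bricardB α₃ β₃ γ₃ δ₃) * t₁ ^ 2 + c (bricardE α₃ β₃ γ₃ δ₃)) = 0 := by
  refine ⟨?_, ?_, ?_⟩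
  · exact coordFn_relation hΓ hℓ (u := (i, false)) (v := (k, false)) (w := (j, false)) hik hij
      hjk.symm rfl rfl rfl rfl
  · rw [edge_comm (i, false) (j, false)]
    exact coordFn_relation hΓ hℓ (u := (j, false)) (v := (k, false)) (w := (i, false)) hjk
      hij.symm hik.symm rfl rfl rfl rfl
  · rw [edge_comm (i, false) (k, false), edge_comm (j, false) (k, false)]
    exact coordFn_relation hΓ hℓ (u := (k, false)) (v := (j, false)) (w := (i, false)) hjk.symm
      hik.symm hij.symm rfl rfl rfl rfl

/-- The octahedra whose links at `a_i` and `a_j` are an antikite and a kite. -/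
theorem flexGram_of_kite_antikite (hΓ : Γ ⊆ configSpace ℓ) (hℓ : HasEdgeLengths P ℓ)
    (hP : IsNondegenerate octahedron P) {i j k : Fin 3} (hij : i ≠ j) (hik : i ≠ k) (hjk : j ≠ k)
    (hex : ExoticFields (coordFn Γ (edge (j, false) (k, false) hjk))
      (coordFn Γ (edge (i, false) (k, false) hik)) (coordFn Γ (edge (i, false) (j, false) hij)))
    {a₁ b₁ a₂ b₂ a₃ b₃ : S3} (ha₁ : a₁ = P (i, false)) (hb₁ : b₁ = P (i, true))
    (ha₂ : a₂ = P (j, false)) (hb₂ : b₂ = P (j, true)) (ha₃ : a₃ = P (k, false))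
    (hb₃ : b₃ = P (k, true))
    (hA : bricardA (triangleAngle a₁ a₃ a₂) (triangleAngle a₁ a₂ b₃) (triangleAngle a₁ b₃ b₂)
      (triangleAngle a₁ b₂ a₃) = 0)
    (hD : bricardD (triangleAngle a₁ a₃ a₂) (triangleAngle a₁ a₂ b₃) (triangleAngle a₁ b₃ b₂)
      (triangleAngle a₁ b₂ a₃) = 0)
    (hB : bricardB (triangleAngle a₂ a₃ a₁) (triangleAngle a₂ a₁ b₃) (triangleAngle a₂ b₃ b₁)
      (triangleAngle a₂ b₁ a₃) = 0)
    (hE : bricardE (triangleAngle a₂ a₃ a₁) (triangleAngle a₂ a₁ b₃) (triangleAngle a₂ b₃ b₁)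
      (triangleAngle a₂ b₁ a₃) = 0) :
    ∃ p q : Bool → ℝ, FlexGram p q (fun v => P (![i, j, k] v.1, v.2)) ∧
      |p false| ≠ |p true| ∧ |q false| ≠ |q true| ∧ ∀ i j, p i ^ 2 + q j ^ 2 < 1 := by
  have hidx : ∀ m n : Fin 3, m ≠ n → ![i, j, k] m ≠ ![i, j, k] n := by
    intro m n hmn
    fin_cases m <;> fin_cases n <;> simp_all [eq_comm]
  have hG : ∀ u v w : OctV, u.1 ≠ v.1 → u.1 ≠ w.1 → v.1 ≠ w.1 →
      0 < gramDet (P (![i, j, k] u.1, u.2)) (P (![i, j, k] v.1, v.2)) (P (![i, j, k] w.1, w.2)) :=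
    fun u v w h1 h2 h3 => gramDet_pos_of_isNondegenerate hP (hidx _ _ h1) (hidx _ _ h2) (hidx _ _ h3)
  have hcos : ∀ {l m n : Fin 3}, l ≠ m → l ≠ n → m ≠ n → ∀ b c d,
      Real.cos (triangleAngle (P (l, b)) (P (m, c)) (P (n, d))) =
        cosAngle (P (l, b)) (P (m, c)) (P (n, d)) := fun h1 h2 h3 b c d =>
    cos_triangleAngle (gramDet_pos_of_isNondegenerate hP h1 h2 h3)
  have hsin : ∀ {l m n : Fin 3}, l ≠ m → l ≠ n → m ≠ n → ∀ b c d,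
      Real.sin (triangleAngle (P (l, b)) (P (m, c)) (P (n, d))) =
        sinAngle (P (l, b)) (P (m, c)) (P (n, d)) := fun h1 h2 h3 b c d =>
    sin_triangleAngle (gramDet_pos_of_isNondegenerate hP h1 h2 h3)
  have hpos : ∀ {l m n : Fin 3}, l ≠ m → l ≠ n → m ≠ n → ∀ b c d,
      0 < Real.sin (triangleAngle (P (l, b)) (P (m, c)) (P (n, d))) := fun h1 h2 h3 b c d => by
    rw [hsin h1 h2 h3]
    exact sinAngle_pos (gramDet_pos_of_isNondegenerate hP h1 h2 h3)
  have hC : ∀ {β δ : ℝ}, 0 < Real.sin β → 0 < Real.sin δ → bricardC β δ ≠ 0 := fun h1 h2 =>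
    mul_ne_zero (mul_ne_zero (by norm_num) h1.ne') h2.ne'
  obtain ⟨r1, r2, r3⟩ := coordFn_relations hΓ hℓ hij hik hjk
  simp only [← ha₁, ← ha₂, ← ha₃, ← hb₁, ← hb₂, ← hb₃] at r1 r2 r3
  rw [hA, hD, map_zero, zero_mul, zero_add, zero_mul, zero_add] at r1
  rw [hB, hE, map_zero, zero_mul, zero_add, add_zero] at r2
  subst ha₁ hb₁ ha₂ hb₂ ha₃ hb₃
  obtain ⟨⟨hB₁, hE₁⟩, ⟨hA₂, hD₂⟩, hA₃, hB₃, hD₃, hE₃⟩ := kite_antikite_proportional hex.fst hex.snd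
    hex.thd hex.fst_thd hex.snd_thd hex.snd_fst
    (hC (hpos hij hik hjk _ _ _) (hpos hij hik hjk _ _ _))
    (hC (hpos hij.symm hjk hik _ _ _) (hpos hij.symm hjk hik _ _ _)) r1 r2 r3
  obtain ⟨n1, -, n2⟩ := antikite_cos (hpos hik hij hjk.symm _ _ _) (hpos hij hik hjk _ _ _)
    (hpos hij hik hjk _ _ _) hA hD
  obtain ⟨k1, -, k2⟩ := kite_cos (hpos hjk hij.symm hik.symm _ _ _) (hpos hij.symm hjk hik _ _ _)
    (hpos hij.symm hjk hik _ _ _) hB hE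
  obtain ⟨⟨d1, d2⟩, s1, s2, s3, s4⟩ := kite_antikite_cos (hpos hik hij hjk.symm _ _ _)
    (hpos hij hik hjk _ _ _) (hpos hij hik hjk _ _ _) (hpos hjk hij.symm hik.symm _ _ _)
    (hpos hij.symm hjk hik _ _ _) (hpos hij.symm hjk hik _ _ _) (hpos hik.symm hjk.symm hij _ _ _)
    (hpos hik.symm hjk.symm hij _ _ _) hA hD hB hE hB₁ hE₁ hA₂ hD₂ hA₃ hB₃ hD₃ hE₃
  simp only [hcos hij hik hjk, hcos hik hij hjk.symm, hcos hij.symm hjk hik,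
    hcos hjk hij.symm hik.symm, hcos hik.symm hjk.symm hij, hcos hjk.symm hik.symm hij.symm,
    hsin hij hik hjk, hsin hik hij hjk.symm, hsin hij.symm hjk hik,
    hsin hjk hij.symm hik.symm, hsin hik.symm hjk.symm hij, hsin hjk.symm hik.symm hij.symm]
    at n1 n2 k1 k2 d1 d2 s1 s2 s3 s4
  exact flexGram_of_angles (Q := fun v => P (![i, j, k] v.1, v.2)) hG rfl rfl rfl rfl rfl rfl
    k1 k2 n1 n2 d1 d2 s1 s2 s3 s4

/-- Up to a permutation of the indices, the octahedra with exotic configuration curve have the Gram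
matrices of the explicit family. -/
theorem exists_flexGram_of_exoticFields (hΓ : Γ ⊆ configSpace ℓ) (hℓ : HasEdgeLengths P ℓ)
    (hP : IsNondegenerate octahedron P) (ρ : Equiv.Perm (Fin 3))
    (hex : ExoticFields (coordFn Γ (faceEdge (ρ 0))) (coordFn Γ (faceEdge (ρ 1)))
      (coordFn Γ (faceEdge (ρ 2)))) :
    ∃ (ρ' : Equiv.Perm (Fin 3)) (p q : Bool → ℝ), FlexGram p q (P ∘ reindex ρ') ∧
      |p false| ≠ |p true| ∧ |q false| ≠ |q true| ∧ ∀ i j, p i ^ 2 + q j ^ 2 < 1 := by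
  have h01 : ρ 0 ≠ ρ 1 := ρ.injective.ne (by decide)
  have h02 : ρ 0 ≠ ρ 2 := ρ.injective.ne (by decide)
  have h12 : ρ 1 ≠ ρ 2 := ρ.injective.ne (by decide)
  have hrel : ∀ ρ' : Equiv.Perm (Fin 3),
      (fun v : OctV => P (![ρ' 0, ρ' 1, ρ' 2] v.1, v.2)) = P ∘ reindex ρ' := fun ρ' => by
    funext ⟨n, b⟩
    fin_cases n <;> rfl
  rw [faceEdge_eq h01 h02 h12, faceEdge_eq h01.symm h12 h02, faceEdge_eq h02.symm h12.symm h01] at hex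
  have hpos : ∀ {l m n : Fin 3}, l ≠ m → l ≠ n → m ≠ n → ∀ b c d,
      0 < Real.sin (triangleAngle (P (l, b)) (P (m, c)) (P (n, d))) := fun h1 h2 h3 b c d => by
    have hG : 0 < gramDet (P (_, b)) (P (_, c)) (P (_, d)) :=
      gramDet_pos_of_isNondegenerate hP h1 h2 h3
    rw [sin_triangleAngle hG]
    exact sinAngle_pos hG
  have hC : ∀ {β δ : ℝ}, 0 < Real.sin β → 0 < Real.sin δ → bricardC β δ ≠ 0 := fun h1 h2 =>
    mul_ne_zero (mul_ne_zero (by norm_num) h1.ne') h2.ne'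
  obtain ⟨r1, r2, r3⟩ := coordFn_relations hΓ hℓ h01 h02 h12
  rcases kite_antikite hex.fst hex.snd hex.thd hex.thd_fst hex.thd_snd hex.fst_thd hex.snd_thd
    hex.snd_fst (hC (hpos h01 h02 h12 _ _ _) (hpos h01 h02 h12 _ _ _))
    (hC (hpos h01.symm h12 h02 _ _ _) (hpos h01.symm h12 h02 _ _ _))
    (hC (hpos h02.symm h12.symm h01 _ _ _) (hpos h02.symm h12.symm h01 _ _ _)) r1 r2 r3 with
    ⟨hA, hD, hB, hE⟩ | ⟨hB, hE, hA, hD⟩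
  · obtain ⟨p, q, hF, h⟩ := flexGram_of_kite_antikite hΓ hℓ hP h01 h02 h12 hex rfl rfl rfl rfl rfl
      rfl hA hD hB hE
    exact ⟨ρ, p, q, hrel ρ ▸ hF, h⟩
  -- Here the kite is at the first vertex and the antikite at the second, so the two indices are
  -- exchanged.
  · have hex' := hex.symm
    rw [edge_comm (ρ 0, false) (ρ 1, false)] at hex'
    obtain ⟨p, q, hF, h⟩ := flexGram_of_kite_antikite hΓ hℓ hP h01.symm h12 h02 hex' rfl rfl rfl
      rfl rfl rfl hA hD hB hE
    exact ⟨ρ * Equiv.swap 0 1, p, q, hrel (ρ * Equiv.swap 0 1) ▸ hF, h⟩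

end Exotic

theorem isInducedByIsometries_of_reindex {P : I → OctV → S3} {ρ : Equiv.Perm (Fin 3)}
    (h : IsInducedByIsometries fun s => P s ∘ reindex ρ) : IsInducedByIsometries P := by
  obtain ⟨g, hg, hP⟩ := h
  refine ⟨g, hg, fun t v => ?_⟩
  simpa using hP t ((reindex ρ).symm v)

theorem inner_eq_of_hasEdgeLengths {P Q : OctV → S3} {ℓ : OctEdge → ℝ} (hP : HasEdgeLengths P ℓ)
    (hQ : HasEdgeLengths Q ℓ) {u v : OctV} (huv : u.1 ≠ v.1) :
    inner ℝ (P u : E4) (P v) = inner ℝ (Q u : E4) (Q v) := by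
  rw [← cos_sdist, ← cos_sdist, hP u v huv, hQ u v huv]

theorem FlexGram.of_inner_eq {p q : Bool → ℝ} {P Q : OctV → S3} (hQ : FlexGram p q Q)
    (h : ∀ u v : OctV, u.1 ≠ v.1 → inner ℝ (P u : E4) (P v) = inner ℝ (Q u : E4) (Q v)) :
    FlexGram p q P := by
  refine ⟨fun i j => ?_, fun i k => ?_, fun j => ?_, fun j => ?_⟩ <;> rw [h _ _ (by simp)]
  exacts [hQ.fst_snd i j, hQ.fst_thd i k, hQ.snd_thd j, hQ.snd_thd' j]

/-- The relations `FlexGram` concern edges only, so they pass from parameter `0` to the whole flex.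
The relabelling of the vertices carries the set of antipodes along. -/
theorem isCounterexample_of_isExoticFlexibleOctahedron {P : I → OctV → S3}
    (h : IsExoticFlexibleOctahedron P) : IsCounterexample octahedron P := by
  obtain ⟨hflex, ℓ, Γ, hcomp, -, ⟨hprime, htr, ρ, hex⟩, hP⟩ := h
  refine ⟨hflex, fun S hS => ?_⟩
  obtain ⟨ρ', p, q, hF, hp, hq, hpq⟩ := exists_flexGram_of_exoticFields hcomp.2.1 (hP 0).1
    (hflex.nondegenerate 0) ρ (hex.exoticFields htr)
  have hF' : ∀ s, FlexGram p q (P s ∘ reindex ρ') := fun s => hF.of_inner_eq fun u v huv =>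
    inner_eq_of_hasEdgeLengths (hP s).1 (hP 0).1 (ρ'.injective.ne huv)
  refine not_hasConstantVolume_antipodes (P := fun s => P s ∘ reindex ρ')
    (continuous_pi fun v => (continuous_apply _).comp hflex.continuous) hF' hp hq hpq
    (fun hI => hflex.not_induced (isInducedByIsometries_of_reindex hI)) (reindex ρ' ⁻¹' S) ?_
  exact hasConstantVolume_reindex
    (fun s => isNondegenerate_antipodes S (hflex.nondegenerate s)) ρ' hS

end SphericalOctahedra

end

/-! ### Assembly of the three statements -/

open scoped unitInterval in
open SphericalOctahedra in
theorem theorem1 :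
    (∀ p₁ p₂ q₁ q₂ : ℝ, |p₁| ≠ |p₂| → |q₁| ≠ |q₂| →
      max (p₁ ^ 2) (p₂ ^ 2) + max (q₁ ^ 2) (q₂ ^ 2) < 1 →
      (∀ P : I → OctV → S3, Continuous P → (∀ s, P s ∈ configCurve p₁ p₂ q₁ q₂) →
        ¬ IsInducedByIsometries P →
        ∀ S : Set OctV, ¬ HasConstantVolume octahedron fun s => antipodes S (P s)) ∧
      (∀ δ₁ δ₂ ε₁ ε₂ : ℤˣ, ∃ P : I → OctV → S3,
        (∀ (s : I) (v : OctV), (P s v : E4) = flexVertex p₁ p₂ q₁ q₂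
          ((1 - s) * thetaMin q₁ q₂ + s * thetaMax p₁ p₂) δ₁ δ₂ ε₁ ε₂ v) ∧
        IsCounterexample octahedron P)) ∧
    (∀ P : I → OctV → S3, IsExoticFlexibleOctahedron P → IsCounterexample octahedron P) ∧
    ¬ ModifiedBellowsConjecture := by
  exact ⟨fun p₁ p₂ q₁ q₂ hp hq hpq => ⟨fun P hP hC hI S =>
      not_hasConstantVolume_of_configCurve hp hq hpq hP hC hI S,
      exists_counterexample hp hq hpq⟩,
    fun P hP => isCounterexample_of_isExoticFlexibleOctahedron hP, not_modifiedBellowsConjecture⟩
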